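/- All words and matrices are over $\mathbb F_2$; $\lambda\ge 1$ is the security parameter. An algorithm is *probabilistic polynomial time* (PPT) if it is a fixed program on finitely many bit stacks, which may also draw a uniformly random element of $\{0,\dots,N-1\}$ ($N$ being the length of a stack), and which on every input, for all random choices, halts after a number of steps polynomial in the input length. Keys are tuples of bit strings, and every algorithm and every adversary receives $1^\lambda$. A family of two distributions (case $b=0$, case $b=1$) is *indistinguishable* if for every PPT adversary $\mathcal A$ there is a negligible $\varepsilon$ such that $|\Pr[\mathcal A\text{ outputs } b]-\tfrac12|<\varepsilon(\lambda)$ for all $\lambda\ge1$, where $b\in\{0,1\}$ is uniform and $\mathcal A$ gets one sample of case $b$. Adversaries also receive $1^{n(\lambda)}$ and $1^{k(\lambda)}$. **Robust secret encryption.** Let $n,k:\mathbb N\to\mathbb N$ and $\delta:\mathbb N\to\mathbb R$. PPT algorithms $(\mathsf{Gen},\mathsf{Enc},\mathsf{Dec})$ form an $(n,k,\delta)$-RSE if, for $n=n(\lambda)$, $k=k(\lambda)$, $\delta=\delta(\lambda)$: (i) for every key $sk$ in the range of $\mathsf{Gen}(1^\lambda)$, every $x\in\mathbb F_2^k$, every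 possible output $y\in\mathbb F_2^n$ of $\mathsf{Enc}_{sk}(x)$, and every $y'\in\mathbb F_2^n$ at Hamming distance at most $\delta n$ from $y$, one has $\mathsf{Dec}_{sk}(y')=x$ with probability $1$; (ii) for every polynomially bounded $q:\mathbb N\to\mathbb N$, the following are indistinguishable: ($b=0$) $q(\lambda)$ encodings, under one key $sk\leftarrow\mathsf{Gen}(1^\lambda)$, of independent uniform messages in $\mathbb F_2^k$; ($b=1$) $q(\lambda)$ independent uniform words in $\mathbb F_2^n$ (here the adversary also receives $1^{q(\lambda)}$). **Goppa codes.** For $g\in\mathbb F_{2^m}[z]$ and distinct $\alpha_1,\dots,\alpha_n\in\mathbb F_{2^m}$ with $g(\alpha_i)\ne0$, the binary Goppa code is $\{c\in\mathbb F_2^n:\sum_i \frac{c_i}{z-\alpha_i}\equiv 0 \bmod g(z)\}$. **Theorem.** Let $n,k,m,t:\mathbb N\to\mathbb N$ with $k(\lambda)>0$, and let $\delta(\lambda)>0$ (for instance, $\delta$ a constant). Let there be given a random $[n,k]$ Goppa code with encoding and decoding algorithms, tolerant to $\lambda+\delta n$ errors; that is: a PPT algorithm that on input $1^\lambda$ samples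 a key consisting of a generator matrix $G\in\mathbb F_2^{k\times n}$ (rows a basis) of a binary Goppa code with $\deg g\le t(\lambda)$ over $\mathbb F_{2^{m(\lambda)}}$, $m(\lambda)\geq 1$, together with any further data for the decoder, and a PPT decoder that for each such key recovers $x$ with probability $1$ from every word at distance at most $\lambda+\delta n$ from $xG$, for all $x\in\mathbb F_2^k$. Assume 1. (average decoding hardness) the following are indistinguishable: ($b=0$) $(R,\,xR+e)$ with $R\in\mathbb F_2^{k\times n}$, $x\in\mathbb F_2^k$ and $e\in\mathbb F_2^n$ of Hamming weight $\lambda$, all uniform; ($b=1$) $(R,u)$ with $R\in\mathbb F_2^{k\times n}$ and $u\in\mathbb F_2^n$ uniform; 2. (Goppa codes are indistinguishable from random codes) the following are indistinguishable: ($b=0$) a uniform matrix in $\mathbb F_2^{k\times n}$; ($b=1$) the generator matrix $G$ of the sampled Goppa code. Then the scheme whose $\mathsf{Gen}$ samples the Goppa code key, whose $\mathsf{Enc}_{sk}(x)$ outputs $xG+z$ with $z\in\mathbb F_2^n$ uniform of Hamming weight $\lambda$, and whose $\mathsf{Dec}_{sk}$ is the Goppa code's decoder, is an $(n,k,\delta)$-RSE.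 -/

import Mathlib

open scoped Polynomial

noncomputable section

namespace RobustEnc

/-! ### Machine model

A program works on registers, each of which is a stack of bits. Every step costs one unit of time.
Besides the usual stack operations there is an instruction for exact uniform sampling.
A program is a single finite object: it does not depend on the security parameter. -/

/-- Contents of the registers. -/
abbrev Store := ℕ → List Bool

/-- Programs. -/
inductive Prog : Type
  | skip : Prog
  /-- push the bit `b` onto register `r` -/
  | push (b : Bool) (r : ℕ) : Prog
  /-- remove the top bit of register `r` (no effect on an empty register) -/
  | pop (r : ℕ) : Prog
  /-- overwrite register `s` with a uniformly random element of `{0, …, N - 1}` in unary, where `N`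
  is the length of register `r` (with the empty string if `N = 0`) -/
  | draw (r s : ℕ) : Prog
  /-- sequential composition -/
  | seq (p q : Prog) : Prog
  /-- continue with `p`, `q`, `u` if register `r` is empty, has top bit `false`, has top bit `true` -/
  | branch (r : ℕ) (p q u : Prog) : Prog
  /-- repeat `p` as long as register `r` is non-empty -/
  | loop (r : ℕ) (p : Prog) : Prog

/-- A configuration: the programs still to be executed, and the registers.
The machine has halted when nothing is left to be executed. -/
abbrev Cfg := List Prog × Store

/-- One step of the machine. -/
def step : Cfg → PMF Cfg
  | ([], s) => PMF.pure ([], s)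
  | (Prog.skip :: K, s) => PMF.pure (K, s)
  | (Prog.push b r :: K, s) => PMF.pure (K, Function.update s r (b :: s r))
  | (Prog.pop r :: K, s) => PMF.pure (K, Function.update s r (s r).tail)
  | (Prog.draw r t :: K, s) =>
      match (s r).length with
      | 0 => PMF.pure (K, Function.update s t [])
      | N + 1 => (PMF.uniformOfFintype (Fin (N + 1))).map
          fun i => (K, Function.update s t (List.replicate (i : ℕ) true))
  | (Prog.seq p q :: K, s) => PMF.pure (p :: q :: K, s)
  | (Prog.branch r p q u :: K, s) =>
      match s r with
      | [] => PMF.pure (p :: K, s)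
      | false :: _ => PMF.pure (q :: K, s)
      | true :: _ => PMF.pure (u :: K, s)
  | (Prog.loop r p :: K, s) =>
      match s r with
      | [] => PMF.pure (K, s)
      | _ :: _ => PMF.pure (p :: Prog.loop r p :: K, s)

/-- The distribution of the configuration after `T` steps. -/
def run : ℕ → Cfg → PMF Cfg
  | 0, c => PMF.pure c
  | T + 1, c => (step c).bind (run T)

/-- The input strings are placed in registers `0, 1, 2, …`; all other registers are empty. -/
def load (inp : List (List Bool)) : Store := fun i => inp.getD i []

/-- The length of an input. -/
def inputSize (inp : List (List Bool)) : ℕ := (inp.map List.length).sum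

/-- A probabilistic polynomial time algorithm: a program that, on every input and for every outcome
of its random choices, halts within a number of steps that is polynomial in the input length. -/
structure PPT where
  prog : Prog
  time : Polynomial ℕ
  halts : ∀ inp : List (List Bool),
    ∀ c ∈ (run (time.eval (inputSize inp)) ([prog], load inp)).support, c.1 = []

/-- The distribution of the registers when the algorithm has halted. -/
def PPT.out (A : PPT) (inp : List (List Bool)) : PMF Store :=
  (run (A.time.eval (inputSize inp)) ([A.prog], load inp)).map Prod.snd

/-! ### Words, matrices, bit strings -/

/-- Words of length `n` over the field with two elements. -/
abbrev Word (n : ℕ) := Fin n → ZMod 2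

/-- `1^l` -/
def unary (l : ℕ) : List Bool := List.replicate l true

def wordBits {n : ℕ} (x : Word n) : List Bool := List.ofFn fun i => decide (x i = 1)

/-- The entries of a matrix, row by row. -/
def matBits {k n : ℕ} (G : Matrix (Fin k) (Fin n) (ZMod 2)) : List Bool :=
  (List.ofFn fun i => wordBits (G i)).flatten

/-! ### Distinguishing games -/

/-- `ε` decays faster than the inverse of every polynomial. -/
def Negligible (ε : ℕ → ℝ) : Prop :=
  Asymptotics.SuperpolynomialDecay Filter.atTop (fun l : ℕ => (l : ℝ)) ε

/-- The game in which the challenger picks a uniform bit `b` and sends a sample of `D b` to the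
adversary, who answers with a bit `b'` (its answer is `true` iff register `0` has top bit `true`).
The outcome is `true` iff `b' = b`. -/
def game (A : PPT) (D : Bool → PMF (List (List Bool))) : PMF Bool := do
  let b ← PMF.uniformOfFintype Bool
  let inp ← D b
  let s ← A.out inp
  return ((s 0).head? == some true) == b

/-- The probability that the adversary wins. -/
def winProb (A : PPT) (D : Bool → PMF (List (List Bool))) : ℝ := (game A D true).toReal

/-- No probabilistic polynomial time adversary wins the games `D l` (`l` the security parameter)
with probability noticeably different from `1/2`. -/
def Indistinguishable (D : ℕ → Bool → PMF (List (List Bool))) : Prop :=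
  ∀ A : PPT, ∃ ε : ℕ → ℝ, Negligible ε ∧ ∀ l, 0 < l → |winProb A (D l) - 1 / 2| < ε l

/-- Independent samples. -/
def iid {α : Type} (μ : PMF α) : ℕ → PMF (List α)
  | 0 => PMF.pure []
  | q + 1 => do
      let x ← μ
      let xs ← iid μ q
      return x :: xs

/-! ### Robust secret encryption -/

/-- A secret key encoding scheme with messages of length `k` and encodings of length `n`, both
depending on the security parameter. Keys are given to algorithms as a fixed number of bit strings.
-/
structure SecretCode (n k : ℕ → ℕ) where
  Key : ℕ → Type
  arity : ℕ
  keyBits : ∀ {l : ℕ}, Key l → Fin arity → List Bool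
  Gen : ∀ l : ℕ, PMF (Key l)
  Enc : ∀ l : ℕ, Key l → Word (k l) → PMF (Word (n l))
  Dec : ∀ l : ℕ, Key l → Word (n l) → PMF (Word (k l))

namespace SecretCode

variable {n k : ℕ → ℕ} (S : SecretCode n k)

/-- `Gen(1^l)` is computed by a probabilistic polynomial time algorithm. -/
def EfficientGen : Prop :=
  ∃ M : PPT, ∀ l, 0 < l →
    (M.out [unary l]).map (fun (s : Store) (i : Fin S.arity) => s i) = (S.Gen l).map S.keyBits

/-- `Enc` is computed by a probabilistic polynomial time algorithm, on input `1^l`, a key and a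
message. -/
def EfficientEnc : Prop :=
  ∃ M : PPT, ∀ l, 0 < l → ∀ sk ∈ (S.Gen l).support, ∀ x : Word (k l),
    (M.out (unary l :: List.ofFn (S.keyBits sk) ++ [wordBits x])).map (fun s => s 0)
      = (S.Enc l sk x).map wordBits

/-- `Dec` is computed by a probabilistic polynomial time algorithm, on input `1^l`, a key and a
received word. -/
def EfficientDec : Prop :=
  ∃ M : PPT, ∀ l, 0 < l → ∀ sk ∈ (S.Gen l).support, ∀ y : Word (n l),
    (M.out (unary l :: List.ofFn (S.keyBits sk) ++ [wordBits y])).map (fun s => s 0)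
      = (S.Dec l sk y).map wordBits

/-- For every key in the range of `Gen`, decoding always recovers the message from each of its
encodings, as long as at most `e l` symbols have been changed. -/
def ToleratesErrors (e : ℕ → ℝ) : Prop :=
  ∀ l, 0 < l → ∀ sk ∈ (S.Gen l).support, ∀ x : Word (k l), ∀ y ∈ (S.Enc l sk x).support,
    ∀ y' : Word (n l), (hammingDist y y' : ℝ) ≤ e l → S.Dec l sk y' = PMF.pure x

/-- What the adversary receives in the security game with `q` samples: for `b = false` encodings
under one key of independent uniform messages, for `b = true` independent uniform words. -/
def challenge (q l : ℕ) (b : Bool) : PMF (List (List Bool)) := do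
  let sk ← S.Gen l
  let R ← iid (if b then PMF.uniformOfFintype (Word (n l))
    else (PMF.uniformOfFintype (Word (k l))).bind (S.Enc l sk)) q
  return [unary l, unary (n l), unary (k l), unary q, (R.map wordBits).flatten]

/-- `(n, k, δ)`-robust secret encryption. -/
structure IsRSE (δ : ℕ → ℝ) : Prop where
  gen : S.EfficientGen
  enc : S.EfficientEnc
  dec : S.EfficientDec
  robust : S.ToleratesErrors fun l => δ l * n l
  secure : ∀ q : ℕ → ℕ, (∃ p : Polynomial ℕ, ∀ l, q l ≤ p.eval l) →
    Indistinguishable fun l => S.challenge (q l) l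

end SecretCode

/-! ### Goppa codes -/

/-- The binary Goppa code with polynomial `g` and support `α`: all words `c` such that
`∑ c_i / (z - α_i) = 0` in `𝔽_{2^m}[z] / (g)`. -/
def goppaCode {m n : ℕ} (g : (GaloisField 2 m)[X]) (α : Fin n → GaloisField 2 m) :
    Set (Word n) :=
  {c | ∑ i, AdjoinRoot.of g (algebraMap (ZMod 2) (GaloisField 2 m) (c i)) *
    Ring.inverse (AdjoinRoot.root g - AdjoinRoot.of g (α i)) = 0}

/-- `C` is a Goppa code given by a polynomial of degree at most `t` over `𝔽_{2^m}` and distinct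
points of `𝔽_{2^m}` at which this polynomial does not vanish. -/
def IsGoppaCode (m t : ℕ) {n : ℕ} (C : Set (Word n)) : Prop :=
  0 < m ∧ ∃ (g : (GaloisField 2 m)[X]) (α : Fin n → GaloisField 2 m),
    g.natDegree ≤ t ∧ Function.Injective α ∧ (∀ i, g.eval (α i) ≠ 0) ∧ C = goppaCode g α

/-- `G` is a generator matrix of the code `C`: its rows form a basis of `C`. -/
def IsGenerator {k n : ℕ} (G : Matrix (Fin k) (Fin n) (ZMod 2)) (C : Set (Word n)) : Prop :=
  LinearIndependent (ZMod 2) (fun i => G i) ∧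
    (Submodule.span (ZMod 2) (Set.range fun i => G i) : Set (Word n)) = C

/-- A key for a Goppa code: a generator matrix, and a string with whatever else the decoder needs
(such as the polynomial and the support). -/
abbrev GoppaKey (n k : ℕ) := Matrix (Fin k) (Fin n) (ZMod 2) × List Bool

/-- A uniformly random word of length `n` and Hamming weight `w` (to be used for `w ≤ n`). -/
def randomError (n w : ℕ) : PMF (Word n) :=
  if h : (Finset.univ.filter fun e : Word n => hammingNorm e = w).Nonempty then
    PMF.uniformOfFinset _ h
  else PMF.pure 0

/-- The codes themselves, without added noise: a random Goppa code with its encoder `x ↦ x G` and a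
decoding algorithm. -/
def goppaFamily {n k : ℕ → ℕ} (gopGen : ∀ l, PMF (GoppaKey (n l) (k l)))
    (gopDec : ∀ l, GoppaKey (n l) (k l) → Word (n l) → PMF (Word (k l))) : SecretCode n k where
  Key l := GoppaKey (n l) (k l)
  arity := 2
  keyBits sk := ![matBits sk.1, sk.2]
  Gen := gopGen
  Enc _ sk x := PMF.pure (Matrix.vecMul x sk.1)
  Dec := gopDec

/-- The construction: an encoding of `x` is `x G + z` for a uniformly random word `z` of weight equal
to the security parameter. -/
def goppaRSE {n k : ℕ → ℕ} (gopGen : ∀ l, PMF (GoppaKey (n l) (k l)))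
    (gopDec : ∀ l, GoppaKey (n l) (k l) → Word (n l) → PMF (Word (k l))) : SecretCode n k where
  Key l := GoppaKey (n l) (k l)
  arity := 2
  keyBits sk := ![matBits sk.1, sk.2]
  Gen := gopGen
  Enc l sk x := (randomError (n l) l).map fun z => Matrix.vecMul x sk.1 + z
  Dec := gopDec

/-! ### The two hardness assumptions -/

/-- Average decoding hardness: for a uniformly random matrix `R`, which the adversary knows, a noisy
codeword `x R + e` (`b = false`) is indistinguishable from a uniform word (`b = true`). -/
def AverageDecodingHard (n k : ℕ → ℕ) : Prop :=
  Indistinguishable fun l b => do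
    let R ← PMF.uniformOfFintype (Matrix (Fin (k l)) (Fin (n l)) (ZMod 2))
    let x ← PMF.uniformOfFintype (Word (k l))
    let e ← randomError (n l) l
    let u ← PMF.uniformOfFintype (Word (n l))
    return [unary l, unary (n l), unary (k l), matBits R,
      wordBits (if b then u else Matrix.vecMul x R + e)]

/-- Goppa codes are indistinguishable from random codes: the adversary receives a uniformly random
matrix (`b = false`) or the generator matrix of a random Goppa code (`b = true`). -/
def GoppaRandomIndist {n k : ℕ → ℕ} (gopGen : ∀ l, PMF (GoppaKey (n l) (k l))) : Prop :=
  Indistinguishable fun l b => do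
    let G ← if b then (gopGen l).map Prod.fst
      else PMF.uniformOfFintype (Matrix (Fin (k l)) (Fin (n l)) (ZMod 2))
    return [unary l, unary (n l), unary (k l), matBits G]

end RobustEnc

end

noncomputable section

namespace RobustEnc

/-! ### Halting computations -/

/-! Robustness is the triangle inequality: `x G + z` lies within `λ` of `x G`, so every word within
`δ n` of the encoding lies within `λ + δ n` of the codeword, where the given decoder succeeds
(`toleratesErrors_goppaRSE`). Error tolerance also forces `λ ≤ n`: otherwise the zero word would be
close enough to every codeword, and would decode to two different messages because `k > 0`. Hence
the noise really has weight `λ`.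

Security is proved by two replacements (`secure_goppaRSE`). First the Goppa matrix `G` behind the
`q` encodings is replaced by a uniform matrix `R`. An adversary noticing this would distinguish `G`
from `R`, since anyone holding a matrix can produce the encodings (`exists_encodings_reduction`).
Then the noisy codewords `x R + e` are turned into uniform words one at a time: hybrid `i` consists
of `i` uniform words followed by `q - i` noisy codewords under the same `R`. A decoding challenge
`(R, y)` with `y` put at position `i` gives hybrid `i` or `i + 1`; for uniform `i < q` the advantage
is a telescoping sum divided by `q` (`exists_adv_decodingGame`).

One obstacle is that `q` is polynomially bounded but perhaps not computable, while the challenges in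
the assumptions do not contain `1^q`. `Indistinguishable.advice` supplies it. Let `g_j` be the
signed advantage of `A` when it is given `1^j`. Guessing `j` below a computable bound `N > q` is not
enough, as the terms `g_j` may have different signs and cancel. So the distinguisher tests itself:
it samples a random case `c`, runs `A` on it with the same `j`, and negates the answer to the real
challenge if `A` was wrong about `c`. Its advantage is the mean of the squares `g_j ^ 2`, which is
at least `g_q ^ 2 / N`; so `|g_q| ≤ √(N ε)`, which is still negligible. The self-test requires both
cases of both assumptions to be efficiently samplable from `1^λ`, `1^n`, `1^k`; for the Goppa matrix
this is the efficiency of key generation.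

The remainder shows that the encoder and the reductions are actual polynomial time programs with
exactly the intended output distributions. `Code` is a language whose loops are bounded by registers
that their bodies leave alone, so that a syntactic check gives polynomial time (`Code.tameBy`), and
loops are evaluated by simulation (`iterDen_eq`). `Poly` is closed under composition and under calls
of arbitrary algorithms (`poly_callDen`), and leads back to the machine model by `Poly.exists_ppt`.
Noise of fixed weight is sampled bit by bit, exactly (`errBits_apply`). -/

theorem bind_congr_of_support {α β : Type*} {p : PMF α} {f g : α → PMF β}
    (h : ∀ a ∈ p.support, f a = g a) : p.bind f = p.bind g := by
  ext b
  simp only [PMF.bind_apply]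
  refine tsum_congr fun a => ?_
  by_cases ha : p a = 0
  · simp [ha]
  · rw [h a ((PMF.mem_support_iff _ _).2 ha)]

theorem map_congr_of_support {α β : Type*} {p : PMF α} {f g : α → β}
    (h : ∀ a ∈ p.support, f a = g a) : p.map f = p.map g :=
  bind_congr_of_support fun a ha => by simp [h a ha]

/-- A uniformly random element of `{0, …, N - 1}` (`0` if `N = 0`). -/
def drawNat : ℕ → PMF ℕ
  | 0 => PMF.pure 0
  | N + 1 => (PMF.uniformOfFintype (Fin (N + 1))).map fun i : Fin (N + 1) => (i : ℕ)

theorem le_of_mem_support_drawNat {N i : ℕ} (h : i ∈ (drawNat N).support) : i ≤ N := by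
  cases N with
  | zero => simpa [drawNat] using h
  | succ N =>
    simp only [drawNat, PMF.mem_support_map_iff] at h
    obtain ⟨j, -, rfl⟩ := h
    exact j.2.le

theorem step_draw (r t : ℕ) (K : List Prog) (s : Store) :
    step (Prog.draw r t :: K, s) = (drawNat (s r).length).map fun i =>
      (K, Function.update s t (List.replicate i true)) := by
  cases hl : (s r).length with
  | zero => simp [step, hl, drawNat, PMF.pure_map]
  | succ N => simp only [step, hl, drawNat]; rfl

/-- Started on the programs `K` and the store `s`, the machine halts within `T` steps, and the final
store has distribution `ν`. -/
def Halts (K : List Prog) (s : Store) (T : ℕ) (ν : PMF Store) : Prop :=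
  run T (K, s) = ν.map fun s' => ([], s')

theorem run_nil (T : ℕ) (s : Store) : run T ([], s) = PMF.pure ([], s) := by
  induction T with
  | zero => rfl
  | succ T ih => simp [run, step, ih]

theorem run_add (a b : ℕ) (c : Cfg) : run (a + b) c = (run a c).bind (run b) := by
  induction a generalizing c with
  | zero => simp [run]
  | succ a ih =>
    rw [Nat.succ_add]
    simp only [run, PMF.bind_bind]
    congr 1
    funext c'
    exact ih c'

/-- A halted configuration is a fixed point of `step`, so `T` is only an upper bound for the running
time. This lets random branches of different duration share one bound. -/
theorem Halts.mono {K : List Prog} {s : Store} {T T' : ℕ} {ν : PMF Store} (h : Halts K s T ν)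
    (hT : T ≤ T') : Halts K s T' ν := by
  obtain ⟨d, rfl⟩ := Nat.exists_eq_add_of_le hT
  unfold Halts at *
  rw [run_add, h, PMF.bind_map]
  simp only [Function.comp_def, run_nil]
  rfl

theorem halts_nil (s : Store) (T : ℕ) : Halts [] s T (PMF.pure s) := by
  simp [Halts, run_nil, PMF.pure_map]

theorem halts_of_support {K : List Prog} {s : Store} {T : ℕ}
    (h : ∀ c ∈ (run T (K, s)).support, c.1 = []) : Halts K s T ((run T (K, s)).map Prod.snd) := by
  unfold Halts
  rw [PMF.map_comp]
  conv_lhs => rw [← PMF.map_id (run T (K, s))]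
  refine map_congr_of_support fun c hc => ?_
  obtain ⟨K', s'⟩ := c
  simp [show K' = [] from h _ hc]

theorem Halts.support {K : List Prog} {s : Store} {T : ℕ} {ν : PMF Store} (h : Halts K s T ν) :
    ∀ c ∈ (run T (K, s)).support, c.1 = [] := by
  intro c hc
  rw [show run T (K, s) = _ from h] at hc
  obtain ⟨s', -, rfl⟩ := (PMF.mem_support_map_iff _ _ _).1 hc
  rfl

theorem Halts.map_snd {K : List Prog} {s : Store} {T : ℕ} {ν : PMF Store} (h : Halts K s T ν) :
    (run T (K, s)).map Prod.snd = ν := by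
  rw [show run T (K, s) = _ from h, PMF.map_comp]
  exact PMF.map_id ν

theorem halts_step {K : List Prog} {s : Store} {T : ℕ} {c : Cfg} {ν : PMF Store}
    (h : step (K, s) = PMF.pure c) (hc : Halts c.1 c.2 T ν) : Halts K s (T + 1) ν := by
  unfold Halts
  simp only [run, h, PMF.pure_bind]
  exact hc

theorem step_append {K₁ : List Prog} (K : List Prog) (s : Store) (h : K₁ ≠ []) :
    step (K₁ ++ K, s) = (step (K₁, s)).map fun c => (c.1 ++ K, c.2) := by
  obtain ⟨p, K', rfl⟩ := List.exists_cons_of_ne_nil h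
  cases p with
  | draw r t =>
    simp only [List.cons_append, step_draw, PMF.map_comp]
    rfl
  | branch r p q u =>
    rcases hr : s r with _ | ⟨_ | _, L⟩ <;> simp [step, hr, PMF.pure_map]
  | loop r p =>
    rcases hr : s r with _ | ⟨_, L⟩ <;> simp [step, hr, PMF.pure_map]
  | _ => simp [step, PMF.pure_map]

/-- The list of pending programs is a stack: while `K₁` is not exhausted, a step does not look at
`K` below it. Different random branches may exhaust `K₁` at different times, so the induction on `T`
follows the branches step by step. -/
theorem Halts.append {K₁ K : List Prog} {s : Store} {T T' : ℕ} {ν : PMF Store}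
    {ν' : Store → PMF Store} (h : Halts K₁ s T ν)
    (h' : ∀ s' ∈ ν.support, Halts K s' T' (ν' s')) :
    Halts (K₁ ++ K) s (T + T') (ν.bind ν') := by
  induction T generalizing K₁ s ν with
  | zero =>
    have hK : K₁ = [] := h.support (K₁, s) (by simp [run])
    subst hK
    have := h.map_snd
    simp only [run, PMF.pure_map] at this
    subst this
    simpa using h' s (by simp)
  | succ T ih =>
    by_cases hK : K₁ = []
    · subst hK
      have := h.map_snd
      simp only [run_nil, PMF.pure_map] at this
      subst this
      simpa using (h' s (by simp)).mono (by omega)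
    · have hsup := h.support
      -- Each successor configuration again halts on all its branches, with its own output
      -- distribution; `ν` is the mixture of these.
      have hc : ∀ c ∈ (step (K₁, s)).support, Halts c.1 c.2 T ((run T c).map Prod.snd) := by
        intro c hc
        refine halts_of_support fun c' hc' => hsup c' ?_
        simp only [run, PMF.mem_support_bind_iff]
        exact ⟨c, hc, hc'⟩
      have hν : ν = (step (K₁, s)).bind fun c => (run T c).map Prod.snd := by
        rw [← h.map_snd]
        simp [run, PMF.map_bind]
      unfold Halts
      rw [Nat.succ_add]
      simp only [run]
      rw [step_append K s hK, PMF.bind_map, hν, PMF.bind_bind, PMF.map_bind]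
      refine bind_congr_of_support fun c hcs => ?_
      refine ih (hc c hcs) fun s' hs' => h' s' ?_
      rw [hν]
      exact (PMF.mem_support_bind_iff _ _ _).2 ⟨c, hcs, hs'⟩

theorem Halts.cons {p : Prog} {K : List Prog} {s : Store} {T T' : ℕ} {ν : PMF Store}
    {ν' : Store → PMF Store} (h : Halts [p] s T ν)
    (h' : ∀ s' ∈ ν.support, Halts K s' T' (ν' s')) : Halts (p :: K) s (T + T') (ν.bind ν') :=
  h.append h'

theorem Halts.seq {p q : Prog} {s : Store} {T T' : ℕ} {ν : PMF Store}
    {ν' : Store → PMF Store} (h : Halts [p] s T ν)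
    (h' : ∀ s' ∈ ν.support, Halts [q] s' T' (ν' s')) :
    Halts [Prog.seq p q] s (T + T' + 1) (ν.bind ν') :=
  halts_step (c := ([p, q], s)) rfl (h.cons h')

theorem Halts.seq_pure {p q : Prog} {s s' : Store} {T T' : ℕ} {ν : PMF Store}
    (h : Halts [p] s T (PMF.pure s')) (h' : Halts [q] s' T' ν) :
    Halts [Prog.seq p q] s (T + T' + 1) ν := by
  simpa using h.seq (ν' := fun _ => ν) (T' := T') (q := q) (by simpa using h')

theorem halts_loop_nil {r : ℕ} (p : Prog) {s : Store} (h : s r = []) :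
    Halts [Prog.loop r p] s 1 (PMF.pure s) :=
  halts_step (c := ([], s)) (by simp [step, h]) (halts_nil s 0)

theorem Halts.loop {r : ℕ} {p : Prog} {s : Store} {T T' : ℕ} {ν : PMF Store}
    {ν' : Store → PMF Store} (hr : s r ≠ []) (h : Halts [p] s T ν)
    (h' : ∀ s' ∈ ν.support, Halts [Prog.loop r p] s' T' (ν' s')) :
    Halts [Prog.loop r p] s (T + T' + 1) (ν.bind ν') := by
  refine halts_step (c := ([p, Prog.loop r p], s)) ?_ (h.cons h')
  obtain ⟨a, L, hL⟩ := List.exists_cons_of_ne_nil hr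
  simp [step, hL]

theorem Halts.loop_pure {r : ℕ} {p : Prog} {s s' : Store} {T T' : ℕ} {ν : PMF Store}
    (hr : s r ≠ []) (h : Halts [p] s T (PMF.pure s')) (h' : Halts [Prog.loop r p] s' T' ν) :
    Halts [Prog.loop r p] s (T + T' + 1) ν := by
  simpa using h.loop (ν' := fun _ => ν) (T' := T') hr (by simpa using h')

/-- All registers have length at most `m`. -/
def Bd (m : ℕ) (s : Store) : Prop := ∀ r, (s r).length ≤ m

theorem Bd.mono {m m' : ℕ} {s : Store} (h : Bd m s) (hm : m ≤ m') : Bd m' s :=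
  fun r => (h r).trans hm

theorem Bd.update {m : ℕ} {s : Store} (h : Bd m s) {r : ℕ} {L : List Bool} (hL : L.length ≤ m) :
    Bd m (Function.update s r L) := by
  intro i
  by_cases hi : i = r
  · subst hi; simpa
  · simpa [hi] using h i

/-- Only `push` and `draw` can lengthen a register, and a drawn number does not exceed the length of
a register. Running time thus bounds growth, which is what makes sequential composition polynomial.
-/
theorem step_bd {c c' : Cfg} {m : ℕ} (h : Bd m c.2) (hc : c' ∈ (step c).support) :
    Bd (m + 1) c'.2 := by
  have h1 : Bd (m + 1) c.2 := h.mono (by omega)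
  obtain ⟨K, s⟩ := c
  have hs : Bd (m + 1) s := h1
  rcases K with _ | ⟨p, K⟩
  · simp only [step, PMF.mem_support_pure_iff] at hc
    subst hc; exact h1
  cases p with
  | push b r =>
    simp only [step, PMF.mem_support_pure_iff] at hc
    subst hc
    exact h1.update (by simpa using h r)
  | pop r =>
    simp only [step, PMF.mem_support_pure_iff] at hc
    subst hc
    exact h1.update (by have : (s r).length ≤ m := h r; simp only [List.length_tail]; omega)
  | draw r t =>
    have hr : (s r).length ≤ m := h r
    simp only [step_draw, PMF.mem_support_map_iff] at hc
    obtain ⟨i, hi, rfl⟩ := hc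
    have := le_of_mem_support_drawNat hi
    exact h1.update (by simp only [List.length_replicate]; omega)
  | branch r p q u =>
    rcases hr : s r with _ | ⟨_ | _, L⟩ <;> simp only [step, hr, PMF.mem_support_pure_iff] at hc <;>
      subst hc <;> exact h1
  | loop r p =>
    rcases hr : s r with _ | ⟨_, L⟩ <;> simp only [step, hr, PMF.mem_support_pure_iff] at hc <;>
      subst hc <;> exact h1
  | _ =>
    simp only [step, PMF.mem_support_pure_iff] at hc
    subst hc; exact h1

theorem run_bd {T m : ℕ} {c c' : Cfg} (h : Bd m c.2) (hc : c' ∈ (run T c).support) :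
    Bd (m + T) c'.2 := by
  induction T generalizing c m with
  | zero =>
    simp only [run, PMF.mem_support_pure_iff] at hc
    subst hc; exact h
  | succ T ih =>
    simp only [run, PMF.mem_support_bind_iff] at hc
    obtain ⟨c₁, h₁, h₂⟩ := hc
    exact (ih (step_bd h h₁) h₂).mono (by omega)

theorem Halts.bd {K : List Prog} {s s' : Store} {T m : ℕ} {ν : PMF Store} (h : Halts K s T ν)
    (hs : Bd m s) (hs' : s' ∈ ν.support) : Bd (m + T) s' := by
  refine run_bd (c := (K, s)) (c' := ([], s')) hs ?_
  rw [show run T (K, s) = _ from h]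
  exact (PMF.mem_support_map_iff _ _ _).2 ⟨s', hs', rfl⟩

/-! ### Renaming registers -/

/-- Rename register `r` to `c + r`. -/
def Prog.shift (c : ℕ) : Prog → Prog
  | .skip => .skip
  | .push b r => .push b (c + r)
  | .pop r => .pop (c + r)
  | .draw r s => .draw (c + r) (c + s)
  | .seq p q => .seq (p.shift c) (q.shift c)
  | .branch r p q u => .branch (c + r) (p.shift c) (q.shift c) (u.shift c)
  | .loop r p => .loop (c + r) (p.shift c)

/-- All registers of the program are less than `B`. -/
def Prog.Below (B : ℕ) : Prog → Prop
  | .skip => True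
  | .push _ r => r < B
  | .pop r => r < B
  | .draw r s => r < B ∧ s < B
  | .seq p q => p.Below B ∧ q.Below B
  | .branch r p q u => r < B ∧ p.Below B ∧ q.Below B ∧ u.Below B
  | .loop r p => r < B ∧ p.Below B

theorem Prog.Below.mono {B B' : ℕ} {p : Prog} (h : p.Below B) (hB : B ≤ B') : p.Below B' := by
  induction p with
  | skip => trivial
  | push b r => exact lt_of_lt_of_le h hB
  | pop r => exact lt_of_lt_of_le h hB
  | draw r s => exact ⟨lt_of_lt_of_le h.1 hB, lt_of_lt_of_le h.2 hB⟩
  | seq p q hp hq => exact ⟨hp h.1, hq h.2⟩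
  | branch r p q u hp hq hu =>
    exact ⟨lt_of_lt_of_le h.1 hB, hp h.2.1, hq h.2.2.1, hu h.2.2.2⟩
  | loop r p hp => exact ⟨lt_of_lt_of_le h.1 hB, hp h.2⟩

theorem Prog.exists_below (p : Prog) : ∃ B, p.Below B := by
  induction p with
  | skip => exact ⟨0, trivial⟩
  | push b r => exact ⟨r + 1, Nat.lt_succ_self r⟩
  | pop r => exact ⟨r + 1, Nat.lt_succ_self r⟩
  | draw r s => exact ⟨r + s + 1, by simp only [Below]; omega⟩
  | seq p q hp hq =>
    obtain ⟨B, hB⟩ := hp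
    obtain ⟨B', hB'⟩ := hq
    exact ⟨B + B', hB.mono (by omega), hB'.mono (by omega)⟩
  | branch r p q u hp hq hu =>
    obtain ⟨B, hB⟩ := hp
    obtain ⟨B', hB'⟩ := hq
    obtain ⟨B'', hB''⟩ := hu
    exact ⟨r + 1 + B + B' + B'', by omega, hB.mono (by omega), hB'.mono (by omega),
      hB''.mono (by omega)⟩
  | loop r p hp =>
    obtain ⟨B, hB⟩ := hp
    exact ⟨r + 1 + B, by omega, hB.mono (by omega)⟩

/-- The store `σ` with the registers `c, …, c + B - 1` replaced by the registers `0, …, B - 1` of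
`s`. -/
def overlay (c B : ℕ) (s σ : Store) : Store :=
  fun r => if c ≤ r ∧ r < c + B then s (r - c) else σ r

theorem overlay_block {c B r : ℕ} (s σ : Store) (h : r < B) : overlay c B s σ (c + r) = s r := by
  simp [overlay, h]

theorem overlay_update {c B r : ℕ} (s σ : Store) (h : r < B) (L : List Bool) :
    Function.update (overlay c B s σ) (c + r) L = overlay c B (Function.update s r L) σ := by
  funext i
  by_cases hi : i = c + r
  · subst hi; simp [overlay, h]
  · rw [Function.update_of_ne hi]
    unfold overlay
    split_ifs with h'
    · rw [Function.update_of_ne (by omega)]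
    · rfl

/-- A step reads and writes only registers named in the program, so it commutes with moving the
block of registers below `B` to another place and is blind to the surrounding store `σ`. -/
theorem step_shift {c B : ℕ} {K : List Prog} (hK : ∀ p ∈ K, p.Below B) (s σ : Store) :
    step (K.map (Prog.shift c), overlay c B s σ)
      = (step (K, s)).map fun x => (x.1.map (Prog.shift c), overlay c B x.2 σ) := by
  rcases K with _ | ⟨p, K⟩
  · simp [step, PMF.pure_map]
  have hp : p.Below B := hK p (by simp)
  cases p with
  | push b r =>
    have hr : r < B := hp
    simp [step, PMF.pure_map, Prog.shift, overlay_block _ _ hr, overlay_update _ _ hr]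
  | pop r =>
    have hr : r < B := hp
    simp [step, PMF.pure_map, Prog.shift, overlay_block _ _ hr, overlay_update _ _ hr]
  | draw r t =>
    have hr : r < B := hp.1
    have ht : t < B := hp.2
    have hr' := overlay_block (c := c) s σ hr
    simp only [List.map_cons, Prog.shift, step_draw, hr', PMF.map_comp, Function.comp_def,
      overlay_update _ _ ht]
  | branch r p q u =>
    have hr' := overlay_block (c := c) s σ (show r < B from hp.1)
    rcases hs : s r with _ | ⟨_ | _, L⟩ <;> rw [hs] at hr' <;>
      simp [step, hs, PMF.pure_map, Prog.shift, hr']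
  | loop r p =>
    have hr' := overlay_block (c := c) s σ (show r < B from hp.1)
    rcases hs : s r with _ | ⟨_, L⟩ <;> rw [hs] at hr' <;>
      simp [step, hs, PMF.pure_map, Prog.shift, hr']
  | _ => simp [step, PMF.pure_map, Prog.shift]

theorem step_below {B : ℕ} {K : List Prog} (hK : ∀ p ∈ K, p.Below B) {s : Store} {c : Cfg}
    (hc : c ∈ (step (K, s)).support) : ∀ p ∈ c.1, p.Below B := by
  rcases K with _ | ⟨p, K⟩
  · simp only [step, PMF.mem_support_pure_iff] at hc
    subst hc; simp
  have hp : p.Below B := hK p (by simp)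
  have hK' : ∀ p ∈ K, p.Below B := fun q hq => hK q (by simp [hq])
  cases p with
  | draw r t =>
    simp only [step_draw, PMF.mem_support_map_iff] at hc
    obtain ⟨i, -, rfl⟩ := hc
    exact hK'
  | branch r p q u =>
    obtain ⟨-, h1, h2, h3⟩ := hp
    rcases hr : s r with _ | ⟨_ | _, L⟩ <;> simp only [step, hr, PMF.mem_support_pure_iff] at hc <;>
      subst hc <;> simp only [List.mem_cons, forall_eq_or_imp] <;>
      first | exact ⟨h1, hK'⟩ | exact ⟨h2, hK'⟩ | exact ⟨h3, hK'⟩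
  | loop r p =>
    rcases hr : s r with _ | ⟨_, L⟩ <;> simp only [step, hr, PMF.mem_support_pure_iff] at hc <;>
      subst hc
    · exact hK'
    · simp only [List.mem_cons, forall_eq_or_imp]
      exact ⟨hp.2, hp, hK'⟩
  | seq p q =>
    simp only [step, PMF.mem_support_pure_iff] at hc
    subst hc
    simp only [List.mem_cons, forall_eq_or_imp]
    exact ⟨hp.1, hp.2, hK'⟩
  | _ =>
    simp only [step, PMF.mem_support_pure_iff] at hc
    subst hc; exact hK'

theorem run_shift {c B T : ℕ} {K : List Prog} (hK : ∀ p ∈ K, p.Below B) (s σ : Store) :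
    run T (K.map (Prog.shift c), overlay c B s σ)
      = (run T (K, s)).map fun x => (x.1.map (Prog.shift c), overlay c B x.2 σ) := by
  induction T generalizing K s with
  | zero => simp [run, PMF.pure_map]
  | succ T ih =>
    simp only [run]
    rw [step_shift hK, PMF.bind_map, PMF.map_bind]
    exact bind_congr_of_support fun x hx => ih (step_below hK hx) x.2

theorem Halts.shift {c B T : ℕ} {p : Prog} (hp : p.Below B) {s : Store} {ν : PMF Store}
    (h : Halts [p] s T ν) (σ : Store) :
    Halts [p.shift c] (overlay c B s σ) T (ν.map fun s' => overlay c B s' σ) := by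
  unfold Halts
  have := run_shift (c := c) (T := T) (K := [p]) (B := B) (by simpa using hp) s σ
  rw [List.map_singleton] at this
  rw [this, show run T ([p], s) = _ from h, PMF.map_comp, PMF.map_comp]
  rfl

theorem Prog.shift_zero (p : Prog) : p.shift 0 = p := by
  induction p <;> simp_all [Prog.shift]

theorem PPT.halts_out (A : PPT) (inp : List (List Bool)) :
    Halts [A.prog] (load inp) (A.time.eval (inputSize inp)) (A.out inp) :=
  halts_of_support (A.halts inp)

/-! ### Elementary programs -/

theorem eval_mono (P : ℕ[X]) {m m' : ℕ} (h : m ≤ m') : P.eval m ≤ P.eval m' := by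
  simp only [Polynomial.eval_eq_sum_range]
  exact Finset.sum_le_sum fun i _ => Nat.mul_le_mul_left _ (Nat.pow_le_pow_left h i)

theorem Halts.to {K : List Prog} {s : Store} {T T' : ℕ} {ν ν' : PMF Store} (h : Halts K s T ν)
    (hν : ν = ν') (hT : T ≤ T') : Halts K s T' ν' :=
  hν ▸ h.mono hT

theorem halts_skip (s : Store) : Halts [Prog.skip] s 1 (PMF.pure s) :=
  halts_step (c := ([], s)) rfl (halts_nil _ 0)

theorem halts_push (b : Bool) (r : ℕ) (s : Store) :
    Halts [Prog.push b r] s 1 (PMF.pure (Function.update s r (b :: s r))) :=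
  halts_step (c := ([], _)) rfl (halts_nil _ 0)

theorem halts_pop (r : ℕ) (s : Store) :
    Halts [Prog.pop r] s 1 (PMF.pure (Function.update s r (s r).tail)) :=
  halts_step (c := ([], _)) rfl (halts_nil _ 0)

theorem halts_draw (r t : ℕ) (s : Store) :
    Halts [Prog.draw r t] s 1 ((drawNat (s r).length).map fun i =>
      Function.update s t (List.replicate i true)) := by
  simp only [Halts, run, step_draw, PMF.map_comp]
  exact PMF.bind_pure _

/-- The alternative chosen by a `branch` on a register with the given contents. -/
def pick {α : Type*} (x y z : α) : List Bool → α
  | [] => x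
  | false :: _ => y
  | true :: _ => z

theorem Halts.branch {r : ℕ} {p q u : Prog} {s : Store} {T : ℕ} {ν : PMF Store}
    (h : Halts [pick p q u (s r)] s T ν) : Halts [Prog.branch r p q u] s (T + 1) ν := by
  refine halts_step (c := ([pick p q u (s r)], s)) ?_ h
  rcases hr : s r with _ | ⟨_ | _, L⟩ <;> simp [step, hr, pick]

/-- Empty register `r`. -/
def clearP (r : ℕ) : Prog := .loop r (.pop r)

theorem halts_clearP (r : ℕ) (s : Store) :
    Halts [clearP r] s (2 * (s r).length + 1) (PMF.pure (Function.update s r [])) := by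
  induction hL : s r generalizing s with
  | nil =>
    rw [← hL, Function.update_eq_self]
    exact (halts_loop_nil _ hL).mono (by omega)
  | cons a L ih =>
    have := ih (Function.update s r (s r).tail) (by simp [hL])
    rw [Function.update_idem] at this
    exact (Halts.loop_pure (by simp [hL]) (halts_pop r s) this).mono
      (by simp only [List.length_cons]; omega)

/-- Move the contents of register `r`, reversed, on top of register `t`. -/
def moveP (r t : ℕ) : Prog :=
  .loop r (.branch r .skip (.seq (.push false t) (.pop r)) (.seq (.push true t) (.pop r)))

theorem halts_moveP {r t : ℕ} (hrt : r ≠ t) (s : Store) :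
    Halts [moveP r t] s (5 * (s r).length + 1)
      (PMF.pure (Function.update (Function.update s t ((s r).reverse ++ s t)) r [])) := by
  induction hL : s r generalizing s with
  | nil =>
    have : Function.update (Function.update s t (([] : List Bool).reverse ++ s t)) r [] = s := by
      funext i
      simp only [Function.update_apply]
      split_ifs <;> simp_all
    rw [this]
    exact (halts_loop_nil _ hL).mono (by omega)
  | cons a L ih =>
    have h1 : Halts [.seq (.push a t) (.pop r)] s 3
        (PMF.pure (Function.update (Function.update s t (a :: s t)) r L)) := by
      have := (halts_push a t s).seq_pure (halts_pop r _)
      rwa [Function.update_of_ne hrt, hL] at this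
    have h2 := ih (Function.update (Function.update s t (a :: s t)) r L) (by simp)
    have h3 : Function.update (Function.update (Function.update (Function.update s t (a :: s t)) r L)
        t (L.reverse ++ Function.update (Function.update s t (a :: s t)) r L t)) r []
        = Function.update (Function.update s t ((a :: L).reverse ++ s t)) r [] := by
      funext i
      simp only [Function.update_apply]
      split_ifs <;> simp_all
    rw [h3] at h2
    refine (Halts.loop_pure (by simp [hL]) (Halts.branch (T := 3) ?_) h2).mono
      (by simp only [List.length_cons]; omega)
    rw [hL]
    cases a <;> exact h1

/-- Move the contents of register `t`, reversed, on top of the registers `r` and `u`. -/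
def dupP (t r u : ℕ) : Prog :=
  .loop t (.branch t .skip (.seq (.push false r) (.seq (.push false u) (.pop t)))
    (.seq (.push true r) (.seq (.push true u) (.pop t))))

theorem halts_dupP {t r u : ℕ} (htr : t ≠ r) (htu : t ≠ u) (hru : r ≠ u) (s : Store) :
    Halts [dupP t r u] s (7 * (s t).length + 1)
      (PMF.pure (Function.update (Function.update (Function.update s r ((s t).reverse ++ s r))
        u ((s t).reverse ++ s u)) t [])) := by
  induction hL : s t generalizing s with
  | nil =>
    have : Function.update (Function.update (Function.update s r (([] : List Bool).reverse ++ s r))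
        u (([] : List Bool).reverse ++ s u)) t [] = s := by
      funext i
      simp only [Function.update_apply]
      split_ifs <;> simp_all
    rw [this]
    exact (halts_loop_nil _ hL).mono (by omega)
  | cons a L ih =>
    have h1 : Halts [.seq (.push a r) (.seq (.push a u) (.pop t))] s 5
        (PMF.pure (Function.update (Function.update (Function.update s r (a :: s r)) u (a :: s u))
          t L)) := by
      have := (halts_push a r s).seq_pure ((halts_push a u _).seq_pure (halts_pop t _))
      rwa [Function.update_of_ne htu, Function.update_of_ne htr, Function.update_of_ne hru.symm,
        hL] at this
    have h2 := ih _ (show (Function.update (Function.update (Function.update s r (a :: s r)) u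
      (a :: s u)) t L) t = L by simp)
    have h3 : Function.update (Function.update (Function.update
        (Function.update (Function.update (Function.update s r (a :: s r)) u (a :: s u)) t L)
        r (L.reverse ++ (Function.update (Function.update (Function.update s r (a :: s r)) u
          (a :: s u)) t L) r))
        u (L.reverse ++ (Function.update (Function.update (Function.update s r (a :: s r)) u
          (a :: s u)) t L) u)) t []
        = Function.update (Function.update (Function.update s r ((a :: L).reverse ++ s r))
        u ((a :: L).reverse ++ s u)) t [] := by
      funext i
      simp only [Function.update_apply]
      split_ifs <;> simp_all
    rw [h3] at h2
    refine (Halts.loop_pure (by simp [hL]) (Halts.branch (T := 5) ?_) h2).mono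
      (by simp only [List.length_cons]; omega)
    rw [hL]
    cases a <;> exact h1

/-- Copy register `r` to register `u`, with the help of the empty register `t`. -/
def copyP (r u t : ℕ) : Prog := .seq (clearP u) (.seq (moveP r t) (dupP t r u))

theorem halts_copyP {r u t : ℕ} (htr : t ≠ r) (htu : t ≠ u) (hru : r ≠ u) {s : Store}
    (ht : s t = []) {m : ℕ} (hm : Bd m s) :
    Halts [copyP r u t] s (14 * m + 5) (PMF.pure (Function.update s u (s r))) := by
  have h1 := halts_clearP u s
  have h2 := halts_moveP htr.symm (Function.update s u [])
  have h3 := halts_dupP htr htu hru (Function.update (Function.update (Function.update s u []) t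
    ((Function.update s u [] r).reverse ++ Function.update s u [] t)) r [])
  have h := h1.seq_pure (h2.seq_pure h3)
  have hu := hm u
  have hr := hm r
  refine h.to ?_ ?_
  · congr 1
    funext i
    simp only [Function.update_apply]
    split_ifs <;> simp_all
  · have h0 : ([] : List Bool).length = 0 := rfl
    simp only [Function.update_apply, htr, hru, ht, if_true, if_false, List.length_append,
      List.length_reverse]
    split_ifs <;> omega

/-- Shorten register `u` by the length of register `r`, and empty register `r`. -/
def dropP (r u : ℕ) : Prog := .loop r (.seq (.pop r) (.pop u))

theorem halts_dropP {r u : ℕ} (hru : r ≠ u) (s : Store) :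
    Halts [dropP r u] s (4 * (s r).length + 1)
      (PMF.pure (Function.update (Function.update s u ((s u).drop (s r).length)) r [])) := by
  induction hL : s r generalizing s with
  | nil =>
    have : Function.update (Function.update s u ((s u).drop ([] : List Bool).length)) r [] = s := by
      funext i
      simp only [Function.update_apply]
      split_ifs <;> simp_all
    rw [this]
    exact (halts_loop_nil _ hL).mono (by omega)
  | cons a L ih =>
    have h1 : Halts [.seq (.pop r) (.pop u)] s 3
        (PMF.pure (Function.update (Function.update s r L) u (s u).tail)) := by
      have := (halts_pop r s).seq_pure (halts_pop u _)
      rwa [Function.update_of_ne hru.symm, hL] at this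
    have h2 := ih (Function.update (Function.update s r L) u (s u).tail)
      (by simp [Function.update_of_ne hru])
    have h3 : Function.update (Function.update (Function.update (Function.update s r L) u
        (s u).tail) u ((Function.update (Function.update s r L) u
        (s u).tail u).drop L.length)) r []
        = Function.update (Function.update s u ((s u).drop (a :: L).length)) r [] := by
      funext i
      simp only [Function.update_apply]
      split_ifs <;> simp_all
    rw [h3] at h2
    exact (Halts.loop_pure (by simp [hL]) h1 h2).mono (by simp only [List.length_cons]; omega)

/-- Empty the registers `a, …, a + j - 1`. -/
def clearRange (a : ℕ) : ℕ → Prog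
  | 0 => .skip
  | j + 1 => .seq (clearP (a + j)) (clearRange a j)

theorem halts_clearRange (a j : ℕ) {s : Store} {m : ℕ} (hm : Bd m s) :
    Halts [clearRange a j] s (j * (2 * m + 2) + 1) (PMF.pure (overlay a j (fun _ => []) s)) := by
  induction j generalizing s with
  | zero =>
    have : overlay a 0 (fun _ => []) s = s := by
      funext r
      simp only [overlay]
      rw [if_neg (by omega)]
    rw [this]
    exact (halts_skip s).mono (by omega)
  | succ j ih =>
    have := (halts_clearP (a + j) s).seq_pure (ih (s := Function.update s (a + j) [])
      (hm.update (by simp)))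
    have e : overlay a j (fun _ => []) (Function.update s (a + j) [])
        = overlay a (j + 1) (fun _ => []) s := by
      funext r
      simp only [overlay, Function.update_apply]
      split_ifs <;> first | rfl | omega
    rw [e] at this
    refine this.mono ?_
    have := hm (a + j)
    ring_nf
    omega

/-! ### Programs with bounded loops -/

/-- A language of programs whose loops are bounded by the length of a register at their start. -/
inductive Code : Type
  | push (b : Bool) (r : ℕ) : Code
  | pop (r : ℕ) : Code
  | clear (r : ℕ) : Code
  | copy (r t : ℕ) : Code
  | rev (r t : ℕ) : Code
  | draw (r t : ℕ) : Code
  | drop (r t : ℕ) : Code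
  | seq (c d : Code) : Code
  | branch (r : ℕ) (c d e : Code) : Code
  /-- copy register `w` to the counter `r`, and repeat: pop `r`, execute `c` -/
  | iter (w r : ℕ) (c : Code) : Code

infixr:60 " ;; " => Code.seq

/-- Repeat `F`, with the successive proper suffixes of a list in register `r`. -/
def iterDen (F : Store → PMF Store) (r : ℕ) : List Bool → Store → PMF Store
  | [], s => PMF.pure (Function.update s r [])
  | _ :: L, s => (F (Function.update s r L)).bind (iterDen F r L)

/-- The distribution of the store after the execution of a program. -/
def Code.den : Code → Store → PMF Store
  | push b r, s => PMF.pure (Function.update s r (b :: s r))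
  | pop r, s => PMF.pure (Function.update s r (s r).tail)
  | clear r, s => PMF.pure (Function.update s r [])
  | copy r t, s => PMF.pure (Function.update s t (s r))
  | rev r t, s => PMF.pure (Function.update (Function.update s t (s r).reverse) r [])
  | draw r t, s => (drawNat (s r).length).map fun i => Function.update s t (List.replicate i true)
  | drop r t, s => PMF.pure (Function.update (Function.update s t ((s t).drop (s r).length)) r [])
  | seq c d, s => (c.den s).bind d.den
  | branch r c d e, s => pick (c.den s) (d.den s) (e.den s) (s r)
  | iter w r c, s => iterDen c.den r (s w) s

/-- Compilation, with register `D` as scratch space. -/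
def Code.compile (D : ℕ) : Code → Prog
  | push b r => .push b r
  | pop r => .pop r
  | clear r => clearP r
  | copy r t => copyP r t D
  | rev r t => .seq (clearP t) (moveP r t)
  | draw r t => .draw r t
  | drop r t => dropP r t
  | seq c d => .seq (c.compile D) (d.compile D)
  | branch r c d e => .branch r (c.compile D) (d.compile D) (e.compile D)
  | iter w r c => .seq (copyP w r D) (.loop r (.seq (.pop r) (c.compile D)))

/-- All registers are less than `D`, and no register in `W` is modified; loops range over registers
in `W`, or over counters of enclosing loops, which the body does not modify. -/
def Code.tame (D : ℕ) : List ℕ → Code → Bool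
  | W, push _ r => r < D && !W.contains r
  | W, pop r => r < D && !W.contains r
  | W, clear r => r < D && !W.contains r
  | W, copy r t => r < D && t < D && r ≠ t && !W.contains t
  | W, rev r t => r < D && t < D && r ≠ t && !W.contains t && !W.contains r
  | W, draw r t => r < D && t < D && !W.contains t
  | W, drop r t => r < D && t < D && r ≠ t && !W.contains t && !W.contains r
  | W, seq c d => c.tame D W && d.tame D W
  | W, branch r c d e => r < D && c.tame D W && d.tame D W && e.tame D W
  | W, iter w r c => w < D && W.contains w && r < D && !W.contains r && c.tame D (r :: W)

/-- The registers from `D` on are empty. -/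
def Clean (D : ℕ) (s : Store) : Prop := ∀ r, D ≤ r → s r = []

theorem Clean.update {D r : ℕ} {s : Store} (hs : Clean D s) (hr : r < D) (L : List Bool) :
    Clean D (Function.update s r L) := fun i hi => by
  rw [Function.update_of_ne (by omega)]
  exact hs i hi

/-- The program `p` computes `F` in polynomial time; it does not modify the registers in `W`, and
the length of the longest register grows at most by a polynomial in the lengths of the registers in
`W`. -/
def TameBy (D : ℕ) (W : List ℕ) (F : Store → PMF Store) (p : Prog) : Prop :=
  ∃ T P : ℕ[X], ∀ s, Clean D s → ∀ m M, Bd m s → (∀ w ∈ W, (s w).length ≤ M) →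
    Halts [p] s (T.eval m) (F s) ∧ ∀ s' ∈ (F s).support,
      Clean D s' ∧ (∀ w ∈ W, s' w = s w) ∧ Bd (m + P.eval M) s'

theorem TameBy.of_pure {D : ℕ} {W : List ℕ} {f : Store → Store} {p : Prog} (T P : ℕ[X])
    (h : ∀ s, Clean D s → ∀ m, Bd m s → Halts [p] s (T.eval m) (PMF.pure (f s)) ∧
      Clean D (f s) ∧ (∀ w ∈ W, f s w = s w) ∧ ∀ M, Bd (m + P.eval M) (f s)) :
    TameBy D W (fun s => PMF.pure (f s)) p := by
  refine ⟨T, P, fun s hs m M hm _ => ?_⟩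
  obtain ⟨h1, h2, h3, h4⟩ := h s hs m hm
  refine ⟨h1, fun s' hs' => ?_⟩
  rw [(PMF.mem_support_pure_iff _ _).1 hs']
  exact ⟨h2, h3, h4 M⟩

/-- Time bounds are composed, with `X + T` bounding the registers after the first program. The
growth bounds simply add, since the registers in `W` that control growth are unchanged. -/
theorem TameBy.seq {D : ℕ} {W : List ℕ} {F G : Store → PMF Store} {p q : Prog}
    (hp : TameBy D W F p) (hq : TameBy D W G q) :
    TameBy D W (fun s => (F s).bind G) (.seq p q) := by
  obtain ⟨T, P, h⟩ := hp
  obtain ⟨T', P', h'⟩ := hq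
  refine ⟨T + T'.comp (Polynomial.X + T) + 1, P + P', fun s hs m M hm hM => ?_⟩
  obtain ⟨h1, h2⟩ := h s hs m M hm hM
  refine ⟨?_, ?_⟩
  · refine (h1.seq (T' := T'.eval (m + T.eval m)) fun s' hs' => ?_).mono (by simp)
    obtain ⟨h3, h4, -⟩ := h2 s' hs'
    exact (h' s' h3 _ M (h1.bd hm hs') fun w hw => h4 w hw ▸ hM w hw).1
  · intro s' hs'
    obtain ⟨s₁, hs₁, hs₂⟩ := (PMF.mem_support_bind_iff _ _ _).1 hs'
    obtain ⟨h3, h4, h5⟩ := h2 s₁ hs₁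
    obtain ⟨h6, h7, h8⟩ := (h' s₁ h3 _ M h5 fun w hw => h4 w hw ▸ hM w hw).2 s' hs₂
    exact ⟨h6, fun w hw => (h7 w hw).trans (h4 w hw), h8.mono (by simp [add_assoc])⟩

theorem TameBy.branch {D r : ℕ} {W : List ℕ} {F G H : Store → PMF Store} {p q u : Prog}
    (hp : TameBy D W F p) (hq : TameBy D W G q) (hu : TameBy D W H u) :
    TameBy D W (fun s => pick (F s) (G s) (H s) (s r)) (.branch r p q u) := by
  obtain ⟨T, P, h⟩ := hp
  obtain ⟨T', P', h'⟩ := hq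
  obtain ⟨T'', P'', h''⟩ := hu
  refine ⟨T + T' + T'' + 1, P + P' + P'', fun s hs m M hm hM => ?_⟩
  have e : ∀ A B C : ℕ[X], ∀ x, (A + B + C).eval x = A.eval x + B.eval x + C.eval x := by simp
  have e1 : ∀ A B C : ℕ[X], ∀ x, (A + B + C + 1).eval x = A.eval x + B.eval x + C.eval x + 1 := by
    simp
  rw [e1, e]
  beta_reduce
  obtain ⟨h1, h2⟩ := h s hs m M hm hM
  obtain ⟨h1', h2'⟩ := h' s hs m M hm hM
  obtain ⟨h1'', h2''⟩ := h'' s hs m M hm hM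
  rcases hr : s r with _ | ⟨_ | _, L⟩
  · rw [show pick (F s) (G s) (H s) [] = F s from rfl]
    refine ⟨(Halts.branch (T := T.eval m) (by rw [hr]; exact h1)).mono (by omega),
      fun s' hs' => ?_⟩
    obtain ⟨h3, h4, h5⟩ := h2 s' hs'
    exact ⟨h3, h4, h5.mono (by omega)⟩
  · rw [show pick (F s) (G s) (H s) (false :: L) = G s from rfl]
    refine ⟨(Halts.branch (T := T'.eval m) (by rw [hr]; exact h1')).mono (by omega),
      fun s' hs' => ?_⟩
    obtain ⟨h3, h4, h5⟩ := h2' s' hs'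
    exact ⟨h3, h4, h5.mono (by omega)⟩
  · rw [show pick (F s) (G s) (H s) (true :: L) = H s from rfl]
    refine ⟨(Halts.branch (T := T''.eval m) (by rw [hr]; exact h1'')).mono (by omega),
      fun s' hs' => ?_⟩
    obtain ⟨h3, h4, h5⟩ := h2'' s' hs'
    exact ⟨h3, h4, h5.mono (by omega)⟩

/-- Growth does not compound: one round adds at most `P(M)` to the longest register, where `M`
bounds registers that the body preserves. So all rounds stay below `m + |L| P(M) ≤ B`, and each
costs at most `T(B) + 3`. A bound on growth in terms of `m` alone would not survive iteration. -/
theorem halts_iter {D r : ℕ} (hr : r < D) {W : List ℕ} {F : Store → PMF Store} {p : Prog}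
    {T P : ℕ[X]} {M B : ℕ}
    (h : ∀ s, Clean D s → ∀ m, Bd m s → (∀ w ∈ r :: W, (s w).length ≤ M) →
      Halts [p] s (T.eval m) (F s) ∧ ∀ s' ∈ (F s).support,
        Clean D s' ∧ (∀ w ∈ r :: W, s' w = s w) ∧ Bd (m + P.eval M) s')
    (hW : r ∉ W) (L : List Bool) {s : Store} (hs : Clean D s) {m : ℕ} (hm : Bd m s)
    (hM : ∀ w ∈ W, (s w).length ≤ M) (hL : s r = L) (hLM : L.length ≤ M)
    (hB : m + L.length * P.eval M ≤ B) :
    Halts [.loop r (.seq (.pop r) p)] s (L.length * (T.eval B + 3) + 1) (iterDen F r L s) ∧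
      ∀ s' ∈ (iterDen F r L s).support, Clean D s' ∧ (∀ w ∈ W, s' w = s w) ∧
        Bd (m + L.length * P.eval M) s' := by
  induction L generalizing s m with
  | nil =>
    have e : Function.update s r [] = s := by rw [← hL, Function.update_eq_self]
    simp only [iterDen, e, PMF.mem_support_pure_iff]
    refine ⟨(halts_loop_nil _ hL).mono (by simp), ?_⟩
    rintro s' rfl
    exact ⟨hs, fun _ _ => rfl, hm.mono (by simp)⟩
  | cons a L ih =>
    simp only [List.length_cons, add_mul, one_mul] at hB hLM ⊢
    have hs₁ := hs.update hr L
    have hm₁ : Bd m (Function.update s r L) := hm.update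
      ((by rw [hL]; simp : L.length ≤ (s r).length).trans (hm r))
    have hWr : ∀ w ∈ W, Function.update s r L w = s w := fun w hw =>
      Function.update_of_ne (ne_of_mem_of_not_mem hw hW) _ _
    obtain ⟨h1, h2⟩ := h _ hs₁ m hm₁ (by
      intro w hw
      rcases List.mem_cons.1 hw with rfl | hw
      · simp only [Function.update_self]; omega
      · rw [hWr w hw]; exact hM w hw)
    have h3 := fun s' hs' => by
      obtain ⟨h4, h5, h6⟩ := h2 s' hs'
      have h7 : ∀ w ∈ W, s' w = s w := fun w hw =>
        (h5 w (List.mem_cons_of_mem _ hw)).trans (hWr w hw)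
      exact And.intro h7 (ih h4 h6 (fun w hw => h7 w hw ▸ hM w hw)
        ((h5 r List.mem_cons_self).trans (by simp)) (by omega) (by omega))
    constructor
    · have hb : Halts [.seq (.pop r) p] s (T.eval m + 2) (F (Function.update s r L)) := by
        have := (halts_pop r s)
        rw [hL] at this
        exact (this.seq_pure h1).mono (by omega)
      refine (Halts.loop (by simp [hL]) hb fun s' hs' => (h3 s' hs').2.1).mono ?_
      have := eval_mono T (show m ≤ B by omega)
      omega
    · intro s' hs'
      obtain ⟨s₁, hs₁, hs₂⟩ := (PMF.mem_support_bind_iff _ _ _).1 hs'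
      obtain ⟨h4, h5⟩ := h3 s₁ hs₁
      obtain ⟨h6, h7, h8⟩ := h5.2 s' hs₂
      exact ⟨h6, fun w hw => (h7 w hw).trans (h4 w hw), h8.mono (by omega)⟩

theorem TameBy.iter {D w r : ℕ} (hw : w < D) (hr : r < D) {W : List ℕ} (hwW : w ∈ W)
    (hrW : r ∉ W) {F : Store → PMF Store} {p : Prog} (hp : TameBy D (r :: W) F p) :
    TameBy D W (fun s => iterDen F r (s w) s)
      (.seq (copyP w r D) (.loop r (.seq (.pop r) p))) := by
  obtain ⟨T, P, h⟩ := hp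
  have hrw : w ≠ r := fun h => hrW (h ▸ hwW)
  refine ⟨14 * Polynomial.X + 7 + Polynomial.X * (T.comp (Polynomial.X + Polynomial.X * P) + 3),
    Polynomial.X * P, fun s hs m M hm hM => ?_⟩
  -- The running time must be polynomial in `m` and the growth polynomial in `M`; using `min m M` as
  -- the bound for the registers in `W` serves both.
  have hmin : ∀ w ∈ W, (s w).length ≤ min m M := fun w hw => le_min (hm w) (hM w hw)
  have hs₁ := hs.update hr (s w)
  have hm₁ : Bd m (Function.update s r (s w)) := hm.update (hm w)
  have hWr : ∀ w' ∈ W, Function.update s r (s w) w' = s w' := fun w hw =>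
    Function.update_of_ne (ne_of_mem_of_not_mem hw hrW) _ _
  have hPm := eval_mono P (min_le_left m M)
  have hPM := eval_mono P (min_le_right m M)
  have hwm := hmin w hwW
  obtain ⟨h1, h2⟩ := halts_iter (B := m + m * P.eval m) hr
    (fun s hs m' hm' hM' => h s hs m' (min m M) hm' hM') hrW (s w) hs₁
    hm₁ (fun w' hw' => (hWr w' hw').symm ▸ hmin w' hw') (by simp) (hmin w hwW)
    (Nat.add_le_add_left (Nat.mul_le_mul (hm w) hPm) _)
  -- Both clauses of `iterDen` first overwrite `r`, so its initial contents are irrelevant.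
  have e : iterDen F r (s w) (Function.update s r (s w)) = iterDen F r (s w) s := by
    cases s w <;> simp [iterDen]
  rw [e] at h1 h2
  constructor
  · refine ((halts_copyP (by omega) (by omega) hrw (hs D le_rfl) hm).seq_pure h1).mono ?_
    have := Nat.mul_le_mul_right (T.eval (m + m * P.eval m) + 3) (hm w)
    simp
    omega
  · intro s' hs'
    obtain ⟨h3, h4, h5⟩ := h2 s' hs'
    refine ⟨h3, fun w' hw' => (h4 w' hw').trans (hWr w' hw'), h5.mono ?_⟩
    have := Nat.mul_le_mul (hwm.trans (min_le_right m M)) hPM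
    simp
    omega

/-- For the basic instructions the growth polynomial is `1` for `push` and `0` otherwise; the
compound ones are the closure properties above. -/
theorem Code.tameBy {D : ℕ} (c : Code) {W : List ℕ} (h : c.tame D W) :
    TameBy D W c.den (c.compile D) := by
  induction c generalizing W with
  | push b r =>
    simp [tame] at h
    refine TameBy.of_pure 1 1 fun s hs m hm => ⟨(halts_push b r s).mono (by simp), hs.update h.1 _,
      fun w hw => Function.update_of_ne (ne_of_mem_of_not_mem hw h.2) _ _, fun M => ?_⟩
    refine (hm.mono (by simp)).update ?_
    have := hm r
    simp; omega
  | pop r =>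
    simp [tame] at h
    refine TameBy.of_pure 1 0 fun s hs m hm => ⟨(halts_pop r s).mono (by simp), hs.update h.1 _,
      fun w hw => Function.update_of_ne (ne_of_mem_of_not_mem hw h.2) _ _, fun M => ?_⟩
    refine (hm.mono (by simp)).update ?_
    have := hm r
    simp; omega
  | clear r =>
    simp [tame] at h
    refine TameBy.of_pure (2 * Polynomial.X + 1) 0 fun s hs m hm =>
      ⟨(halts_clearP r s).mono ?_, hs.update h.1 _,
      fun w hw => Function.update_of_ne (ne_of_mem_of_not_mem hw h.2) _ _, fun M => ?_⟩
    · have := hm r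
      simp; omega
    · exact (hm.mono (by simp)).update (by simp)
  | copy r t =>
    simp [tame] at h
    refine TameBy.of_pure (14 * Polynomial.X + 5) 0 fun s hs m hm =>
      ⟨(halts_copyP (by omega) (by omega) h.1.2 (hs D le_rfl) hm).mono (by simp),
      hs.update h.1.1.2 _,
      fun w hw => Function.update_of_ne (ne_of_mem_of_not_mem hw h.2) _ _, fun M => ?_⟩
    refine (hm.mono (by simp)).update ?_
    have := hm r
    simp; omega
  | rev r t =>
    simp [tame] at h
    refine TameBy.of_pure (7 * Polynomial.X + 3) 0 fun s hs m hm => ⟨?_,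
      (hs.update h.1.1.1.2 _).update h.1.1.1.1 _,
      fun w hw => ?_, fun M => ?_⟩
    · have h1 := hm r
      have h2 := hm t
      have := (halts_clearP t s).seq_pure (halts_moveP h.1.1.2 _)
      refine this.to ?_ ?_
      · simp [Function.update_of_ne h.1.1.2]
      · simp [Function.update_of_ne h.1.1.2]; omega
    · rw [Function.update_of_ne (ne_of_mem_of_not_mem hw h.2),
        Function.update_of_ne (ne_of_mem_of_not_mem hw h.1.2)]
    · refine ((hm.mono (by simp)).update ?_).update (by simp)
      have := hm r
      simp; omega
  | draw r t =>
    simp [tame] at h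
    refine ⟨1, 0, fun s hs m M hm hM => ⟨(halts_draw r t s).mono (by simp), fun s' hs' => ?_⟩⟩
    obtain ⟨i, hi, rfl⟩ := (PMF.mem_support_map_iff _ _ _).1 hs'
    refine ⟨hs.update h.1.2 _,
      fun w hw => Function.update_of_ne (ne_of_mem_of_not_mem hw h.2) _ _, ?_⟩
    refine (hm.mono (by simp)).update ?_
    have := le_of_mem_support_drawNat hi
    have := hm r
    simp; omega
  | drop r t =>
    simp [tame] at h
    refine TameBy.of_pure (4 * Polynomial.X + 1) 0 fun s hs m hm => ⟨?_,
      (hs.update h.1.1.1.2 _).update h.1.1.1.1 _,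
      fun w hw => ?_, fun M => ?_⟩
    · have := hm r
      exact (halts_dropP h.1.1.2 s).mono (by simp; omega)
    · rw [Function.update_of_ne (ne_of_mem_of_not_mem hw h.2),
        Function.update_of_ne (ne_of_mem_of_not_mem hw h.1.2)]
    · refine ((hm.mono (by simp)).update ?_).update (by simp)
      have := hm t
      simp; omega
  | seq c d hc hd =>
    simp only [tame, Bool.and_eq_true] at h
    exact (hc h.1).seq (hd h.2)
  | branch r c d e hc hd he =>
    simp only [tame, Bool.and_eq_true] at h
    exact (hc h.1.1.2).branch (hd h.1.2) (he h.2)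
  | iter w r c hc =>
    simp [tame] at h
    exact TameBy.iter h.1.1.1.1 h.1.1.2 h.1.1.1.2 h.1.2 (hc h.2)

/-! ### Polynomial time transformations of the store -/

/-- Some program computes `F` in polynomial time, on stores whose registers from `D` on are empty. -/
def Poly (D : ℕ) (F : Store → PMF Store) : Prop :=
  ∃ (p : Prog) (T : ℕ[X]), ∀ s, Clean D s → ∀ m, Bd m s →
    Halts [p] s (T.eval m) (F s) ∧ ∀ s' ∈ (F s).support, Clean D s'

/-- The protected set `W` matters only inside loops and is forgotten here. Programs joined by
`Poly.bind` may therefore use different sets, and a later one may loop over a register that an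
earlier one has computed. -/
theorem Code.poly {D : ℕ} (c : Code) (W : List ℕ) (h : c.tame D W) : Poly D c.den := by
  obtain ⟨T, P, h⟩ := c.tameBy h
  refine ⟨c.compile D, T, fun s hs m hm => ?_⟩
  obtain ⟨h1, h2⟩ := h s hs m m hm fun w _ => hm w
  exact ⟨h1, fun s' hs' => (h2 s' hs').1⟩

theorem Poly.bind {D : ℕ} {F G : Store → PMF Store} (hF : Poly D F) (hG : Poly D G) :
    Poly D fun s => (F s).bind G := by
  obtain ⟨p, T, h⟩ := hF
  obtain ⟨q, T', h'⟩ := hG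
  refine ⟨.seq p q, T + T'.comp (Polynomial.X + T) + 1, fun s hs m hm => ?_⟩
  obtain ⟨h1, h2⟩ := h s hs m hm
  constructor
  · exact (h1.seq (T' := T'.eval (m + T.eval m)) fun s' hs' =>
      (h' s' (h2 s' hs') _ (h1.bd hm hs')).1).mono (by simp)
  · intro s' hs'
    obtain ⟨s₁, hs₁, hs₂⟩ := (PMF.mem_support_bind_iff _ _ _).1 hs'
    exact (h' s₁ (h2 s₁ hs₁) _ (h1.bd hm hs₁)).2 s' hs₂

theorem Poly.branch {D r : ℕ} {F G H : Store → PMF Store} (hF : Poly D F) (hG : Poly D G)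
    (hH : Poly D H) : Poly D fun s => pick (F s) (G s) (H s) (s r) := by
  obtain ⟨p, T, h⟩ := hF
  obtain ⟨q, T', h'⟩ := hG
  obtain ⟨u, T'', h''⟩ := hH
  refine ⟨.branch r p q u, T + T' + T'' + 1, fun s hs m hm => ?_⟩
  obtain ⟨h1, h2⟩ := h s hs m hm
  obtain ⟨h1', h2'⟩ := h' s hs m hm
  obtain ⟨h1'', h2''⟩ := h'' s hs m hm
  have e : (T + T' + T'' + 1).eval m = T.eval m + T'.eval m + T''.eval m + 1 := by simp
  rw [e]
  beta_reduce
  rcases hr : s r with _ | ⟨_ | _, L⟩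
  · exact ⟨(Halts.branch (T := T.eval m) (by rw [hr]; exact h1)).mono (by omega), h2⟩
  · exact ⟨(Halts.branch (T := T'.eval m) (by rw [hr]; exact h1')).mono (by omega), h2'⟩
  · exact ⟨(Halts.branch (T := T''.eval m) (by rw [hr]; exact h1'')).mono (by omega), h2''⟩

/-! ### Calling an algorithm as a subroutine -/

theorem Bd.overlay {c B m : ℕ} {s σ : Store} (hs : Bd m s) (hσ : Bd m σ) :
    Bd m (RobustEnc.overlay c B s σ) := fun r => by
  simp only [RobustEnc.overlay]
  split_ifs
  · exact hs _
  · exact hσ _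

/-- Copy the given registers to the registers `D + 1 + i, D + 2 + i, …`. -/
def loadP (D : ℕ) : ℕ → List ℕ → Prog
  | _, [] => .skip
  | i, a :: as => .seq (copyP a (D + 1 + i) D) (loadP D (i + 1) as)

theorem halts_loadP {D m : ℕ} (as : List ℕ) (has : ∀ a ∈ as, a < D) (i : ℕ) {s : Store}
    (hs : s D = []) (hm : Bd m s) :
    Halts [loadP D i as] s (as.length * (14 * m + 6) + 1)
      (PMF.pure (overlay (D + 1 + i) as.length (load (as.map s)) s)) := by
  induction as generalizing i s with
  | nil =>
    have e : overlay (D + 1 + i) 0 (load []) s = s := by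
      funext r
      simp only [overlay]
      rw [if_neg (by omega)]
    simp only [List.map_nil, List.length_nil, e]
    exact (halts_skip s).mono (by omega)
  | cons a as ih =>
    have ha : a < D := has a (by simp)
    have h := ih (fun a ha => has a (by simp [ha])) (i + 1) (s := Function.update s (D + 1 + i) (s a))
      (by rw [Function.update_of_ne (by omega), hs]) (hm.update (hm a))
    refine ((halts_copyP (by omega) (by omega) (by omega) hs hm).seq_pure h).to ?_ ?_
    · congr 1
      have e : as.map (Function.update s (D + 1 + i) (s a)) = as.map s := by
        refine List.map_congr_left fun b hb => Function.update_of_ne ?_ _ _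
        have := has b (by simp [hb])
        omega
      rw [e]
      funext r
      simp only [overlay, List.length_cons, List.map_cons]
      by_cases hr : r = D + 1 + i
      · subst hr
        rw [if_neg (by omega), if_pos (by omega)]
        simp [load]
      · by_cases hr' : D + 1 + (i + 1) ≤ r ∧ r < D + 1 + (i + 1) + as.length
        · rw [if_pos hr', if_pos (by omega),
            show r - (D + 1 + i) = r - (D + 1 + (i + 1)) + 1 by omega]
          simp [load]
        · rw [if_neg hr', if_neg (by omega), Function.update_of_ne hr]
    · simp only [List.length_cons, add_mul, one_mul]
      omega

/-- Copy the registers `D + 1, …, D + c` to the registers `o, …, o + c - 1`. -/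
def outP (D o : ℕ) : ℕ → Prog
  | 0 => .skip
  | i + 1 => .seq (outP D o i) (copyP (D + 1 + i) (o + i) D)

theorem halts_outP {D o c m : ℕ} (ho : o + c ≤ D) {s : Store} (hs : s D = []) (hm : Bd m s) :
    Halts [outP D o c] s (c * (14 * m + 6) + 1)
      (PMF.pure (overlay o c (fun j => s (D + 1 + j)) s)) := by
  induction c with
  | zero =>
    have e : overlay o 0 (fun j => s (D + 1 + j)) s = s := by
      funext r
      simp only [overlay]
      rw [if_neg (by omega)]
    rw [e]
    exact (halts_skip s).mono (by omega)
  | succ c ih =>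
    have hD : overlay o c (fun j => s (D + 1 + j)) s D = [] := by
      simp only [overlay]
      rw [if_neg (by omega), hs]
    have hm' : Bd m (overlay o c (fun j => s (D + 1 + j)) s) := Bd.overlay (fun j => hm _) hm
    refine ((ih (by omega)).seq_pure (halts_copyP (by omega) (by omega) (by omega) hD hm')).to
      ?_ ?_
    · congr 1
      funext r
      by_cases hr : r = o + c
      · subst hr
        simp only [Function.update_self, overlay]
        rw [if_neg (by omega), if_pos (by omega), Nat.add_sub_cancel_left]
      · rw [Function.update_of_ne hr]
        simp only [overlay]
        split_ifs <;> first | rfl | omega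
    · simp only [add_mul, one_mul]
      omega

theorem inputSize_le {m : ℕ} (L : List (List Bool)) (h : ∀ x ∈ L, x.length ≤ m) :
    inputSize L ≤ L.length * m := by
  have := List.sum_le_card_nsmul (L.map List.length) m (by simpa using h)
  simpa [inputSize] using this

theorem bd_load {m : ℕ} {L : List (List Bool)} (h : ∀ x ∈ L, x.length ≤ m) : Bd m (load L) := by
  intro r
  simp only [load, List.getD_eq_getElem?_getD]
  rcases hr : L[r]? with _ | x
  · simp
  · exact h x (List.mem_of_getElem? hr)

theorem load_of_le {L : List (List Bool)} {r : ℕ} (h : L.length ≤ r) : load L r = [] := by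
  simp [load, List.getElem?_eq_none h]

/-- Run the algorithm `A` on the contents of the registers `args`, and put the first `c` registers
of its output into the registers `o, …, o + c - 1`. -/
def callDen (A : PPT) (args : List ℕ) (o c : ℕ) (s : Store) : PMF Store :=
  (A.out (args.map s)).map fun s' => overlay o c s' s

/-- Register `D` is scratch space for copying. The arguments are copied to the block starting at `D
+ 1`, the renamed program runs there, its outputs are copied back, and the block is cleared so that
the store is clean again. -/
theorem poly_callDen {D o c : ℕ} (A : PPT) {args : List ℕ} (hargs : ∀ a ∈ args, a < D)
    (ho : o + c ≤ D) : Poly D (callDen A args o c) := by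
  obtain ⟨B₀, hB₀⟩ := A.prog.exists_below
  -- The block must contain the program's own registers, the `c` outputs and all arguments.
  obtain ⟨B, hB, hcB, hnB⟩ : ∃ B, A.prog.Below B ∧ c ≤ B ∧ args.length ≤ B :=
    ⟨B₀ + c + args.length, hB₀.mono (by omega), by omega, by omega⟩
  set n := args.length with hn
  set t : ℕ[X] := A.time.comp ((n : ℕ[X]) * Polynomial.X) with ht
  refine ⟨.seq (loadP D 0 args) (.seq (A.prog.shift (D + 1)) (.seq (outP D o c)
    (clearRange (D + 1) B))),
    ((n : ℕ[X]) * (14 * Polynomial.X + 6) + 1) + (t + (((c : ℕ[X]) * (14 * (Polynomial.X + t) + 6) + 1) +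
      ((B : ℕ[X]) * (2 * (Polynomial.X + t) + 2) + 1) + 1) + 1) + 1, fun s hs m hm => ⟨?_, ?_⟩⟩
  · have hargm : ∀ x ∈ args.map s, x.length ≤ m := by
      intro x hx
      obtain ⟨a, -, rfl⟩ := List.mem_map.1 hx
      exact hm a
    have htime : A.time.eval (inputSize (args.map s)) ≤ t.eval m := by
      rw [ht, Polynomial.eval_comp]
      refine eval_mono _ ((inputSize_le _ hargm).trans ?_)
      simp [hn]
    have h1 := halts_loadP args hargs 0 (hs D le_rfl) hm
    -- By cleanness the block is empty beyond the arguments, so it is exactly the initial store of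
    -- `A`.
    have e1 : overlay (D + 1 + 0) n (load (args.map s)) s
        = overlay (D + 1) B (load (args.map s)) s := by
      funext r
      simp only [overlay, Nat.add_zero]
      by_cases hr : D + 1 ≤ r ∧ r < D + 1 + n
      · rw [if_pos hr, if_pos (by omega)]
      · rw [if_neg hr]
        split_ifs with h
        · rw [hs r (by omega), load_of_le (by simp; omega)]
        · rfl
    rw [← hn, e1] at h1
    have h2 := ((A.halts_out (args.map s)).shift (c := D + 1) hB s).mono htime
    have hm1 : Bd m (overlay (D + 1) B (load (args.map s)) s) := (bd_load hargm).overlay hm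
    set M := m + t.eval m with hM
    have h3 : ∀ s₂ ∈ ((A.out (args.map s)).map fun s' => overlay (D + 1) B s' s).support,
        Halts [.seq (outP D o c) (clearRange (D + 1) B)] s₂
          ((c * (14 * M + 6) + 1) + (B * (2 * M + 2) + 1) + 1)
          (PMF.pure (fun r => if o ≤ r ∧ r < o + c then s₂ (D + 1 + (r - o)) else s r)) := by
      intro s₂ hs₂
      have hm2 : Bd M s₂ := h2.bd hm1 hs₂
      obtain ⟨s', hs', rfl⟩ := (PMF.mem_support_map_iff _ _ _).1 hs₂
      have h4 := halts_outP (o := o) (c := c) (m := M) ho (s := overlay (D + 1) B s' s)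
        (by simp only [overlay]; rw [if_neg (by omega), hs D le_rfl]) hm2
      refine (h4.seq_pure (halts_clearRange (D + 1) B (m := M) (Bd.overlay (fun j => hm2 _) hm2))).to ?_
        le_rfl
      congr 1
      funext r
      by_cases h1 : D + 1 ≤ r ∧ r < D + 1 + B
      · simp only [overlay]
        rw [if_pos h1, if_neg (by omega), hs r (by omega)]
      · by_cases h2 : o ≤ r ∧ r < o + c
        · simp only [overlay]
          rw [if_neg h1, if_pos h2, if_pos h2]
        · simp only [overlay]
          rw [if_neg h1, if_neg h2, if_neg h2, if_neg h1]
    have h5 := h1.seq_pure (h2.seq h3)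
    refine h5.to ?_ ?_
    · rw [PMF.bind_map, callDen, PMF.map]
      congr 1
      funext s'
      simp only [Function.comp]
      congr 1
      funext r
      simp only [overlay]
      by_cases h : o ≤ r ∧ r < o + c
      · rw [if_pos h, if_pos h, if_pos (by omega), Nat.add_sub_cancel_left]
      · rw [if_neg h, if_neg h]
    · simp [hM]
  · intro s' hs'
    obtain ⟨s'', -, rfl⟩ := (PMF.mem_support_map_iff _ _ _).1 hs'
    intro r hr
    simp only [overlay]
    rw [if_neg (by omega), hs r hr]

/-- A polynomial time transformation of the store gives a probabilistic polynomial time algorithm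
for inputs consisting of `a` strings. -/
theorem Poly.exists_ppt {D : ℕ} {F : Store → PMF Store} (hF : Poly D F) {a : ℕ} (ha : a ≤ D) :
    ∃ M : PPT, ∀ inp : List (List Bool), inp.length ≤ a → M.out inp = F (load inp) := by
  obtain ⟨p, T, h⟩ := hF
  obtain ⟨B₀, hB₀⟩ := p.exists_below
  -- A `PPT` must halt on every input, also on inputs with more than `a` strings, for which `F`
  -- gives no guarantee. The program therefore first clears the registers from `a` up to `a + j = B₀
  -- + D`, which covers all registers that `p` can access.
  set j := B₀ + D - a with hj
  set q : Prog := .seq (clearRange a j) p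
  have hcl : ∀ a j : ℕ, (clearRange a j).Below (a + j) := fun a j => by
    induction j with
    | zero => trivial
    | succ j ih => exact ⟨⟨by simp, by simp [Prog.Below]⟩, ih.mono (by omega)⟩
  have hqB : q.Below (a + j) := ⟨hcl a j, hB₀.mono (by omega)⟩
  set T' : ℕ[X] := ((j : ℕ[X]) * (2 * Polynomial.X + 2) + 1) + T + 1 with hT'
  have key : ∀ inp : List (List Bool), inp.length ≤ a + j →
      ∀ m, Bd m (load inp) → Halts [q] (load inp) (T'.eval m) (F (load (inp.take a))) := by
    intro inp hinp m hm
    have e : overlay a j (fun _ => []) (load inp) = load (inp.take a) := by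
      funext r
      simp only [overlay]
      split_ifs with h
      · rw [load_of_le]
        simp; omega
      · by_cases hr : r < a
        · simp [load, hr]
        · rw [load_of_le (by omega), load_of_le]
          simp; omega
    have h1 := halts_clearRange a j hm
    rw [e] at h1
    have h2 := (h (load (inp.take a)) (fun r hr => load_of_le (by simp; omega)) m (fun r => by
      by_cases hr : r < a
      · refine (hm r).trans' ?_
        simp [load, hr]
      · rw [load_of_le (by simp; omega)]
        simp)).1
    refine (h1.seq_pure h2).mono ?_
    simp [hT']
  have hsize : ∀ inp : List (List Bool), Bd (inputSize inp) (load inp) := fun inp =>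
    bd_load fun x hx => List.single_le_sum (by simp) _ (List.mem_map_of_mem hx)
  -- Input strings from position `a + j` on lie in registers that the program never touches. The
  -- trivial renaming `c = 0` reduces to the truncated input.
  have hall : ∀ inp : List (List Bool), ∃ ν,
      Halts [q] (load inp) (T'.eval (inputSize inp)) ν := by
    intro inp
    have h1 := key (inp.take (a + j)) (by simp) (inputSize inp) (fun r => by
      by_cases hr : r < a + j
      · refine (hsize inp r).trans' ?_
        simp [load, hr]
      · rw [load_of_le (by simp; omega)]
        simp)
    have h2 := h1.shift (c := 0) hqB (load inp)
    have e : overlay 0 (a + j) (load (inp.take (a + j))) (load inp) = load inp := by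
      funext r
      simp only [overlay]
      split_ifs with h
      · simp [load, show r < a + j by omega]
      · rfl
    rw [e, Prog.shift_zero] at h2
    exact ⟨_, h2⟩
  refine ⟨⟨q, T', fun inp => (hall inp).choose_spec.support⟩, fun inp hinp => ?_⟩
  have := (key inp (by omega) _ (hsize inp)).map_snd
  rwa [List.take_of_length_le hinp] at this

/-! ### Distributions of words as distributions of bit strings -/

/-- Both total masses are `1`, so a strict inequality at one point would be a contradiction. -/
theorem pmf_eq_of_le {α : Type*} {p q : PMF α} (h : ∀ a, p a ≤ q a) : p = q := by
  ext a
  refine (h a).antisymm (not_lt.1 fun hlt => ?_)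
  have := ENNReal.tsum_lt_tsum (f := p) (g := q) (i := a) (by simp [p.tsum_coe]) h hlt
  simp [p.tsum_coe, q.tsum_coe] at this

theorem map_apply_of_injective {α β : Type*} (p : PMF α) {f : α → β} (hf : Function.Injective f)
    (a : α) : p.map f (f a) = p a := by
  rw [PMF.map_apply, tsum_eq_single a]
  · simp
  · intro b hb
    rw [if_neg fun h => hb (hf h).symm]

theorem map_apply_of_forall_ne {α β : Type*} (p : PMF α) {f : α → β} {b : β} (h : ∀ a, f a ≠ b) :
    p.map f b = 0 := by
  rw [PMF.map_apply, ENNReal.tsum_eq_zero]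
  exact fun a => if_neg (h a).symm

/-- An inequality on the image suffices: the masses being equal, nothing is left for the points
outside it. -/
theorem map_eq_of_injective {α β : Type*} {p : PMF α} {q : PMF β} {f : α → β}
    (hf : Function.Injective f) (h : ∀ a, p a ≤ q (f a)) : p.map f = q := by
  refine pmf_eq_of_le fun b => ?_
  by_cases hb : ∃ a, f a = b
  · obtain ⟨a, rfl⟩ := hb
    rw [map_apply_of_injective p hf]
    exact h a
  · rw [map_apply_of_forall_ne p fun a ha => hb ⟨a, ha⟩]
    exact zero_le

/-! ### Independent samples -/

theorem iid_zero {α : Type} (μ : PMF α) : iid μ 0 = PMF.pure [] := rfl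

theorem iid_succ {α : Type} (μ : PMF α) (q : ℕ) :
    iid μ (q + 1) = μ.bind fun x => (iid μ q).map fun xs => x :: xs := rfl

theorem iid_map {α β : Type} (μ : PMF α) (f : α → β) (q : ℕ) :
    iid (μ.map f) q = (iid μ q).map (List.map f) := by
  induction q with
  | zero => simp [iid_zero, PMF.pure_map]
  | succ q ih =>
    simp only [iid_succ, ih, PMF.bind_map, PMF.map_bind, PMF.map_comp]
    rfl

theorem iid_add {α : Type} (μ : PMF α) (a b : ℕ) :
    iid μ (a + b) = (iid μ a).bind fun xs => (iid μ b).map fun ys => xs ++ ys := by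
  induction a with
  | zero => simp only [Nat.zero_add, iid_zero, PMF.pure_bind, List.nil_append]; exact
      (PMF.map_id _).symm
  | succ a ih =>
    rw [Nat.succ_add]
    simp only [iid_succ, ih, PMF.bind_bind, PMF.bind_map, PMF.map_bind, PMF.map_comp]
    rfl

theorem iid_one {α : Type} (μ : PMF α) : iid μ 1 = μ.map fun x => [x] := by
  simp only [iid_succ, iid_zero, PMF.pure_map]
  rfl

/-- Needed because programs build words by pushing bits onto a stack, hence in reverse order;
independent samples are exchangeable. -/
theorem iid_reverse {α : Type} (μ : PMF α) (q : ℕ) : (iid μ q).map List.reverse = iid μ q := by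
  induction q with
  | zero => simp [iid_zero, PMF.pure_map]
  | succ q ih =>
    conv_rhs => rw [iid_add, ← ih, iid_one]
    simp only [iid_succ, PMF.map_bind, PMF.map_comp, PMF.bind_map, Function.comp_def,
      List.reverse_cons]
    simp only [PMF.map, Function.comp_def]
    rw [PMF.bind_comm]

theorem length_of_mem_support_iid {α : Type} {μ : PMF α} {q : ℕ} {xs : List α}
    (h : xs ∈ (iid μ q).support) : xs.length = q := by
  induction q generalizing xs with
  | zero => simp [iid_zero] at h; simp [h]
  | succ q ih =>
    simp only [iid_succ, PMF.mem_support_bind_iff, PMF.mem_support_map_iff] at h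
    obtain ⟨x, -, ys, hys, rfl⟩ := h
    simp [ih hys]

/-- Uniformly random strings of length `n`. -/
def bits (n : ℕ) : PMF (List Bool) := iid (PMF.uniformOfFintype Bool) n

theorem bits_apply (L : List Bool) : bits L.length L = ((2 : ENNReal) ^ L.length)⁻¹ := by
  induction L with
  | nil => simp [bits, iid_zero]
  | cons b L ih =>
    have hb : bits (b :: L).length (b :: L) = 2⁻¹ * bits L.length L := by
      simp only [bits, List.length_cons, iid_succ, PMF.bind_apply, tsum_fintype,
        Fintype.sum_bool, PMF.uniformOfFintype_apply, Fintype.card_bool]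
      have h1 : ∀ b' : Bool, b' ≠ b → ((iid (PMF.uniformOfFintype Bool) L.length).map
          fun xs => b' :: xs) (b :: L) = 0 := fun b' hb' =>
        map_apply_of_forall_ne _ fun a ha => hb' (List.cons.inj ha).1
      have h2 : ((iid (PMF.uniformOfFintype Bool) L.length).map
          fun xs => b :: xs) (b :: L) = iid (PMF.uniformOfFintype Bool) L.length L :=
        map_apply_of_injective _ (List.cons_injective) L
      cases b <;> simp [h1, h2]
    rw [hb, ih, List.length_cons, pow_succ', ENNReal.mul_inv (by simp) (by simp)]

theorem uniform_map_eq_bits {α : Type} [Fintype α] [Nonempty α] {f : α → List Bool} {n : ℕ}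
    (hf : Function.Injective f) (hn : ∀ a, (f a).length = n) (hc : Fintype.card α = 2 ^ n) :
    (PMF.uniformOfFintype α).map f = bits n := by
  refine map_eq_of_injective hf fun a => le_of_eq ?_
  have := bits_apply (f a)
  rw [hn] at this
  rw [this, PMF.uniformOfFintype_apply, hc]
  simp

theorem length_wordBits {n : ℕ} (x : Word n) : (wordBits x).length = n := by simp [wordBits]

theorem zmod_two_eq {a b : ZMod 2} (h : decide (a = 1) = decide (b = 1)) : a = b := by
  revert a b
  decide

theorem wordBits_injective {n : ℕ} : Function.Injective (wordBits (n := n)) := by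
  intro x y h
  funext i
  exact zmod_two_eq (congrFun (List.ofFn_injective h) i)

theorem uniform_map_wordBits (n : ℕ) : (PMF.uniformOfFintype (Word n)).map wordBits = bits n :=
  uniform_map_eq_bits wordBits_injective length_wordBits (by simp [Word, ZMod.card])

theorem matBits_succ {k n : ℕ} (G : Matrix (Fin (k + 1)) (Fin n) (ZMod 2)) :
    matBits G = wordBits (G 0) ++ matBits (G.submatrix Fin.succ id) := by
  simp [matBits, List.ofFn_succ]
  rfl

theorem length_matBits {k n : ℕ} (G : Matrix (Fin k) (Fin n) (ZMod 2)) :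
    (matBits G).length = k * n := by
  induction k with
  | zero => simp [matBits]
  | succ k ih =>
    rw [matBits_succ, List.length_append, ih, length_wordBits]
    ring

theorem matBits_injective {k n : ℕ} :
    Function.Injective (matBits : Matrix (Fin k) (Fin n) (ZMod 2) → List Bool) := by
  induction k with
  | zero => intro A B _; funext i; exact i.elim0
  | succ k ih =>
    intro A B h
    rw [matBits_succ, matBits_succ] at h
    obtain ⟨h1, h2⟩ := List.append_inj h (by simp [length_wordBits])
    have h3 := ih h2
    funext i
    refine Fin.cases (wordBits_injective h1) (fun j => congrFun h3 j) i

theorem uniform_map_matBits (k n : ℕ) :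
    (PMF.uniformOfFintype (Matrix (Fin k) (Fin n) (ZMod 2))).map matBits = bits (k * n) :=
  uniform_map_eq_bits matBits_injective length_matBits (by
    rw [show Fintype.card (Matrix (Fin k) (Fin n) (ZMod 2))
      = Fintype.card (Fin k → Fin n → ZMod 2) from rfl]
    simp [ZMod.card, ← pow_mul, mul_comm])

/-! ### Random words of given weight -/

/-- Sequential sampling of a string of length `n` with `w` ones. -/
def errBits : ℕ → ℕ → PMF (List Bool)
  | 0, _ => PMF.pure []
  | n + 1, w => (drawNat (n + 1)).bind fun i =>
      if i < w then (errBits n (w - 1)).map (List.cons true) else (errBits n w).map (List.cons false)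

theorem length_of_mem_support_errBits {n w : ℕ} {L : List Bool} (h : L ∈ (errBits n w).support) :
    L.length = n := by
  induction n generalizing w L with
  | zero => simp [errBits] at h; simp [h]
  | succ n ih =>
    simp only [errBits, PMF.mem_support_bind_iff] at h
    obtain ⟨i, -, h⟩ := h
    split_ifs at h <;> obtain ⟨L', h', rfl⟩ := (PMF.mem_support_map_iff _ _ _).1 h <;>
      simp [ih h']

theorem drawNat_bind_ite_apply {α : Type} {n w : ℕ} (hw : w ≤ n + 1) (p q : PMF α) (a : α) :
    (drawNat (n + 1)).bind (fun i => if i < w then p else q) a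
      = (w * p a + (n + 1 - w : ℕ) * q a) / (n + 1 : ℕ) := by
  have hcard : (Finset.univ.filter fun i : Fin (n + 1) => (i : ℕ) < w).card = w := by
    rw [Fin.card_filter_val_lt]
    omega
  have hcard' : (Finset.univ.filter fun i : Fin (n + 1) => ¬ (i : ℕ) < w).card = n + 1 - w := by
    have := Finset.card_filter_add_card_filter_not (s := (Finset.univ : Finset (Fin (n + 1))))
      fun i : Fin (n + 1) => (i : ℕ) < w
    rw [hcard] at this
    simp only [Finset.card_univ, Fintype.card_fin] at this
    omega
  rw [drawNat, PMF.bind_map, PMF.bind_apply, tsum_fintype]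
  simp only [Function.comp, PMF.uniformOfFintype_apply, Fintype.card_fin]
  rw [← Finset.mul_sum, mul_comm, ← div_eq_mul_inv]
  congr 1
  have : ∀ i : Fin (n + 1), (if (i : ℕ) < w then p else q) a = if (i : ℕ) < w then p a else q a :=
    fun i => by split_ifs <;> rfl
  simp only [this]
  rw [Finset.sum_ite, Finset.sum_const, Finset.sum_const, hcard, hcard', nsmul_eq_mul,
    nsmul_eq_mul]

/-- With `w` ones to be placed in `n + 1` positions, the first symbol is a one with probability `w /
(n + 1)`. Multiplying by the inverse binomial coefficient for the rest gives the next inverse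
binomial coefficient, by the two absorption identities for a leading one and a leading zero. -/
theorem errBits_apply (L : List Bool) :
    errBits L.length (L.count true) L = ((L.length.choose (L.count true) : ℕ) : ENNReal)⁻¹ := by
  induction L with
  | nil => simp [errBits]
  | cons b L ih =>
    have hle : L.count true ≤ L.length := List.count_le_length
    have key : ∀ a b c d : ℕ, a * d = c * b → b ≠ 0 → c ≠ 0 → d ≠ 0 →
        ((a : ENNReal) * (b : ENNReal)⁻¹) / (c : ENNReal) = (d : ENNReal)⁻¹ := by
      intro a b c d h hb hc hd
      have h' : (a : ENNReal) * d = c * b := by exact_mod_cast h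
      have hb' : (b : ENNReal) ≠ 0 := by exact_mod_cast hb
      have hc' : (c : ENNReal) ≠ 0 := by exact_mod_cast hc
      have hd' : (d : ENNReal) ≠ 0 := by exact_mod_cast hd
      rw [← ENNReal.mul_right_inj hd' (by simp), ENNReal.mul_inv_cancel hd' (by simp),
        div_eq_mul_inv, mul_comm, mul_right_comm, mul_right_comm (a : ENNReal), h',
        mul_comm (c : ENNReal), mul_assoc (b : ENNReal), mul_assoc,
        mul_right_comm (c : ENNReal), ENNReal.mul_inv_cancel hc' (by simp), one_mul,
        ENNReal.mul_inv_cancel hb' (by simp)]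
    cases b with
    | true =>
      have e : (true :: L).count true = L.count true + 1 := by simp
      rw [e, List.length_cons, errBits, drawNat_bind_ite_apply (by omega), Nat.add_sub_cancel,
        map_apply_of_injective _ List.cons_injective,
        map_apply_of_forall_ne _ (fun a ha => by simp at ha), ih, mul_zero, add_zero]
      refine key _ _ _ _ ?_ (Nat.choose_pos hle).ne' (by omega) (Nat.choose_pos (by omega)).ne'
      have := Nat.add_one_mul_choose_eq L.length (L.count true)
      rw [this, mul_comm]
    | false =>
      have e : (false :: L).count true = L.count true := by simp
      rw [e, List.length_cons, errBits, drawNat_bind_ite_apply (by omega),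
        map_apply_of_injective _ List.cons_injective,
        map_apply_of_forall_ne _ (fun a ha => by simp at ha), ih, mul_zero, zero_add]
      refine key _ _ _ _ ?_ (Nat.choose_pos hle).ne' (by omega) (Nat.choose_pos (by omega)).ne'
      have := Nat.choose_mul_succ_eq L.length (L.count true)
      rw [mul_comm, ← this, mul_comm]

theorem count_wordBits {n : ℕ} (e : Word n) : (wordBits e).count true = hammingNorm e := by
  have h2 : ∀ a : ZMod 2, (decide (a = 1)).toNat = if a ≠ 0 then 1 else 0 := by decide
  induction n with
  | zero => simp [wordBits, hammingNorm]
  | succ n ih =>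
    have h := ih fun i => e i.succ
    simp only [hammingNorm, Finset.card_filter] at h ⊢
    rw [Fin.sum_univ_succ, ← h, ← h2, wordBits, List.ofFn_succ, List.count_cons, add_comm]
    rcases hd : decide (e 0 = 1) <;> simp [wordBits]

theorem card_weight (n w : ℕ) :
    (Finset.univ.filter fun e : Word n => hammingNorm e = w).card = n.choose w := by
  rw [show n.choose w = (Finset.powersetCard w (Finset.univ : Finset (Fin n))).card by simp]
  refine Finset.card_bij (fun e _ => Finset.univ.filter fun i => e i ≠ 0) ?_ ?_ ?_
  · intro e he
    simpa [Finset.mem_powersetCard, hammingNorm] using he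
  · intro e _ e' _ h
    have h2 : ∀ a b : ZMod 2, (a ≠ 0 ↔ b ≠ 0) → a = b := by decide
    funext i
    refine h2 _ _ ?_
    have := Finset.ext_iff.1 h i
    simpa using this
  · intro S hS
    refine ⟨fun i => if i ∈ S then 1 else 0, ?_, ?_⟩
    · simpa [Finset.mem_powersetCard, hammingNorm] using hS
    · ext i; simp

/-- For `w > n` the two sides differ in general: `randomError` falls back to the zero word, while
sequential sampling produces only ones. This is where `λ ≤ n` is needed. -/
theorem randomError_map_wordBits {n w : ℕ} (hw : w ≤ n) :
    (randomError n w).map wordBits = errBits n w := by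
  have hne : (Finset.univ.filter fun e : Word n => hammingNorm e = w).Nonempty := by
    rw [← Finset.card_pos, card_weight]
    exact Nat.choose_pos hw
  refine map_eq_of_injective wordBits_injective fun e => ?_
  rw [randomError, dif_pos hne]
  by_cases he : hammingNorm e = w
  · rw [PMF.uniformOfFinset_apply_of_mem _ (by simpa using he), card_weight]
    have := errBits_apply (wordBits e)
    rw [length_wordBits, count_wordBits, he] at this
    rw [this]
  -- Words of the wrong weight have mass zero on the left, so there the inequality is trivial and
  -- `errBits` need not be evaluated.
  · rw [PMF.uniformOfFinset_apply_of_notMem _ (by simpa using he)]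
    exact zero_le

theorem hammingNorm_randomError_le {n w : ℕ} {e : Word n} (h : e ∈ (randomError n w).support) :
    hammingNorm e ≤ w := by
  unfold randomError at h
  split_ifs at h with hne
  · have := (PMF.mem_support_uniformOfFinset_iff hne e).1 h
    exact (Finset.mem_filter.1 this).2.le
  · rw [(PMF.mem_support_pure_iff _ _).1 h]
    simp

/-! ### Encoding bit strings -/

/-- Add to `z` the product of the row vector `x` and the matrix with `n` columns whose entries are
listed row by row. -/
def mulBits (n : ℕ) : List Bool → List Bool → List Bool → List Bool
  | [], _, z => z
  | b :: x, G, z => mulBits n x (G.drop n) (List.zipWith (fun a g => xor a (b && g)) z G)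

/-- Induction on the rows: the first row, multiplied by the first message bit, is absorbed into the
accumulator `z`. -/
theorem mulBits_eq {k n : ℕ} (x : Word k) (G : Matrix (Fin k) (Fin n) (ZMod 2)) (z : Word n) :
    mulBits n (wordBits x) (matBits G) (wordBits z) = wordBits (Matrix.vecMul x G + z) := by
  induction k generalizing z with
  | zero =>
    have : Matrix.vecMul x G = 0 := by
      funext j
      simp [Matrix.vecMul, dotProduct]
    simp [this, wordBits, mulBits]
  | succ k ih =>
    have h1 : wordBits x = decide (x 0 = 1) :: wordBits (fun i : Fin k => x i.succ) := by
      simp [wordBits, List.ofFn_succ]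
    have h2 : List.zipWith (fun a g => xor a (decide (x 0 = 1) && g)) (wordBits z)
        (wordBits (G 0) ++ matBits (G.submatrix Fin.succ id)) = wordBits (z + x 0 • G 0) := by
      have h3 : ∀ a b c : ZMod 2, xor (decide (a = 1)) (decide (b = 1) && decide (c = 1))
          = decide (a + b * c = 1) := by decide
      refine List.ext_getElem (by simp [length_wordBits]) fun i hi hi' => ?_
      have hin : i < n := by simpa [length_wordBits] using hi'
      rw [List.getElem_zipWith, List.getElem_append_left (by simpa [length_wordBits] using hin)]
      simp [wordBits, h3]
    rw [h1, matBits_succ, mulBits, h2, List.drop_left' (length_wordBits _), ih]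
    congr 1
    funext j
    simp only [Matrix.vecMul, dotProduct, Fin.sum_univ_succ, Pi.add_apply, Pi.smul_apply,
      smul_eq_mul, Matrix.submatrix_apply, id_eq]
    ring

theorem length_mulBits {n : ℕ} (x : List Bool) {G z : List Bool} (hz : z.length = n)
    (hG : G.length = x.length * n) : (mulBits n x G z).length = n := by
  induction x generalizing G z with
  | nil => exact hz
  | cons b x ih =>
    simp only [List.length_cons, add_mul, one_mul] at hG
    refine ih ?_ ?_
    · rw [List.length_zipWith]; omega
    · rw [List.length_drop]; omega

/-- Noisy codewords: `x G + z` for uniform `x`, and `z` of weight `w`. -/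
def encBits (n k w : ℕ) (G : List Bool) : PMF (List Bool) :=
  (bits k).bind fun x => (errBits n w).map fun z => mulBits n x G z

theorem map_wordBits_enc {n k w : ℕ} (hw : w ≤ n) (x : Word k)
    (G : Matrix (Fin k) (Fin n) (ZMod 2)) :
    ((randomError n w).map fun z => Matrix.vecMul x G + z).map wordBits
      = (errBits n w).map fun z => mulBits n (wordBits x) (matBits G) z := by
  rw [← randomError_map_wordBits hw, PMF.map_comp, PMF.map_comp]
  congr 1
  funext z
  exact (mulBits_eq x G z).symm

theorem uniform_bind_enc {n k w : ℕ} (hw : w ≤ n) (G : Matrix (Fin k) (Fin n) (ZMod 2)) :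
    ((PMF.uniformOfFintype (Word k)).bind fun x =>
      (randomError n w).map fun z => Matrix.vecMul x G + z).map wordBits
      = encBits n k w (matBits G) := by
  rw [PMF.map_bind, encBits, ← uniform_map_wordBits, PMF.bind_map]
  congr 1
  funext x
  exact map_wordBits_enc hw x G

/-! ### Iteration -/

/-- Iteration of a random transformation. -/
def iterK {α : Type*} (μ : α → PMF α) : ℕ → α → PMF α
  | 0, a => PMF.pure a
  | n + 1, a => (μ a).bind (iterK μ n)

theorem iterDen_eq {α : Type*} {F : Store → PMF Store} {r : ℕ} (st : α → List Bool → Store)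
    (μ : α → PMF α) (V : ℕ → α → Prop)
    (hr : ∀ a L L', Function.update (st a L) r L' = st a L')
    (hF : ∀ n a L, V (n + 1) a → F (st a L) = (μ a).map fun a' => st a' L)
    (hV : ∀ n a, V (n + 1) a → ∀ a' ∈ (μ a).support, V n a') (L : List Bool) (a : α)
    (L₀ : List Bool) (h : V L.length a) :
    iterDen F r L (st a L₀) = (iterK μ L.length a).map fun a' => st a' [] := by
  induction L generalizing a L₀ with
  | nil => simp [iterDen, iterK, hr, PMF.pure_map]
  | cons b L ih =>
    simp only [iterDen, hr, List.length_cons, iterK, PMF.map_bind] at h ⊢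
    rw [hF _ _ _ h, PMF.bind_map]
    exact bind_congr_of_support fun a' ha' => ih a' L (hV _ _ h a' ha')

theorem iterK_pure {α : Type*} (f : α → α) (n : ℕ) (a : α) :
    iterK (fun a => PMF.pure (f a)) n a = PMF.pure (f^[n] a) := by
  induction n generalizing a with
  | zero => rfl
  | succ n ih => simp [iterK, ih]

theorem pick_self {α : Type*} (x y : α) (L : List Bool) :
    pick x y y L = if L = [] then x else y := by
  rcases L with _ | ⟨_ | _, L⟩ <;> simp [pick]

/-! ### Sampling uniform words -/

theorem drawNat_two : drawNat 2 = (PMF.uniformOfFintype Bool).map Bool.toNat := by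
  refine (map_eq_of_injective (f := Bool.toNat) (by decide) fun b => le_of_eq ?_).symm
  have h := fun i : Fin 2 => map_apply_of_injective (PMF.uniformOfFintype (Fin 2)) Fin.val_injective i
  cases b
  · have := h 0
    rw [drawNat, show Bool.toNat false = ((0 : Fin 2) : ℕ) from rfl, this]
    simp
  · have := h 1
    rw [drawNat, show Bool.toNat true = ((1 : Fin 2) : ℕ) from rfl, this]
    simp

/-- Push a random bit onto register `y`. -/
def tossCode (y : ℕ) : Code :=
  .push true 11 ;; .push true 11 ;; .draw 11 12 ;; .clear 11 ;;
    .branch 12 (.push false y) (.push true y) (.push true y) ;; .clear 12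

theorem den_tossCode {y : ℕ} (h11 : y ≠ 11) (h12 : y ≠ 12) {s : Store} (hs : s 11 = [])
    (hs' : s 12 = []) : (tossCode y).den s =
      (PMF.uniformOfFintype Bool).map fun b => Function.update s y (b :: s y) := by
  simp only [tossCode, Code.den, PMF.pure_bind, Function.update_self, hs, List.length_cons,
    List.length_nil, Nat.zero_add, Nat.reduceAdd, drawNat_two, PMF.bind_bind, pick_self, PMF.map,
    Function.comp_def]
  refine congrArg _ (funext fun b => ?_)
  cases b
  all_goals
    simp [h11, h12]
    refine congrArg _ (funext fun r => ?_)
    simp only [Function.update_apply]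
    split_ifs <;> simp_all

theorem iterK_cons {α : Type} (μ : PMF α) (n : ℕ) (L : List α) :
    iterK (fun L => μ.map fun b => b :: L) n L = (iid μ n).map fun x => x.reverse ++ L := by
  induction n generalizing L with
  | zero => simp [iterK, iid_zero, PMF.pure_map]
  | succ n ih =>
    simp only [iterK, iid_succ, PMF.map_bind, PMF.bind_map, PMF.map_comp, Function.comp_def, ih]
    simp

/-- Put a random string of the length of register `w` on top of register `y`. -/
def wordCode (w y : ℕ) : Code := .iter w 15 (tossCode y)

/-- The bits are pushed in reverse order, which by `iid_reverse` does not affect the distribution.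
-/
theorem den_wordCode {w y : ℕ} (h11 : y ≠ 11) (h12 : y ≠ 12) (h15 : y ≠ 15) {s : Store}
    (hs11 : s 11 = []) (hs12 : s 12 = []) (hs15 : s 15 = []) : (wordCode w y).den s =
      (bits (s w).length).map fun L => Function.update s y (L ++ s y) := by
  have h := iterDen_eq (F := (tossCode y).den) (r := 15)
    (fun a L => Function.update (Function.update s y a) 15 L)
    (fun L => (PMF.uniformOfFintype Bool).map fun b => b :: L) (fun _ _ => True)
    (by simp) (fun n a L _ => by
      rw [den_tossCode h11 h12 (by simp [h11.symm, hs11])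
        (by simp [h12.symm, hs12]), PMF.map_comp]
      congr 1
      funext b r
      simp only [Function.update_apply, Function.comp]
      split_ifs <;> simp_all) (by simp) (s w) (s y) [] trivial
  have e : Function.update (Function.update s y (s y)) 15 [] = s := by
    rw [Function.update_eq_self, ← hs15, Function.update_eq_self]
  rw [e, iterK_cons, PMF.map_comp] at h
  rw [wordCode, Code.den, h, bits]
  conv_rhs => rw [← iid_reverse, PMF.map_comp]
  congr 1
  funext L r
  simp only [Function.update_apply, Function.comp]
  split_ifs <;> simp_all

/-- Replace register `3` by a random string of the length of register `2` times the length of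
register `1`. -/
def matCode : Code := .clear 3 ;; .iter 2 14 (wordCode 1 3)

theorem iterK_append_bits (n k : ℕ) (a : List Bool) :
    iterK (fun a => (bits n).map fun x => x ++ a) k a = (bits (k * n)).map fun x => x ++ a := by
  induction k generalizing a with
  | zero => simp [iterK, bits, iid_zero, PMF.pure_map]
  | succ k ih =>
    simp only [iterK, PMF.bind_map, ih, Function.comp_def, add_mul, one_mul]
    rw [bits, bits, bits, iid_add, PMF.map_bind]
    simp only [PMF.map_comp]
    simp only [PMF.map]
    rw [PMF.bind_comm]
    simp [Function.comp_def]

theorem den_matCode {s : Store} (hs11 : s 11 = []) (hs12 : s 12 = []) (hs14 : s 14 = [])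
    (hs15 : s 15 = []) : matCode.den s =
      (bits ((s 2).length * (s 1).length)).map fun L => Function.update s 3 L := by
  have h := iterDen_eq (F := (wordCode 1 3).den) (r := 14)
    (fun a L => Function.update (Function.update s 3 a) 14 L)
    (fun a => (bits (s 1).length).map fun x => x ++ a) (fun _ _ => True)
    (by simp) (fun n a L _ => by
      rw [den_wordCode (by decide) (by decide) (by decide)
        (by simp [hs11])
        (by simp [hs12]) (by simp [hs15]),
        PMF.map_comp]
      congr 1
      funext b r
      simp only [Function.update_apply, Function.comp]
      split_ifs <;> simp_all) (by simp) (s 2) [] [] trivial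
  have e : Function.update (Function.update s 3 []) 14 [] = Function.update s 3 [] := by
    funext r
    simp only [Function.update_apply]
    split_ifs <;> simp_all
  rw [e, iterK_append_bits, PMF.map_comp] at h
  simp only [matCode, Code.den, PMF.pure_bind]
  rw [show Function.update s 3 [] 2 = s 2 by simp, h]
  congr 1
  funext L r
  simp only [Function.update_apply, Function.comp]
  split_ifs <;> simp_all

/-! ### Sampling words of given weight -/

/-- Append one symbol to the sequentially sampled word in register `7`; register `10` counts the
remaining positions and register `8` the remaining ones. -/
def errStep : Code :=
  .draw 10 11 ;; .copy 8 12 ;; .drop 11 12 ;;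
    .branch 12 (.push false 7) (.push true 7 ;; .pop 8) (.push true 7 ;; .pop 8) ;;
    .clear 12 ;; .pop 10

/-- Put a random string of the length of register `1`, whose weight is the length of register `0`,
into register `7`. -/
def errCode : Code :=
  .copy 1 10 ;; .copy 0 8 ;; .iter 1 15 errStep ;; .clear 8 ;; .rev 7 8 ;; .copy 8 7 ;; .clear 8 ;;
    .clear 10

/-- The effect of `errStep`. -/
def errStepK (a : List Bool × List Bool × List Bool) : PMF (List Bool × List Bool × List Bool) :=
  (drawNat a.1.length).map fun i =>
    (a.1.tail, if i < a.2.1.length then a.2.1.tail else a.2.1,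
      decide (i < a.2.1.length) :: a.2.2)

/-- The list lengths of the first two components count the remaining positions and the remaining
ones. The word accumulates on a stack, hence the reversal, which `errCode` undoes at the end. -/
theorem iterK_errStepK (n : ℕ) (a : List Bool × List Bool × List Bool) (h : a.1.length = n) :
    (iterK errStepK n a).map (fun a => a.2.2)
      = (errBits n a.2.1.length).map fun L => L.reverse ++ a.2.2 := by
  induction n generalizing a with
  | zero => simp [iterK, errBits, PMF.pure_map]
  | succ n ih =>
    simp only [iterK, errStepK, PMF.map_bind, PMF.bind_map, errBits, h]
    congr 1
    funext i
    rw [Function.comp, ih _ (by simp [h])]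
    dsimp only
    split_ifs with hi
    · rw [PMF.map_comp]
      simp [Function.comp_def, hi]
    · rw [PMF.map_comp]
      simp [Function.comp_def, hi]

theorem den_errCode {s : Store} (hs7 : s 7 = []) (hs8 : s 8 = []) (hs10 : s 10 = [])
    (hs11 : s 11 = []) (hs12 : s 12 = []) (hs15 : s 15 = []) : errCode.den s =
      (errBits (s 1).length (s 0).length).map fun z => Function.update s 7 z := by
  have h := iterDen_eq (F := errStep.den) (r := 15)
    (fun (a : List Bool × List Bool × List Bool) L => Function.update (Function.update
      (Function.update (Function.update s 10 a.1) 8 a.2.1) 7 a.2.2) 15 L)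
    errStepK (fun _ _ => True)
    (by simp) (fun n a L _ => by
      simp only [errStep, Code.den, PMF.pure_bind, errStepK, PMF.map, PMF.bind_bind,
        Function.comp_def]
      rw [show (Function.update (Function.update (Function.update (Function.update s 10 a.1) 8
        a.2.1) 7 a.2.2) 15 L) 10 = a.1 by simp]
      refine congrArg _ (funext fun i => ?_)
      simp only [pick_self]
      by_cases hi : i < a.2.1.length
      · have hi' : ¬ a.2.1.length ≤ i := by omega
        simp [hi, hi']
        refine congrArg _ (funext fun r => ?_)
        simp only [Function.update_apply]
        split_ifs <;> simp_all
      · have hi' : a.2.1.length ≤ i := by omega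
        simp [hi, hi']
        refine congrArg _ (funext fun r => ?_)
        simp only [Function.update_apply]
        split_ifs <;> simp_all) (by simp) (s 1) (s 1, s 0, []) [] trivial
  have e : Function.update (Function.update (Function.update (Function.update s 10 (s 1)) 8 (s 0))
      7 []) 15 [] = Function.update (Function.update s 10 (s 1)) 8 (s 0) := by
    funext r
    simp only [Function.update_apply]
    split_ifs <;> simp_all
  have h2 := congrArg (PMF.map fun L : List Bool => Function.update s 7 L.reverse)
    (iterK_errStepK (s 1).length (s 1, s 0, []) rfl)
  simp only [PMF.map_comp, Function.comp_def, List.append_nil, List.reverse_reverse] at h2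
  simp only [errCode, Code.den, PMF.pure_bind]
  rw [show (Function.update s 10 (s 1)) 0 = s 0 by simp,
    show (Function.update (Function.update s 10 (s 1)) 8 (s 0)) 1 = s 1 by
      simp, ← e, h, ← h2, PMF.bind_map, PMF.map]
  congr 1
  funext a
  simp only [Function.comp]
  congr 1
  funext r
  simp only [Function.update_apply]
  split_ifs <;> simp_all

/-! ### Vector-matrix multiplication -/

/-- Add the product of the top bits of the registers `9` and `10` to the top bit of register `7`,
move the result to register `8`, and pop the registers `7` and `10`. -/
def mulStep : Code :=
  .branch 9 (.pop 8) (.branch 7 (.pop 8) (.push false 8) (.push true 8))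
    (.branch 7 (.pop 8) (.branch 10 (.pop 8) (.push false 8) (.push true 8))
      (.branch 10 (.pop 8) (.push true 8) (.push false 8))) ;;
    .pop 7 ;; .pop 10

/-- Add to the word in register `7` the product of the row vector in register `9` and the matrix in
register `3`, with the help of the lengths in the registers `1` and `2`. -/
def mulCode : Code :=
  .copy 3 10 ;; .iter 2 14 (.iter 1 15 mulStep ;; .pop 9 ;; .rev 8 7) ;; .clear 10

theorem iterate_mulStep (b : Bool) (n : ℕ) (G z u : List Bool) (hz : z.length = n)
    (hG : n ≤ G.length) :
    (fun a : List Bool × List Bool × List Bool => (a.1.tail, a.2.1.tail,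
      xor (a.2.1.headD false) (b && a.1.headD false) :: a.2.2))^[n] (G, z, u)
      = (G.drop n, [], (List.zipWith (fun a g => xor a (b && g)) z G).reverse ++ u) := by
  induction n generalizing G z u with
  | zero => simp [List.length_eq_zero_iff.1 hz]
  | succ n ih =>
    rcases z with _ | ⟨a, z⟩
    · simp at hz
    rcases G with _ | ⟨g, G⟩
    · simp at hG
    rw [Function.iterate_succ, Function.comp]
    simp only [List.tail_cons, List.headD_cons]
    rw [ih _ _ _ (by simpa using hz) (by simpa using hG)]
    simp

theorem den_iter_mulStep {b : Bool} {x : List Bool} {s : Store} (hs9 : s 9 = b :: x)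
    (hs8 : s 8 = []) (hs15 : s 15 = []) (hs7 : (s 7).length = (s 1).length)
    (hs10 : (s 1).length ≤ (s 10).length) :
    (Code.iter 1 15 mulStep).den s = PMF.pure (Function.update (Function.update (Function.update s
      10 ((s 10).drop (s 1).length)) 7 []) 8
        (List.zipWith (fun a g => xor a (b && g)) (s 7) (s 10)).reverse) := by
  have h := iterDen_eq (F := mulStep.den) (r := 15)
    (fun (a : List Bool × List Bool × List Bool) L => Function.update (Function.update
      (Function.update (Function.update s 10 a.1) 7 a.2.1) 8 a.2.2) 15 L)
    (fun a => PMF.pure (a.1.tail, a.2.1.tail,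
      xor (a.2.1.headD false) (b && a.1.headD false) :: a.2.2))
    (fun n a => n ≤ a.1.length ∧ n ≤ a.2.1.length)
    (by simp) (fun n a L ha => by
      obtain ⟨G, z, u⟩ := a
      rcases z with _ | ⟨a, z⟩
      · simp at ha
      rcases G with _ | ⟨g, G⟩
      · simp at ha
      rw [PMF.pure_map]
      cases b <;> cases a <;> cases g <;> simp [mulStep, Code.den, hs9, pick] <;>
        refine congrArg _ (funext fun r => ?_) <;> simp only [Function.update_apply] <;>
        split_ifs <;> simp_all)
    (fun n a ha a' ha' => by
      rw [(PMF.mem_support_pure_iff _ _).1 ha']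
      simp only [List.length_tail]
      omega) (s 1) (s 10, s 7, []) [] ⟨hs10, hs7.ge⟩
  have e : Function.update (Function.update (Function.update (Function.update s 10 (s 10)) 7 (s 7))
      8 []) 15 [] = s := by
    funext r
    simp only [Function.update_apply]
    split_ifs <;> simp_all
  rw [e, iterK_pure, PMF.pure_map, iterate_mulStep b _ _ _ _ hs7 hs10] at h
  rw [Code.den, h]
  refine congrArg _ (funext fun r => ?_)
  simp only [Function.update_apply]
  split_ifs <;> simp_all

theorem iterate_mulRow (n k : ℕ) (x G z : List Bool) (hx : x.length = k) :
    ((fun a : List Bool × List Bool × List Bool => (a.1.tail, a.2.1.drop n,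
      List.zipWith (fun b g => xor b (a.1.headD false && g)) a.2.2 a.2.1))^[k] (x, G, z)).2.2
      = mulBits n x G z ∧ ((fun a : List Bool × List Bool × List Bool => (a.1.tail, a.2.1.drop n,
      List.zipWith (fun b g => xor b (a.1.headD false && g)) a.2.2 a.2.1))^[k] (x, G, z)).1 = [] := by
  induction k generalizing x G z with
  | zero => simp [List.length_eq_zero_iff.1 hx, mulBits]
  | succ k ih =>
    rcases x with _ | ⟨b, x⟩
    · simp at hx
    rw [Function.iterate_succ, Function.comp]
    simp only [List.tail_cons, List.headD_cons]
    exact ih _ _ _ (by simpa using hx)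

theorem den_mulCode {s : Store} (hs8 : s 8 = []) (hs10 : s 10 = []) (hs14 : s 14 = [])
    (hs15 : s 15 = []) (hs9 : (s 9).length = (s 2).length) (hs7 : (s 7).length = (s 1).length)
    (hs3 : (s 3).length = (s 2).length * (s 1).length) :
    mulCode.den s = PMF.pure (Function.update (Function.update s 9 []) 7
      (mulBits (s 1).length (s 9) (s 3) (s 7))) := by
  have h := iterDen_eq (F := (Code.iter 1 15 mulStep ;; .pop 9 ;; .rev 8 7).den) (r := 14)
    (fun (a : List Bool × List Bool × List Bool) L => Function.update (Function.update
      (Function.update (Function.update s 9 a.1) 10 a.2.1) 7 a.2.2) 14 L)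
    (fun a => PMF.pure (a.1.tail, a.2.1.drop (s 1).length,
      List.zipWith (fun b g => xor b (a.1.headD false && g)) a.2.2 a.2.1))
    (fun m a => a.1.length = m ∧ a.2.2.length = (s 1).length ∧ a.2.1.length = m * (s 1).length)
    (by simp) (fun m a L ha => by
      obtain ⟨x, G, z⟩ := a
      obtain ⟨h1, h2, h3⟩ := ha
      rcases x with _ | ⟨b, x⟩
      · simp at h1
      simp only [add_mul, one_mul] at h2 h3
      rw [PMF.pure_map, Code.den, den_iter_mulStep (b := b) (x := x) (by simp)
        (by simp [hs8]) (by simp [hs15]) (by simpa using h2) (by simp; omega)]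
      simp only [PMF.pure_bind, Code.den]
      refine congrArg _ (funext fun r => ?_)
      by_cases h7 : r = 7
      · subst h7; simp
      by_cases h8 : r = 8
      · subst h8; simp [hs8]
      by_cases h9 : r = 9
      · subst h9; simp
      by_cases h10 : r = 10
      · subst h10; simp
      simp [Function.update_apply, h7, h8, h9, h10])
    (fun m a ha a' ha' => by
      obtain ⟨h1, h2, h3⟩ := ha
      rw [(PMF.mem_support_pure_iff _ _).1 ha']
      simp only [add_mul, one_mul] at h3
      refine ⟨by simp [h1], ?_, ?_⟩
      · simp only [List.length_zipWith]; omega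
      · simp only [List.length_drop]; omega)
    (s 2) (s 9, s 3, s 7) [] ⟨hs9, hs7, hs3⟩
  have e : Function.update (Function.update (Function.update (Function.update s 9 (s 9)) 10 (s 3))
      7 (s 7)) 14 [] = Function.update s 10 (s 3) := by
    funext r
    simp only [Function.update_apply]
    split_ifs <;> simp_all
  obtain ⟨h1, h2⟩ := iterate_mulRow (s 1).length (s 2).length (s 9) (s 3) (s 7) hs9
  rw [e, iterK_pure, PMF.pure_map, h1, h2] at h
  simp only [mulCode, Code.den, PMF.pure_bind] at h ⊢
  rw [show (Function.update s 10 (s 3)) 2 = s 2 by simp, h, PMF.pure_bind]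
  refine congrArg _ (funext fun r => ?_)
  simp only [Function.update_apply]
  split_ifs <;> simp_all

/-! ### Sampling sequences of words -/

/-- The registers `0`, `1`, `2`, `3` hold strings of lengths `w`, `n`, `k` and the matrix `G`, and
the scratch registers are empty. -/
structure Ready (n k w : ℕ) (G : List Bool) (s : Store) : Prop where
  r0 : (s 0).length = w
  r1 : (s 1).length = n
  r2 : (s 2).length = k
  r3 : s 3 = G
  r7 : s 7 = []
  r8 : s 8 = []
  r9 : s 9 = []
  r10 : s 10 = []
  r11 : s 11 = []
  r12 : s 12 = []
  r14 : s 14 = []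
  r15 : s 15 = []

/-- Put a noisy codeword for a random message into register `7`. -/
def noisyCode : Code := wordCode 2 9 ;; errCode ;; mulCode

theorem den_noisyCode {n k w : ℕ} {G : List Bool} (hG : G.length = k * n) {s : Store}
    (hs : Ready n k w G s) :
    noisyCode.den s = (encBits n k w G).map fun y => Function.update s 7 y := by
  obtain ⟨h0, h1, h2, h3, h7, h8, h9, h10, h11, h12, h14, h15⟩ := hs
  rw [noisyCode, Code.den, den_wordCode (by decide) (by decide) (by decide) h11 h12 h15, h2,
    PMF.bind_map, encBits, PMF.map_bind]
  refine bind_congr_of_support fun x hx => ?_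
  have hx' : x.length = k := length_of_mem_support_iid hx
  rw [Function.comp, Code.den, den_errCode (by simp [h7]) (by simp [h8]) (by simp [h10])
    (by simp [h11]) (by simp [h12]) (by simp [h15]), PMF.bind_map, PMF.map_comp, PMF.map]
  have e : ∀ L, (Function.update s 9 L) 1 = s 1 ∧ (Function.update s 9 L) 0 = s 0 := by simp
  rw [(e _).1, (e _).2, h0, h1]
  refine bind_congr_of_support fun z hz => ?_
  have hz' := length_of_mem_support_errBits hz
  rw [Function.comp, den_mulCode (by simp [h8]) (by simp [h10]) (by simp [h14])
    (by simp [h15]) (by simp [h9, hx', h2]) (by simp [hz', h1]) (by simp [h1, h2, h3, hG])]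
  refine congrArg _ (funext fun r => ?_)
  simp only [Function.update_apply]
  split_ifs <;> simp_all

/-- Put a uniformly random word into register `7`. -/
theorem den_wordCode_one {n k w : ℕ} {G : List Bool} {s : Store} (hs : Ready n k w G s) :
    (wordCode 1 7).den s = (bits n).map fun y => Function.update s 7 y := by
  obtain ⟨h0, h1, h2, h3, h7, h8, h9, h10, h11, h12, h14, h15⟩ := hs
  rw [den_wordCode (by decide) (by decide) (by decide) h11 h12 h15, h1]
  simp [h7]

/-- Move the word in register `7`, reversed, on top of register `6`. -/
def pushCode : Code := .iter 1 15 (.branch 7 (.pop 6) (.push false 6) (.push true 6) ;; .pop 7)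

theorem iterate_push (n : ℕ) (y u : List Bool) (hy : y.length = n) :
    (fun a : List Bool × List Bool => (a.1.tail, a.1.headD false :: a.2))^[n] (y, u)
      = ([], y.reverse ++ u) := by
  induction n generalizing y u with
  | zero => simp [List.length_eq_zero_iff.1 hy]
  | succ n ih =>
    rcases y with _ | ⟨a, y⟩
    · simp at hy
    rw [Function.iterate_succ, Function.comp]
    simp only [List.tail_cons, List.headD_cons]
    rw [ih _ _ (by simpa using hy)]
    simp

theorem den_pushCode {s : Store} (hs15 : s 15 = []) (hs7 : (s 7).length = (s 1).length) :
    pushCode.den s = PMF.pure (Function.update (Function.update s 7 []) 6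
      ((s 7).reverse ++ s 6)) := by
  have h := iterDen_eq (r := 15)
    (F := (.branch 7 (.pop 6) (.push false 6) (.push true 6) ;; .pop 7 : Code).den)
    (fun (a : List Bool × List Bool) L => Function.update (Function.update
      (Function.update s 7 a.1) 6 a.2) 15 L)
    (fun a => PMF.pure (a.1.tail, a.1.headD false :: a.2))
    (fun n a => n ≤ a.1.length)
    (by simp) (fun n a L ha => by
      obtain ⟨y, u⟩ := a
      rcases y with _ | ⟨b, y⟩
      · simp at ha
      rw [PMF.pure_map]
      cases b <;> simp [Code.den, pick] <;>
        refine congrArg _ (funext fun r => ?_) <;> simp only [Function.update_apply] <;>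
        split_ifs <;> simp_all)
    (fun n a ha a' ha' => by
      rw [(PMF.mem_support_pure_iff _ _).1 ha']
      simp only [List.length_tail]
      omega) (s 1) (s 7, s 6) [] hs7.ge
  have e : Function.update (Function.update (Function.update s 7 (s 7)) 6 (s 6)) 15 [] = s := by
    funext r
    simp only [Function.update_apply]
    split_ifs <;> simp_all
  rw [e, iterK_pure, PMF.pure_map, iterate_push _ _ _ hs7] at h
  rw [pushCode, Code.den, h]
  refine congrArg _ (funext fun r => ?_)
  simp only [Function.update_apply]
  split_ifs <;> simp_all

theorem iterK_append_reverse (μ : PMF (List Bool)) (q : ℕ) (a : List Bool) :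
    iterK (fun a => μ.map fun y => y.reverse ++ a) q a
      = (iid μ q).map fun ys => ys.flatten.reverse ++ a := by
  induction q generalizing a with
  | zero => simp [iterK, iid_zero, PMF.pure_map]
  | succ q ih =>
    simp only [iterK, iid_succ, PMF.map_bind, PMF.bind_map, PMF.map_comp, Function.comp_def, ih]
    simp

/-- Sample as many words as the length of register `w`, and put them, reversed, on top of
register `6`. -/
def sampleCode (w : ℕ) (c : Code) : Code := .iter w 13 (c ;; pushCode)

/-- The sampler `c` is specified on all `Ready` stores, and `pushCode` restores readiness after each
word by emptying register `7`; this makes the samples independent and identically distributed. -/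
theorem den_sampleCode {n k l : ℕ} {G : List Bool} {c : Code} {μ : PMF (List Bool)}
    (hμ : ∀ y ∈ μ.support, y.length = n)
    (hc : ∀ s, Ready n k l G s → c.den s = μ.map fun y => Function.update s 7 y) (w : ℕ)
    {s : Store} (hs : Ready n k l G s) (hs13 : s 13 = []) :
    (sampleCode w c).den s = (iid μ (s w).length).map fun ys =>
      Function.update s 6 (ys.flatten.reverse ++ s 6) := by
  have h := iterDen_eq (r := 13) (F := (c ;; pushCode).den)
    (fun (a : List Bool) L => Function.update (Function.update s 6 a) 13 L)
    (fun a => μ.map fun y => y.reverse ++ a) (fun _ _ => True)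
    (by simp) (fun n a L _ => by
      obtain ⟨h0, h1, h2, h3, h7, h8, h9, h10, h11, h12, h14, h15⟩ := hs
      rw [Code.den, hc _ (by constructor <;> simpa), PMF.bind_map, PMF.map_comp, PMF.map]
      refine bind_congr_of_support fun y hy => ?_
      have hy' := hμ y hy
      rw [Function.comp, den_pushCode (by simpa) (by simp [h1, hy'])]
      refine congrArg _ (funext fun r => ?_)
      simp only [Function.update_apply]
      split_ifs <;> simp_all) (by simp) (s w) (s 6) [] trivial
  have e : Function.update (Function.update s 6 (s 6)) 13 [] = s := by
    rw [Function.update_eq_self, ← hs13, Function.update_eq_self]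
  rw [e, iterK_append_reverse, PMF.map_comp] at h
  rw [sampleCode, Code.den, h]
  refine congrArg (fun f => PMF.map f _) (funext fun ys => ?_)
  simp only [Function.comp]
  rw [← hs13, Function.update_comm (by decide), Function.update_eq_self]

theorem length_of_mem_support_encBits {n k w : ℕ} {G y : List Bool} (hG : G.length = k * n)
    (hy : y ∈ (encBits n k w G).support) : y.length = n := by
  obtain ⟨x, hx, hy⟩ := (PMF.mem_support_bind_iff _ _ _).1 hy
  obtain ⟨z, hz, rfl⟩ := (PMF.mem_support_map_iff _ _ _).1 hy
  refine length_mulBits x (length_of_mem_support_errBits hz) ?_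
  rw [length_of_mem_support_iid hx, hG]

/-! ### The encoder -/

/-- Remove a row from the matrix in register `10`, and increment register `1`. -/
def divideStep : Code :=
  .branch 10 (.clear 12) (.push true 1 ;; .copy 2 12 ;; .drop 12 10)
    (.push true 1 ;; .copy 2 12 ;; .drop 12 10)

/-- From a matrix in register `1` and a message in register `3`, set up the registers for
`mulCode`. -/
def prepareCode : Code :=
  .copy 3 9 ;; .copy 1 3 ;; .copy 9 2 ;; .copy 3 10 ;; .clear 1 ;;
    .iter 3 13 divideStep

/-- Encoding of a message, with noise. -/
def encCode : Code := prepareCode ;; errCode ;; mulCode ;; .copy 7 0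

/-- The encoder is not given `n`; it recovers it as the number of times that `k` entries can be
removed from the `k * n` entries of `G`, for which `k > 0` is essential. Once the list is empty,
further rounds do nothing, so any number `m ≥ n` of rounds will do. -/
theorem iterate_divide (k n m : ℕ) (hk : 0 < k) (hm : n ≤ m) (G N : List Bool)
    (hG : G.length = k * n) :
    (fun a : List Bool × List Bool => if a.1 = [] then a else (a.1.drop k, true :: a.2))^[m] (G, N)
      = ([], List.replicate n true ++ N) := by
  induction m generalizing G N n with
  | zero =>
    obtain rfl : n = 0 := by omega
    simpa using hG
  | succ m ih =>
    rw [Function.iterate_succ, Function.comp]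
    rcases n with _ | n
    · have hG' : G = [] := by simpa using hG
      rw [if_pos hG']
      exact ih 0 (by omega) G N hG
    · have hG' : G ≠ [] := by
        rintro rfl
        simp at hG
        omega
      rw [if_neg hG', ih n (by omega) _ _ (by rw [List.length_drop, hG, mul_add]; omega)]
      simp [List.replicate_succ']

theorem den_prepareCode {n k : ℕ} (hk : 0 < k) {l G e x : List Bool} (hx : x.length = k)
    (hG : G.length = k * n) :
    prepareCode.den (load [l, G, e, x]) = PMF.pure
      (load [l, List.replicate n true, x, G, [], [], [], [], [], x]) := by
  set s := load [l, [], x, G, [], [], [], [], [], x, G] with hs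
  have h := iterDen_eq (r := 13) (F := divideStep.den)
    (fun (a : List Bool × List Bool) L => Function.update (Function.update
      (Function.update s 10 a.1) 1 a.2) 13 L)
    (fun a => PMF.pure (if a.1 = [] then a else (a.1.drop k, true :: a.2))) (fun _ _ => True)
    (by simp) (fun n a L _ => by
      have h2 : s 2 = x := by simp [hs, load]
      have h12 : s 12 = [] := by simp [hs, load]
      obtain ⟨G, N⟩ := a
      rw [PMF.pure_map, divideStep, Code.den, pick_self]
      simp only [Code.den, PMF.pure_bind]
      by_cases hG : G = []
      · rw [if_pos (by simp [hG]), if_pos hG]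
        refine congrArg _ (funext fun r => ?_)
        simp only [Function.update_apply]
        split_ifs <;> simp_all
      · rw [if_neg (by simpa using hG), if_neg hG]
        refine congrArg _ (funext fun r => ?_)
        by_cases r1 : r = 1
        · subst r1; simp
        by_cases r10 : r = 10
        · subst r10; simp [h2, hx]
        by_cases r12 : r = 12
        · subst r12; simp [h12]
        simp [Function.update_apply, r1, r10, r12]) (by simp) G (G, []) [] trivial
  -- The loop runs over `G` itself, that is `k * n ≥ n` rounds.
  rw [iterK_pure, PMF.pure_map, iterate_divide k n _ hk
    (by rw [hG]; exact Nat.le_mul_of_pos_left n hk) _ _ hG] at h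
  have e1 : Function.update (Function.update (Function.update s 10 G) 1 []) 13 [] = s := by
    funext r
    match r with
    | 0 | 1 | 2 | 3 | 4 | 5 | 6 | 7 | 8 | 9 | 10 | 11 | 12 | 13 => simp [hs, load]
    | r + 14 => simp [hs, load]
  rw [e1] at h
  have e2 : Function.update (Function.update (Function.update (Function.update (Function.update
      (load [l, G, e, x]) 9 x) 3 G) 2 x) 10 G) 1 [] = s := by
    funext r
    match r with
    | 0 | 1 | 2 | 3 | 4 | 5 | 6 | 7 | 8 | 9 | 10 => simp [hs, load]
    | r + 11 => simp [hs, load]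
  rw [prepareCode]
  have l1 : load [l, G, e, x] 1 = G := by simp [load]
  have l3 : load [l, G, e, x] 3 = x := by simp [load]
  simp only [Code.den, PMF.pure_bind, Function.update_self, l1, l3, ne_eq,
    Nat.reduceEqDiff, not_false_eq_true, Function.update_of_ne, OfNat.one_ne_ofNat,
    OfNat.ofNat_ne_one]
  rw [e2, h]
  refine congrArg _ (funext fun r => ?_)
  match r with
  | 0 | 1 | 2 | 3 | 4 | 5 | 6 | 7 | 8 | 9 | 10 | 11 | 12 | 13 => simp [hs, load]
  | r + 14 => simp [hs, load]

theorem den_encCode {n k : ℕ} (hk : 0 < k) {l G e x : List Bool} (hx : x.length = k)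
    (hG : G.length = k * n) :
    (encCode.den (load [l, G, e, x])).map (fun s => s 0)
      = (errBits n l.length).map fun z => mulBits n x G z := by
  rw [encCode, Code.den, den_prepareCode hk hx hG, PMF.pure_bind, Code.den,
    den_errCode (by simp [load]) (by simp [load]) (by simp [load]) (by simp [load])
    (by simp [load]) (by simp [load]), PMF.bind_map, PMF.map_bind, PMF.map]
  have e0 : (load [l, List.replicate n true, x, G, [], [], [], [], [], x] 0).length = l.length := by
    simp [load]
  have e1 : (load [l, List.replicate n true, x, G, [], [], [], [], [], x] 1).length = n := by
    simp [load]
  rw [e0, e1]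
  refine bind_congr_of_support fun z hz => ?_
  have hz' := length_of_mem_support_errBits hz
  rw [Function.comp, Code.den, den_mulCode (by simp [load]) (by simp [load]) (by simp [load])
    (by simp [load]) (by simp [load]) (by simp [load, hz']) (by simp [load, hG, hx]),
    PMF.pure_bind, Code.den, PMF.pure_map]
  simp [load]

/-! ### Advantages -/

/-- The probability of `true`. -/
def pr (μ : PMF Bool) : ℝ := (μ true).toReal

theorem toReal_apply_false (μ : PMF Bool) : (μ false).toReal = 1 - pr μ := by
  have h := μ.tsum_coe
  rw [tsum_fintype, Fintype.sum_bool] at h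
  have h2 := congrArg ENNReal.toReal h
  rw [ENNReal.toReal_add (μ.apply_ne_top _) (μ.apply_ne_top _)] at h2
  simp only [pr]
  simp at h2
  linarith

theorem pr_bind_fintype {α : Type*} [Fintype α] (μ : PMF α) (f : α → PMF Bool) :
    pr (μ.bind f) = ∑ a, (μ a).toReal * pr (f a) := by
  rw [pr, PMF.bind_apply, tsum_fintype, ENNReal.toReal_sum]
  · simp [pr, ENNReal.toReal_mul]
  · exact fun a _ => ENNReal.mul_ne_top (μ.apply_ne_top _) ((f a).apply_ne_top _)

theorem pr_bind (μ : PMF Bool) (f : Bool → PMF Bool) :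
    pr (μ.bind f) = pr μ * pr (f true) + (1 - pr μ) * pr (f false) := by
  rw [pr_bind_fintype, Fintype.sum_bool, toReal_apply_false]
  rfl

theorem pr_pure (b : Bool) : pr (PMF.pure b) = if b then 1 else 0 := by
  cases b <;> simp [pr]

theorem pr_uniform : pr (PMF.uniformOfFintype Bool) = 1 / 2 := by simp [pr]

theorem pr_drawNat_bind {N : ℕ} (hN : 0 < N) (f : ℕ → PMF Bool) :
    pr ((drawNat N).bind f) = (∑ i ∈ Finset.range N, pr (f i)) / N := by
  obtain ⟨N, rfl⟩ := Nat.exists_eq_succ_of_ne_zero hN.ne'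
  rw [drawNat, PMF.bind_map, pr_bind_fintype]
  simp only [PMF.uniformOfFintype_apply, Fintype.card_fin, ENNReal.toReal_inv,
    ENNReal.toReal_natCast, ← Finset.mul_sum, Function.comp]
  rw [Fin.sum_univ_eq_sum_range fun i => pr (f i), div_eq_inv_mul]

/-- The answer of the adversary on the given input. -/
def answer (A : PPT) (inp : List (List Bool)) : PMF Bool :=
  (A.out inp).map fun s => (s 0).head? == some true

/-- The difference between the probabilities of the answer `true` in the two cases. -/
def adv (A : PPT) (D : Bool → PMF (List (List Bool))) : ℝ :=
  pr ((D true).bind (answer A)) - pr ((D false).bind (answer A))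

theorem winProb_eq (A : PPT) (D : Bool → PMF (List (List Bool))) :
    winProb A D = 1 / 2 + adv A D / 2 := by
  have h : game A D = (PMF.uniformOfFintype Bool).bind fun b =>
      ((D b).bind (answer A)).bind fun a => PMF.pure (a == b) := by
    simp only [PMF.bind_bind, answer, PMF.bind_map]
    rfl
  rw [winProb, h]
  change pr _ = _
  rw [pr_bind, pr_bind, pr_bind, pr_uniform]
  simp only [pr_pure, adv, beq_self_eq_true, if_true, Bool.false_beq, Bool.true_beq, Bool.not_true,
    Bool.false_eq_true, if_false]
  simp
  ring

theorem negligible_two_pow : Negligible fun l : ℕ => ((1 / 2 : ℝ)) ^ l := by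
  intro c
  exact tendsto_pow_const_mul_const_pow_of_lt_one c (by norm_num) (by norm_num)

/-- The winning probability is `1/2` plus half the signed advantage. The definition asks for a
strict inequality, which may fail for a vanishing bound; adding the negligible `2 ^ (-l)` makes it
strict. -/
theorem indistinguishable_iff {D : ℕ → Bool → PMF (List (List Bool))} :
    Indistinguishable D ↔
      ∀ A : PPT, ∃ ε : ℕ → ℝ, Negligible ε ∧ ∀ l, 0 < l → |adv A (D l)| ≤ ε l := by
  constructor
  · intro h A
    obtain ⟨ε, hε, h⟩ := h A
    refine ⟨fun l => 2 * ε l, hε.const_mul 2, fun l hl => ?_⟩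
    have := h l hl
    rw [winProb_eq, add_sub_cancel_left, abs_div, abs_two] at this
    linarith
  · intro h A
    obtain ⟨ε, hε, h⟩ := h A
    refine ⟨fun l => ε l + (1 / 2) ^ l, hε.add negligible_two_pow, fun l hl => ?_⟩
    have h1 := h l hl
    have h2 : (0 : ℝ) < (1 / 2) ^ l := by positivity
    rw [winProb_eq, add_sub_cancel_left, abs_div, abs_two]
    have := abs_nonneg (adv A (D l))
    linarith

/-- `l ^ c * √ε = √(l ^ (2 * c) * ε)`. -/
theorem negligible_sqrt {ε : ℕ → ℝ} (h : Negligible ε) : Negligible fun l => √(ε l) := by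
  intro c
  have h1 := ((h (2 * c)).sqrt)
  rw [Real.sqrt_zero] at h1
  refine h1.congr fun l => ?_
  rw [Real.sqrt_mul (by positivity), mul_comm 2 c, pow_mul, Real.sqrt_sq (by positivity)]

theorem negligible_poly_mul {ε : ℕ → ℝ} (h : Negligible ε) (C d : ℕ) :
    Negligible fun l => ((C * l ^ d : ℕ) : ℝ) * ε l := by
  have := (h.param_pow_mul d).const_mul (C : ℝ)
  refine this.congr fun l => ?_
  simp only [Pi.mul_apply, Pi.pow_apply]
  push_cast
  ring

/-- A function bounded by a polynomial is bounded by a multiple of a power, except at `0`. -/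
theorem exists_lt_mul_pow {q : ℕ → ℕ} (hq : ∃ p : ℕ[X], ∀ l, q l ≤ p.eval l) :
    ∃ C d : ℕ, ∀ l, 0 < l → q l < C * l ^ d := by
  obtain ⟨p, hp⟩ := hq
  refine ⟨p.eval 1 + 1, p.natDegree, fun l hl => ?_⟩
  have h1 : p.eval l ≤ p.eval 1 * l ^ p.natDegree := by
    rw [Polynomial.eval_eq_sum_range, Polynomial.eval_eq_sum_range, Finset.sum_mul]
    refine Finset.sum_le_sum fun i hi => ?_
    rw [one_pow, mul_one]
    exact Nat.mul_le_mul_left _ (Nat.pow_le_pow_right hl (by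
      have := Finset.mem_range.1 hi; omega))
  have h2 : 0 < l ^ p.natDegree := by positivity
  have := hp l
  rw [add_mul, one_mul]
  omega

/-! ### Computing bounds -/

/-- Put `1^C` into register `6`. -/
def constCode : ℕ → Code
  | 0 => .clear 6
  | C + 1 => constCode C ;; .push true 6

theorem den_constCode (C : ℕ) (s : Store) :
    (constCode C).den s = PMF.pure (Function.update s 6 (unary C)) := by
  induction C with
  | zero => rfl
  | succ C ih => simp [constCode, Code.den, ih, unary, List.replicate_succ]

theorem tame_constCode (C : ℕ) : (constCode C).tame 20 [] := by
  induction C with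
  | zero => rfl
  | succ C ih => simp [constCode, Code.tame, ih]

/-- Put a unary number of the length of register `0` times the length of register `6` into
register `7`. -/
def timesCode : Code := .clear 7 ;; .iter 0 8 (.iter 6 9 (.push true 7))

theorem den_iter_push {s : Store} (hs9 : s 9 = []) : (Code.iter 6 9 (.push true 7)).den s =
    PMF.pure (Function.update s 7 (unary (s 6).length ++ s 7)) := by
  have h := iterDen_eq (F := (Code.push true 7).den) (r := 9)
    (fun a L => Function.update (Function.update s 7 a) 9 L)
    (fun a => PMF.pure (true :: a)) (fun _ _ => True)
    (by simp) (fun n a L _ => by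
      rw [PMF.pure_map, Code.den]
      refine congrArg _ (funext fun r => ?_)
      simp only [Function.update_apply]
      split_ifs <;> simp_all) (by simp) (s 6) (s 7) [] trivial
  have e : Function.update (Function.update s 7 (s 7)) 9 [] = s := by
    rw [Function.update_eq_self, ← hs9, Function.update_eq_self]
  have hit : ∀ (n : ℕ) (a : List Bool), (fun a => true :: a)^[n] a = unary n ++ a := by
    intro n
    induction n with
    | zero => intro a; rfl
    | succ n ih =>
      intro a
      rw [Function.iterate_succ_apply', ih]
      simp [unary, List.replicate_succ]
  rw [e, iterK_pure, PMF.pure_map, hit, ← hs9, Function.update_comm (by decide),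
    Function.update_eq_self] at h
  rw [Code.den, h]

theorem den_timesCode {s : Store} (hs8 : s 8 = []) (hs9 : s 9 = []) :
    timesCode.den s = PMF.pure (Function.update s 7 (unary ((s 6).length * (s 0).length))) := by
  have h := iterDen_eq (F := (Code.iter 6 9 (.push true 7)).den) (r := 8)
    (fun a L => Function.update (Function.update s 7 a) 8 L)
    (fun a => PMF.pure (unary (s 6).length ++ a)) (fun _ _ => True)
    (by simp) (fun n a L _ => by
      rw [PMF.pure_map, den_iter_push (by simp [hs9])]
      refine congrArg _ (funext fun r => ?_)
      simp only [Function.update_apply]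
      split_ifs <;> simp_all) (by simp) (s 0) [] [] trivial
  have e : Function.update (Function.update s 7 []) 8 [] = Function.update s 7 [] := by
    rw [Function.update_comm (by decide), ← hs8, Function.update_eq_self, hs8]
  have hit : ∀ n : ℕ, (fun a => unary (s 6).length ++ a)^[n] []
      = unary ((s 6).length * n) := by
    intro n
    induction n with
    | zero => rfl
    | succ n ih =>
      rw [Function.iterate_succ_apply', ih, unary, unary, unary, ← List.replicate_add, mul_add,
        mul_one, add_comm]
  rw [e, iterK_pure, PMF.pure_map, hit, Function.update_comm (by decide), ← hs8,
    Function.update_eq_self] at h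
  simp only [timesCode, Code.den, PMF.pure_bind] at h ⊢
  rw [← h]
  simp [hs8]

/-- Put a unary number into register `6`: `C` times the `d`-th power of the length of
register `0`. -/
def powDen (C : ℕ) : ℕ → Store → PMF Store
  | 0, s => (constCode C).den s
  | d + 1, s => ((powDen C d s).bind timesCode.den).bind (Code.rev 7 6).den

/-- Register `6` bounds a loop in each multiplication and is overwritten between multiplications, so
no single protected set works. Since `d` is a constant, the stages can be joined by `Poly.bind`. -/
theorem poly_powDen (C d : ℕ) : Poly 20 (powDen C d) := by
  induction d with
  | zero => exact (constCode C).poly [] (tame_constCode C)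
  | succ d ih =>
    exact (ih.bind (timesCode.poly [0, 6] (by decide))).bind ((Code.rev 7 6).poly [] (by decide))

theorem powDen_eq (C d : ℕ) {s : Store} (hs7 : s 7 = []) (hs8 : s 8 = []) (hs9 : s 9 = []) :
    powDen C d s = PMF.pure (Function.update s 6 (unary (C * (s 0).length ^ d))) := by
  induction d with
  | zero => simp [powDen, den_constCode]
  | succ d ih =>
    rw [powDen, ih, PMF.pure_bind, den_timesCode (by simp [hs8]) (by simp [hs9]), PMF.pure_bind,
      Code.den]
    refine congrArg _ (funext fun r => ?_)
    simp only [Function.update_apply]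
    split_ifs <;> simp_all [unary, pow_succ, mul_assoc]

/-! ### Advice -/

/-- Output the top bit of register `10` if the registers `17` and `18` have the same top bit, and
its negation otherwise. -/
def compareCode : Code :=
  .clear 0 ;; .branch 18 (.clear 0)
    (.branch 17 (.branch 10 (.clear 0) (.clear 0) (.push true 0))
      (.branch 10 (.clear 0) (.clear 0) (.push true 0))
      (.branch 10 (.push true 0) (.push true 0) (.clear 0)))
    (.branch 17 (.branch 10 (.push true 0) (.push true 0) (.clear 0))
      (.branch 10 (.push true 0) (.push true 0) (.clear 0))
      (.branch 10 (.clear 0) (.clear 0) (.push true 0)))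

/-- With `c` the sampled case and register `17` the answer on it, the output is the answer in
register `10` if the self-test succeeded, and its negation otherwise. -/
theorem den_compareCode {s : Store} {c : Bool} (hc : s 18 = [c]) :
    (compareCode.den s).map (fun s => (s 0).head? == some true)
      = PMF.pure ((((s 17).head? == some true) == c) == ((s 10).head? == some true)) := by
  rcases h17 : s 17 with _ | ⟨_ | _, L⟩ <;> rcases h10 : s 10 with _ | ⟨_ | _, L'⟩ <;> cases c <;>
    simp [compareCode, Code.den, hc, h17, h10, pick, PMF.pure_map]

/-- The reduction for the removal of advice: with a random number as advice, run `A` on the input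
and on a fresh sample of a known random case. -/
def adviceDen (A : PPT) (S : Bool → PPT) (C d : ℕ) (s : Store) : PMF Store :=
  (((((powDen C d s).bind (Code.draw 6 5).den).bind
    (callDen A [0, 1, 2, 3, 4, 5] 10 1)).bind (tossCode 18).den).bind
    (fun s => pick (PMF.pure s) (callDen (S false) [0, 1, 2, 3, 4] 12 5 s)
      (callDen (S true) [0, 1, 2, 3, 4] 12 5 s) (s 18))).bind fun s =>
    (callDen A [12, 13, 14, 15, 16, 5] 17 1 s).bind compareCode.den

theorem poly_pure (D : ℕ) : Poly D PMF.pure :=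
  ⟨.skip, 1, fun s hs m _ => ⟨(halts_skip s).mono (by simp), by simpa using hs⟩⟩

theorem poly_adviceDen (A : PPT) (S : Bool → PPT) (C d : ℕ) : Poly 20 (adviceDen A S C d) := by
  refine Poly.bind (Poly.bind (Poly.bind (Poly.bind (Poly.bind (poly_powDen C d)
    ((Code.draw 6 5).poly [] (by decide))) (poly_callDen A (by decide) (by decide)))
    ((tossCode 18).poly [] (by decide))) (Poly.branch (poly_pure 20)
    (poly_callDen _ (by decide) (by decide)) (poly_callDen _ (by decide) (by decide)))) ?_
  exact (poly_callDen A (by decide) (by decide)).bind (compareCode.poly [] (by decide))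

/-- The first five registers of the output. -/
def firstFive (s : Store) : List (List Bool) := [s 0, s 1, s 2, s 3, s 4]

theorem adviceDen_eq (A : PPT) (S : Bool → PPT) (C d : ℕ) (x₀ x₁ x₂ x₃ x₄ : List Bool) :
    (adviceDen A S C d (load [x₀, x₁, x₂, x₃, x₄])).map (fun s => (s 0).head? == some true) =
      (drawNat (C * x₀.length ^ d)).bind fun j =>
      (answer A ([x₀, x₁, x₂, x₃, x₄] ++ [unary j])).bind fun b₁ =>
      (PMF.uniformOfFintype Bool).bind fun c =>
      ((((S c).out [x₀, x₁, x₂, x₃, x₄]).map firstFive).bind fun y =>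
        answer A (y ++ [unary j])).bind fun b₂ => PMF.pure ((b₂ == c) == b₁) := by
  rw [adviceDen, powDen_eq _ _ (by simp [load]) (by simp [load]) (by simp [load]), PMF.pure_bind]
  simp only [Code.den, PMF.bind_bind, PMF.map_bind, PMF.bind_map]
  have e6 : (Function.update (load [x₀, x₁, x₂, x₃, x₄]) 6
      (unary (C * (load [x₀, x₁, x₂, x₃, x₄] 0).length ^ d)) 6).length = C * x₀.length ^ d := by
    simp [unary, load]
  rw [e6]
  refine congrArg _ (funext fun j => ?_)
  set s₁ := Function.update (Function.update (load [x₀, x₁, x₂, x₃, x₄]) 6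
    (unary (C * (load [x₀, x₁, x₂, x₃, x₄] 0).length ^ d))) 5 (List.replicate j true) with hs₁
  simp only [Function.comp, callDen, PMF.bind_map, answer]
  have ha : [0, 1, 2, 3, 4, 5].map s₁ = [x₀, x₁, x₂, x₃, x₄] ++ [unary j] := by
    simp [hs₁, load, unary]
  rw [ha]
  refine congrArg _ (funext fun t => ?_)
  simp only [Function.comp]
  rw [den_tossCode (by decide) (by decide) (by simp [overlay, load])
    (by simp [overlay, load]), PMF.bind_map]
  refine congrArg _ (funext fun c => ?_)
  have h18 : overlay 10 1 t s₁ 18 = [] := by simp [overlay, hs₁, load]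
  rw [Function.comp, h18]
  set s₂ := Function.update (overlay 10 1 t s₁) 18 [c] with hs₂
  have e18 : s₂ 18 = [c] := by simp [hs₂]
  have ha : [0, 1, 2, 3, 4].map s₂ = [x₀, x₁, x₂, x₃, x₄] := by
    simp [hs₂, overlay, hs₁, load]
  have hpick : pick (PMF.pure s₂) (((S false).out ([0, 1, 2, 3, 4].map s₂)).map fun s' =>
      overlay 12 5 s' s₂) (((S true).out ([0, 1, 2, 3, 4].map s₂)).map fun s' =>
      overlay 12 5 s' s₂) (s₂ 18) = ((S c).out [x₀, x₁, x₂, x₃, x₄]).map fun s' =>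
      overlay 12 5 s' s₂ := by
    rw [e18, ha]
    cases c <;> rfl
  rw [hpick, PMF.bind_map]
  refine congrArg _ (funext fun u => ?_)
  simp only [Function.comp]
  have ha : [12, 13, 14, 15, 16, 5].map (overlay 12 5 u s₂) = firstFive u ++ [unary j] := by
    simp [firstFive, hs₂, overlay, hs₁, unary]
  rw [ha]
  refine congrArg _ (funext fun v => ?_)
  simp only [Function.comp]
  rw [den_compareCode (c := c) (by simp [overlay, hs₂])]
  simp [overlay, hs₂]

/-- Indistinguishability of efficiently samplable distributions implies indistinguishability for
adversaries with advice, a number bounded by a polynomial. -/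
theorem Indistinguishable.advice {D : ℕ → Bool → PMF (List (List Bool))}
    (hD : Indistinguishable D)
    (hlen : ∀ l b, ∀ inp ∈ (D l b).support, ∃ x₁ x₂ x₃ x₄, inp = [unary l, x₁, x₂, x₃, x₄])
    (S : Bool → PPT) (hS : ∀ l, 0 < l → ∀ b b', ∀ inp ∈ (D l b').support,
      ((S b).out inp).map firstFive = D l b)
    {q : ℕ → ℕ} (hq : ∃ p : ℕ[X], ∀ l, q l ≤ p.eval l) :
    Indistinguishable fun l b => (D l b).map fun inp => inp ++ [unary (q l)] := by
  rw [indistinguishable_iff] at hD ⊢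
  intro A
  obtain ⟨C, d, hCd⟩ := exists_lt_mul_pow hq
  obtain ⟨B, hB⟩ := (poly_adviceDen A S C d).exists_ppt (a := 5) (by decide)
  obtain ⟨ε, hε, h⟩ := hD B
  -- The advantage on advice `q l` will satisfy `g (q l) ^ 2 ≤ N * ε l` with `N = C * l ^ d`.
  refine ⟨_, negligible_sqrt (negligible_poly_mul hε C d), fun l hl => ?_⟩
  set N := C * l ^ d with hN
  have hqN : q l < N := hCd l hl
  have hN0 : 0 < N := by omega
  set α : Bool → ℕ → PMF Bool := fun c j => (D l c).bind fun inp => answer A (inp ++ [unary j])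
    with hα
  set g : ℕ → ℝ := fun j => pr (α true j) - pr (α false j) with hg
  -- The self-test is independent of the challenge given `j`: the sampler uses the challenge only
  -- for its lengths, which are the same in all samples. So the challenge and the test sample enter
  -- through the same family `α`.
  have hgame : ∀ b, (D l b).bind (answer B) = (drawNat N).bind fun j => (α b j).bind fun b₁ =>
      (PMF.uniformOfFintype Bool).bind fun c => (α c j).bind fun b₂ =>
        PMF.pure ((b₂ == c) == b₁) := by
    intro b
    have h1 : (D l b).bind (answer B) = (D l b).bind fun inp => (drawNat N).bind fun j =>
      (answer A (inp ++ [unary j])).bind fun b₁ => (PMF.uniformOfFintype Bool).bind fun c =>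
        (α c j).bind fun b₂ => PMF.pure ((b₂ == c) == b₁) := by
      refine bind_congr_of_support fun inp hinp => ?_
      have hSc := fun c => hS l hl c b inp hinp
      obtain ⟨x₁, x₂, x₃, x₄, rfl⟩ := hlen l b inp hinp
      rw [answer, hB _ (by simp), adviceDen_eq]
      have hlu : (unary l).length = l := by simp [unary]
      simp only [hSc, hα, hN, hlu]
    rw [h1, PMF.bind_comm]
    simp only [hα, PMF.bind_bind]
  -- For fixed `j` the self-test succeeds with probability `1 / 2 + g j / 2`, and then the answer
  -- `b₁` is kept; otherwise it is negated.
  have hpr : ∀ b, pr ((D l b).bind (answer B)) = (∑ j ∈ Finset.range N,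
      (pr (α b j) * (1 / 2 + g j / 2) + (1 - pr (α b j)) * (1 / 2 - g j / 2))) / N := by
    intro b
    rw [hgame, pr_drawNat_bind hN0]
    congr 1
    refine Finset.sum_congr rfl fun j _ => ?_
    simp only [pr_bind, pr_pure, pr_uniform, hg]
    simp
    ring
  -- The difference of the two cases contributes one factor `g j`, and the self-test the other.
  have hadv : adv B (D l) = (∑ j ∈ Finset.range N, g j ^ 2) / N := by
    rw [adv, hpr, hpr, ← sub_div, ← Finset.sum_sub_distrib]
    congr 1
    refine Finset.sum_congr rfl fun j _ => ?_
    simp only [hg]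
    ring
  have hA : adv A (fun b => (D l b).map fun inp => inp ++ [unary (q l)]) = g (q l) := by
    simp only [adv, hg, hα, PMF.bind_map]
    rfl
  rw [hA]
  refine Real.abs_le_sqrt ?_
  -- Squares cannot cancel, so the term of the correct guess bounds the sum from below.
  have h1 : g (q l) ^ 2 ≤ ∑ j ∈ Finset.range N, g j ^ 2 :=
    Finset.single_le_sum (f := fun j => g j ^ 2) (fun j _ => sq_nonneg _)
      (Finset.mem_range.2 hqN)
  have hNR : (0 : ℝ) < N := by exact_mod_cast hN0
  have h2 := (le_abs_self _).trans (h l hl)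
  rw [hadv, div_le_iff₀ hNR] at h2
  rw [mul_comm]
  exact h1.trans h2

/-! ### Samplers -/

theorem Poly.seq {D : ℕ} {c d : Code} (hc : Poly D c.den) (hd : Poly D d.den) :
    Poly D (c ;; d).den := hc.bind hd

theorem Indistinguishable.congr {D D' : ℕ → Bool → PMF (List (List Bool))}
    (h : Indistinguishable D)
    (hD : ∀ l, 0 < l → ∀ A b, (D l b).bind (answer A) = (D' l b).bind (answer A)) :
    Indistinguishable D' := by
  rw [indistinguishable_iff] at h ⊢
  intro A
  obtain ⟨ε, hε, h⟩ := h A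
  refine ⟨ε, hε, fun l hl => ?_⟩
  rw [adv, ← hD l hl, ← hD l hl]
  exact h l hl

/-- An empty last input is indistinguishable from an unused register. It pads the matrix game to
five strings, the format shared with the decoding game. -/
theorem answer_append_nil (A : PPT) (inp : List (List Bool)) :
    answer A (inp ++ [[]]) = answer A inp := by
  have h1 : load (inp ++ [[]]) = load inp := by
    funext r
    simp only [load, List.getD_eq_getElem?_getD]
    rcases lt_trichotomy r inp.length with h | h | h
    · rw [List.getElem?_append_left h]
    · subst h; simp
    · rw [List.getElem?_eq_none (by simp; omega), List.getElem?_eq_none h.le]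
  have h2 : inputSize (inp ++ [[]]) = inputSize inp := by simp [inputSize]
  rw [answer, answer, PPT.out, PPT.out, h1, h2]

/-- The two cases of the distinguishing problem for generator matrices. -/
def matrixGame (μ : PMF (List Bool)) (n k l : ℕ) (b : Bool) : PMF (List (List Bool)) :=
  (if b then μ else bits (k * n)).map fun G => [unary l, unary n, unary k, G, []]

/-- The two cases of the decoding problem. -/
def decodingGame (n k l : ℕ) (b : Bool) : PMF (List (List Bool)) :=
  (bits (k * n)).bind fun R => (if b then bits n else encBits n k l R).map fun y =>
    [unary l, unary n, unary k, R, y]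

/-- The input `inp` is a sample of either case and is needed only for `1^l`, `1^n`, `1^k`: the
functions `n` and `k` need not be computable. A Goppa matrix comes from the key generator `M`, a
uniform one from coin tosses. -/
theorem exists_matrix_sampler {μ : ℕ → PMF (List Bool)} (n k : ℕ → ℕ) (M : PPT)
    (hM : ∀ l, 0 < l → (M.out [unary l]).map (fun s => s 0) = μ l) :
    ∃ S : Bool → PPT, ∀ l, 0 < l → ∀ b b', ∀ inp ∈ (matrixGame (μ l) (n l) (k l) l b').support,
      ((S b).out inp).map firstFive = matrixGame (μ l) (n l) (k l) l b := by
  obtain ⟨S₀, h₀⟩ := (matCode.poly (D := 20) [1, 2] (by decide)).exists_ppt (a := 5) (by decide)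
  obtain ⟨S₁, h₁⟩ := (poly_callDen (D := 20) (o := 3) (c := 1) M (args := [0]) (by decide)
    (by decide)).exists_ppt (a := 5) (by decide)
  refine ⟨fun b => if b then S₁ else S₀, fun l hl b b' inp hinp => ?_⟩
  obtain ⟨G, -, rfl⟩ := (PMF.mem_support_map_iff _ _ _).1 hinp
  cases b
  · simp only [Bool.false_eq_true, if_false, matrixGame]
    rw [h₀ _ (by simp), den_matCode (by simp [load]) (by simp [load]) (by simp [load])
      (by simp [load]), PMF.map_comp]
    simp [load, unary, firstFive, Function.comp_def]
  · simp only [if_true, matrixGame]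
    rw [h₁ _ (by simp), ← hM l hl, callDen, PMF.map_comp, PMF.map_comp]
    simp [load, firstFive, Function.comp_def, overlay]

theorem ready_load {l n k : ℕ} {G x y : List Bool} :
    Ready n k l G (load [unary l, unary n, unary k, G, x, y]) := by
  constructor <;> simp [load, unary]

theorem ready_load_five {l n k : ℕ} {G x : List Bool} :
    Ready n k l G (load [unary l, unary n, unary k, G, x]) := by
  constructor <;> simp [load, unary]

theorem Ready.update {n k l r : ℕ} {G L : List Bool} {s : Store} (h : Ready n k l G s)
    (hr : r ∈ [4, 5, 6, 13, 16, 17]) : Ready n k l G (Function.update s r L) := by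
  obtain ⟨h0, h1, h2, h3, h7, h8, h9, h10, h11, h12, h14, h15⟩ := h
  simp only [List.mem_cons, List.not_mem_nil, or_false] at hr
  rcases hr with rfl | rfl | rfl | rfl | rfl | rfl <;> constructor <;> simpa

theorem Ready.update_three {n k l : ℕ} {G L : List Bool} {s : Store} (h : Ready n k l G s) :
    Ready n k l L (Function.update s 3 L) := by
  obtain ⟨h0, h1, h2, h3, h7, h8, h9, h10, h11, h12, h14, h15⟩ := h
  constructor <;> simpa

/-- As for matrices, only the lengths in the given sample are used; a fresh matrix and a fresh word
are drawn. -/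
theorem exists_decoding_sampler (n k : ℕ → ℕ) :
    ∃ S : Bool → PPT, ∀ l, 0 < l → ∀ b b', ∀ inp ∈ (decodingGame (n l) (k l) l b').support,
      ((S b).out inp).map firstFive = decodingGame (n l) (k l) l b := by
  obtain ⟨S₀, h₀⟩ := ((matCode ;; noisyCode ;; .copy 7 4).poly (D := 20) [1, 2]
    (by decide)).exists_ppt (a := 5) (by decide)
  obtain ⟨S₁, h₁⟩ := ((matCode ;; wordCode 1 7 ;; .copy 7 4).poly (D := 20) [1, 2]
    (by decide)).exists_ppt (a := 5) (by decide)
  refine ⟨fun b => if b then S₁ else S₀, fun l hl b b' inp hinp => ?_⟩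
  obtain ⟨R, -, h⟩ := (PMF.mem_support_bind_iff _ _ _).1 hinp
  obtain ⟨y, -, rfl⟩ := (PMF.mem_support_map_iff _ _ _).1 h
  have e1 : (load [unary l, unary (n l), unary (k l), R, y] 1).length = n l := by
    simp [load, unary]
  have e2 : (load [unary l, unary (n l), unary (k l), R, y] 2).length = k l := by
    simp [load, unary]
  cases b
  · simp only [Bool.false_eq_true, if_false, decodingGame]
    rw [h₀ _ (by simp), Code.den, den_matCode (by simp [load]) (by simp [load]) (by simp [load])
      (by simp [load]), PMF.bind_map, PMF.map_bind, e1, e2]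
    refine bind_congr_of_support fun R' hR' => ?_
    rw [Function.comp, Code.den, den_noisyCode (length_of_mem_support_iid hR')
      ready_load_five.update_three, PMF.bind_map]
    simp only [Code.den, Function.comp_def]
    rw [PMF.map_bind, PMF.map]
    refine congrArg _ (funext fun y' => ?_)
    rw [PMF.pure_map]
    simp [load, firstFive]
  · simp only [if_true, decodingGame]
    rw [h₁ _ (by simp), Code.den, den_matCode (by simp [load]) (by simp [load]) (by simp [load])
      (by simp [load]), PMF.bind_map, PMF.map_bind, e1, e2]
    refine bind_congr_of_support fun R' hR' => ?_
    rw [Function.comp, Code.den, den_wordCode_one ready_load_five.update_three, PMF.bind_map]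
    simp only [Code.den, Function.comp_def]
    rw [PMF.map_bind, PMF.map]
    refine congrArg _ (funext fun y' => ?_)
    rw [PMF.pure_map]
    simp [load, firstFive]

/-! ### Reductions -/

/-- Whoever holds `G` and knows `q` can simulate the security game for `A`. The string `x` is the
padding in register `4`, so that the advice sits in register `5`. -/
theorem exists_encodings_reduction (A : PPT) :
    ∃ B : PPT, ∀ l n k q : ℕ, ∀ G x : List Bool, G.length = k * n →
      answer B [unary l, unary n, unary k, G, x, unary q] =
        (iid (encBits n k l G) q).bind fun ys =>
          answer A [unary l, unary n, unary k, unary q, ys.flatten] := by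
  obtain ⟨B, hB⟩ := (((sampleCode 5 noisyCode).poly (D := 20) [1, 2, 5] (by decide)).seq
    ((Code.rev 6 7).poly [] (by decide)) |>.bind (poly_callDen (o := 0) (c := 1) A
      (args := [0, 1, 2, 5, 7]) (by decide) (by decide))).exists_ppt (a := 6) (by decide)
  refine ⟨B, fun l n k q G x hG => ?_⟩
  rw [answer, hB _ (by simp), Code.den, den_sampleCode
    (fun y hy => length_of_mem_support_encBits hG hy) (fun s hs => den_noisyCode hG hs) 5 ready_load
    (by simp [load]), PMF.bind_map, PMF.bind_bind, PMF.map_bind]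
  have e5 : (load [unary l, unary n, unary k, G, x, unary q] 5).length = q := by
    simp [load, unary]
  rw [e5]
  refine congrArg _ (funext fun ys => ?_)
  simp only [Function.comp, Code.den, PMF.pure_bind]
  rw [callDen, PMF.map_comp, answer]
  simp [load, Function.comp_def, overlay]

/-- Under a matrix `R`, the sequence of `i` uniform words and `q - i` noisy codewords. -/
def hybrid (n k l q i : ℕ) (R : List Bool) : PMF (List Bool) :=
  (iid (bits n) i).bind fun us => (iid (encBits n k l R) (q - i)).map fun vs =>
    us.flatten ++ vs.flatten

/-- The preparation of the numbers of uniform words and of noisy codewords for a random hybrid. -/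
def splitCode : Code :=
  .copy 5 17 ;; .pop 17 ;; .draw 5 16 ;; .copy 16 11 ;; .drop 11 17

theorem den_splitCode {s : Store} {q : ℕ} (h5 : s 5 = unary q) (h11 : s 11 = []) :
    splitCode.den s = (drawNat q).map fun i =>
      Function.update (Function.update s 16 (unary i)) 17 (unary (q - 1 - i)) := by
  simp only [splitCode, Code.den, PMF.pure_bind]
  rw [show (Function.update (Function.update s 17 (s 5)) 17 (Function.update s 17 (s 5) 17).tail 5)
    = unary q by simp [h5], PMF.bind_map, PMF.map, show (unary q).length = q by simp [unary]]
  refine congrArg _ (funext fun i => ?_)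
  refine congrArg _ (funext fun r => ?_)
  by_cases r11 : r = 11
  · subst r11; simp [h11]
  by_cases r17 : r = 17
  · subst r17; simp [h5, unary]
  by_cases r16 : r = 16
  · subst r16; simp [unary]
  simp [r11, r16, r17]

/-- Uniform words, the word in register `4`, and noisy codewords. -/
def hybridCode : Code :=
  sampleCode 16 (wordCode 1 7) ;; .copy 4 7 ;; pushCode ;; sampleCode 17 noisyCode

theorem den_hybridCode {n k l : ℕ} {G y : List Bool} (hG : G.length = k * n) (hy : y.length = n)
    {s : Store} (hs : Ready n k l G s) (h4 : s 4 = y) (h6 : s 6 = []) (h13 : s 13 = []) :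
    hybridCode.den s = (iid (bits n) (s 16).length).bind fun us =>
      (iid (encBits n k l G) (s 17).length).map fun vs =>
        Function.update s 6 (us.flatten ++ (y ++ vs.flatten)).reverse := by
  rw [hybridCode, Code.den, den_sampleCode (μ := bits n)
    (fun y hy => length_of_mem_support_iid hy) (fun s hs => den_wordCode_one hs) 16 hs h13,
    PMF.bind_map]
  refine congrArg _ (funext fun us => ?_)
  simp only [Function.comp, Code.den, PMF.pure_bind, h6]
  rw [den_pushCode (by simp [hs.r15]) (by simp [h4, hs.r1, hy]), PMF.pure_bind]
  have e : Function.update (Function.update (Function.update (Function.update s 6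
      (us.flatten.reverse ++ [])) 7 (Function.update s 6 (us.flatten.reverse ++ []) 4)) 7 []) 6
      ((Function.update (Function.update s 6
      (us.flatten.reverse ++ [])) 7 (Function.update s 6 (us.flatten.reverse ++ []) 4) 7).reverse ++
      Function.update (Function.update s 6
      (us.flatten.reverse ++ [])) 7 (Function.update s 6 (us.flatten.reverse ++ []) 4) 6)
      = Function.update s 6 (y.reverse ++ us.flatten.reverse) := by
    have h7 := hs.r7
    funext r
    simp only [Function.update_apply]
    split_ifs <;> simp_all
  rw [e, den_sampleCode (fun y hy => length_of_mem_support_encBits hG hy)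
    (fun s hs => den_noisyCode hG hs) 17 (hs.update (by simp)) (by simp [h13])]
  simp

/-- The challenge word `y` is placed at a random position `i`, after `i` uniform words and before `q
- 1 - i` noisy codewords made from the challenge matrix. -/
theorem exists_hybrid_reduction (A : PPT) :
    ∃ B : PPT, ∀ l n k q : ℕ, ∀ G y : List Bool, G.length = k * n → y.length = n →
      answer B [unary l, unary n, unary k, G, y, unary q] =
        (drawNat q).bind fun i => (iid (bits n) i).bind fun us =>
          (iid (encBits n k l G) (q - 1 - i)).bind fun vs =>
            answer A [unary l, unary n, unary k, unary q, us.flatten ++ (y ++ vs.flatten)] := by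
  obtain ⟨B, hB⟩ := (((splitCode.poly (D := 20) [] (by decide)).seq
    ((hybridCode.poly [1, 2, 16, 17] (by decide)).seq
    ((Code.rev 6 7).poly [] (by decide)))).bind (poly_callDen (o := 0) (c := 1) A
      (args := [0, 1, 2, 5, 7]) (by decide) (by decide))).exists_ppt (a := 6) (by decide)
  refine ⟨B, fun l n k q G y hG hy => ?_⟩
  rw [answer, hB _ (by simp), Code.den, den_splitCode (q := q) (by simp [load]) (by simp [load]),
    PMF.bind_map, PMF.bind_bind, PMF.map_bind]
  refine congrArg _ (funext fun i => ?_)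
  rw [Function.comp, Code.den, den_hybridCode (y := y) hG hy
    ((ready_load.update (by simp)).update (by simp)) (by simp [load]) (by simp [load])
    (by simp [load]), PMF.bind_bind, PMF.bind_bind, PMF.map_bind]
  simp only [Function.update_self, ne_eq, Nat.reduceEqDiff, not_false_eq_true,
    Function.update_of_ne, unary, List.length_replicate]
  refine congrArg _ (funext fun us => ?_)
  rw [PMF.bind_map, PMF.map_bind]
  refine congrArg _ (funext fun vs => ?_)
  simp only [Function.comp, Code.den, PMF.pure_bind]
  rw [callDen, PMF.map_comp, answer]
  simp [load, Function.comp_def, overlay]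

/-- Together with `hybrid_of_lt`: hybrids `i` and `i + 1` have the same form and differ only in the
distribution of the word `y` at position `i`. -/
theorem hybrid_succ_left (n k l q i : ℕ) (R : List Bool) :
    hybrid n k l q (i + 1) R = (bits n).bind fun y => (iid (bits n) i).bind fun us =>
      (iid (encBits n k l R) (q - 1 - i)).map fun vs => us.flatten ++ (y ++ vs.flatten) := by
  rw [hybrid, iid_add, iid_one, PMF.bind_bind, PMF.bind_comm]
  refine congrArg _ (funext fun us => ?_)
  rw [PMF.map_comp, PMF.bind_map, show q - (i + 1) = q - 1 - i by omega]
  simp [Function.comp_def]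

theorem hybrid_of_lt {n k l q i : ℕ} (hi : i < q) (R : List Bool) :
    hybrid n k l q i R = (encBits n k l R).bind fun y => (iid (bits n) i).bind fun us =>
      (iid (encBits n k l R) (q - 1 - i)).map fun vs => us.flatten ++ (y ++ vs.flatten) := by
  rw [hybrid, PMF.bind_comm]
  refine congrArg _ (funext fun us => ?_)
  rw [show q - i = (q - 1 - i) + 1 by omega, iid_succ, PMF.map_bind]
  refine congrArg _ (funext fun y => ?_)
  rw [PMF.map_comp]
  simp [Function.comp_def]

/-- The probability that the adversary answers `true` on a hybrid. -/
def hybridPr (A : PPT) (n k l q i : ℕ) : ℝ :=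
  pr (((bits (k * n)).bind (hybrid n k l q i)).bind fun w =>
    answer A [unary l, unary n, unary k, unary q, w])

theorem exists_adv_decodingGame (A : PPT) :
    ∃ B : PPT, ∀ l n k q : ℕ, hybridPr A n k l q q - hybridPr A n k l q 0 =
      q * adv B fun b => (decodingGame n k l b).map fun inp => inp ++ [unary q] := by
  obtain ⟨B, hB⟩ := exists_hybrid_reduction A
  refine ⟨B, fun l n k q => ?_⟩
  rcases Nat.eq_zero_or_pos q with rfl | hq
  · simp
  -- In case `b` the reduction produces hybrid `i + b`, with `i` uniform below `q`.
  have key : ∀ b : Bool, pr (((decodingGame n k l b).map fun inp => inp ++ [unary q]).bind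
      (answer B)) = (∑ i ∈ Finset.range q, hybridPr A n k l q (i + b.toNat)) / q := by
    intro b
    have h : ((decodingGame n k l b).map fun inp => inp ++ [unary q]).bind (answer B)
        = (drawNat q).bind fun i => (bits (k * n)).bind fun R =>
          (if b then bits n else encBits n k l R).bind fun y => (iid (bits n) i).bind fun us =>
          (iid (encBits n k l R) (q - 1 - i)).bind fun vs =>
            answer A [unary l, unary n, unary k, unary q, us.flatten ++ (y ++ vs.flatten)] := by
      rw [PMF.bind_comm, decodingGame, PMF.bind_map, PMF.bind_bind]
      refine bind_congr_of_support fun R hR => ?_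
      have hR' : R.length = k * n := length_of_mem_support_iid hR
      rw [PMF.bind_map, PMF.bind_comm]
      refine bind_congr_of_support fun y hy => ?_
      refine hB l n k q R y hR' ?_
      cases b
      · exact length_of_mem_support_encBits hR' hy
      · exact length_of_mem_support_iid hy
    rw [h, pr_drawNat_bind hq]
    congr 1
    refine Finset.sum_congr rfl fun i hi => ?_
    have hi' := Finset.mem_range.1 hi
    rw [hybridPr]
    congr 1
    rw [PMF.bind_bind]
    refine congrArg _ (funext fun R => ?_)
    cases b
    · rw [Bool.toNat_false, Nat.add_zero, hybrid_of_lt hi']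
      simp only [PMF.bind_bind, PMF.bind_map, Function.comp_def]
      simp
    · rw [Bool.toNat_true, hybrid_succ_left]
      simp only [PMF.bind_bind, PMF.bind_map, Function.comp_def]
      simp
  have hq' : (q : ℝ) ≠ 0 := by exact_mod_cast hq.ne'
  rw [adv, key, key, ← sub_div, ← Finset.sum_sub_distrib, mul_div_cancel₀ _ hq']
  -- The sum over `i` of the differences of adjacent hybrids telescopes.
  exact (Finset.sum_range_sub (fun i => hybridPr A n k l q i) q).symm

/-! ### The scheme -/

/-- The encoder is certified piecewise: `prepareCode` computes register `1`, which the later pieces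
need as a protected loop bound. -/
theorem poly_encCode : Poly 20 encCode.den := by
  have hp : Poly 20 prepareCode.den :=
    ((Code.copy 3 9).poly [] (by decide)).seq <| ((Code.copy 1 3).poly [] (by decide)).seq <|
    ((Code.copy 9 2).poly [] (by decide)).seq <| ((Code.copy 3 10).poly [] (by decide)).seq <|
    ((Code.clear 1).poly [] (by decide)).seq <|
    (Code.iter 3 13 divideStep).poly [3, 2] (by decide)
  exact hp.seq <| (errCode.poly [1] (by decide)).seq <| (mulCode.poly [1, 2] (by decide)).seq <|
    (Code.copy 7 0).poly [] (by decide)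

variable {n k : ℕ → ℕ} {gopGen : ∀ l, PMF (GoppaKey (n l) (k l))}
  {gopDec : ∀ l, GoppaKey (n l) (k l) → Word (n l) → PMF (Word (k l))}

/-- A code that tolerates `w` errors and more has length at least `w`, if it encodes at least one
bit. -/
theorem le_length_of_toleratesErrors {w : ℕ → ℕ} {e : ℕ → ℝ} (hk : ∀ l, 0 < l → 0 < k l)
    (he : ∀ l, 0 < l → (w l : ℝ) ≤ e l) (h : (goppaFamily gopGen gopDec).ToleratesErrors e)
    {l : ℕ} (hl : 0 < l) : w l ≤ n l := by
  by_contra! hlt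
  obtain ⟨sk, hsk⟩ := (gopGen l).support_nonempty
  -- If `n < w`, the zero word is within the tolerated distance of every codeword, so it would have
  -- to decode to every message.
  have h0 : ∀ x : Word (k l), gopDec l sk 0 = PMF.pure x := fun x => by
    refine h l hl sk hsk x _ ((PMF.mem_support_pure_iff _ _).2 rfl) 0 (le_trans ?_ (he l hl))
    have := hammingDist_le_card_fintype (x := Matrix.vecMul x sk.1) (y := (0 : Word (n l)))
    rw [Fintype.card_fin] at this
    exact_mod_cast this.trans hlt.le
  have h1 : (PMF.pure (0 : Word (k l))).support = (PMF.pure (1 : Word (k l))).support := by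
    rw [← h0, ← h0]
  rw [PMF.support_pure, PMF.support_pure, Set.singleton_eq_singleton_iff] at h1
  -- For `k > 0` the all-zero and all-one messages differ.
  exact zero_ne_one (congrFun h1 ⟨0, hk l hl⟩)

theorem efficientEnc_goppaRSE (hk : ∀ l, 0 < l → 0 < k l) (hn : ∀ l, 0 < l → l ≤ n l) :
    (goppaRSE gopGen gopDec).EfficientEnc := by
  obtain ⟨M, hM⟩ := poly_encCode.exists_ppt (a := 4) (by decide)
  refine ⟨M, fun l hl sk _ x => ?_⟩
  change (M.out [unary l, matBits sk.1, sk.2, wordBits x]).map (fun s => s 0)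
    = ((randomError (n l) l).map fun z => Matrix.vecMul x sk.1 + z).map wordBits
  rw [hM _ (by simp), den_encCode (hk l hl) (length_wordBits x) (length_matBits sk.1),
    map_wordBits_enc (hn l hl), unary, List.length_replicate]

theorem toleratesErrors_goppaRSE {e : ℕ → ℝ}
    (h : (goppaFamily gopGen gopDec).ToleratesErrors fun l => l + e l) :
    (goppaRSE gopGen gopDec).ToleratesErrors e := by
  intro l hl sk hsk x y hy y' hy'
  obtain ⟨z, hz, rfl⟩ := (PMF.mem_support_map_iff _ _ _).1 hy
  refine h l hl sk hsk x (Matrix.vecMul x sk.1) ((PMF.mem_support_pure_iff _ _).2 rfl) y' ?_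
  have h1 := hammingDist_triangle (Matrix.vecMul x sk.1) (Matrix.vecMul x sk.1 + z) y'
  have h2 : hammingDist (Matrix.vecMul x sk.1) (Matrix.vecMul x sk.1 + z) ≤ l := by
    rw [hammingDist_eq_hammingNorm]
    refine (congrArg hammingNorm (neg_add_cancel_left _ z)).trans_le ?_
    exact hammingNorm_randomError_le hz
  have h3 : (hammingDist (Matrix.vecMul x sk.1) y' : ℝ) ≤
      (l + hammingDist (Matrix.vecMul x sk.1 + z) y' : ℕ) := by exact_mod_cast h1.trans (by omega)
  push_cast at h3
  change ((hammingDist (Matrix.vecMul x sk.1) y' : ℕ) : ℝ) ≤ l + e l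
  change ((hammingDist (Matrix.vecMul x sk.1 + z) y' : ℕ) : ℝ) ≤ e l at hy'
  linarith

/-! ### Security -/

/-- The assumption in terms of matrices is carried over to bit strings: a uniform matrix is a
uniform string of length `k * n`. -/
theorem indistinguishable_matrixGame (h : GoppaRandomIndist gopGen) :
    Indistinguishable fun l b =>
      matrixGame ((gopGen l).map fun sk => matBits sk.1) (n l) (k l) l b := by
  refine Indistinguishable.congr h fun l _ A b => ?_
  have e : matrixGame ((gopGen l).map fun sk => matBits sk.1) (n l) (k l) l b =
      ((if b then (gopGen l).map Prod.fst else PMF.uniformOfFintype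
        (Matrix (Fin (k l)) (Fin (n l)) (ZMod 2))).map matBits).map fun G =>
          [unary l, unary (n l), unary (k l), G] ++ [[]] := by
    cases b
    · simp only [matrixGame, Bool.false_eq_true, if_false, uniform_map_matBits]
      rfl
    · simp only [matrixGame, if_true, PMF.map_comp]
      rfl
  rw [e, PMF.bind_map, PMF.bind_map]
  simp only [Function.comp_def, answer_append_nil]
  cases b
  · change (PMF.bind _ fun G => PMF.pure _).bind _ = _
    simp only [PMF.bind_bind, PMF.pure_bind]
    rfl
  · change (PMF.bind _ fun G => PMF.pure _).bind _ = _
    simp only [PMF.bind_bind, PMF.pure_bind]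
    rfl

theorem indistinguishable_decodingGame (hn : ∀ l, 0 < l → l ≤ n l)
    (h : AverageDecodingHard n k) :
    Indistinguishable fun l b => decodingGame (n l) (k l) l b := by
  refine Indistinguishable.congr h fun l hl A b => congrArg (fun μ => PMF.bind μ (answer A)) ?_
  change (PMF.uniformOfFintype _).bind (fun R => (PMF.uniformOfFintype _).bind fun x =>
    (randomError (n l) l).bind fun e => (PMF.uniformOfFintype _).bind fun u =>
      PMF.pure [unary l, unary (n l), unary (k l), matBits R,
        wordBits (if b then u else Matrix.vecMul x R + e)]) = _
  rw [decodingGame, ← uniform_map_matBits, PMF.bind_map]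
  refine congrArg _ (funext fun R => ?_)
  cases b
  -- The original game draws `x`, `e` and `u` in both cases; draws that do not enter the output
  -- integrate out.
  · simp only [Bool.false_eq_true, if_false, PMF.bind_const, Function.comp]
    rw [← uniform_bind_enc (hn l hl), PMF.map_comp, PMF.map_bind]
    refine congrArg _ (funext fun x => ?_)
    rw [PMF.map_comp]
    rfl
  · simp only [if_true, PMF.bind_const, Function.comp]
    rw [← uniform_map_wordBits, PMF.map_comp]
    rfl

theorem challenge_false_bind (hn : ∀ l, 0 < l → l ≤ n l) {q l : ℕ} (hl : 0 < l)
    (f : List (List Bool) → PMF Bool) :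
    ((goppaRSE gopGen gopDec).challenge q l false).bind f =
      ((gopGen l).map fun sk => matBits sk.1).bind fun G =>
        (iid (encBits (n l) (k l) l G) q).bind fun ys =>
          f [unary l, unary (n l), unary (k l), unary q, ys.flatten] := by
  change ((gopGen l).bind fun sk => (iid ((PMF.uniformOfFintype (Word (k l))).bind fun x =>
    (randomError (n l) l).map fun z => Matrix.vecMul x sk.1 + z) q).bind fun R =>
      PMF.pure [unary l, unary (n l), unary (k l), unary q, (R.map wordBits).flatten]).bind f = _
  simp only [PMF.bind_bind, PMF.pure_bind, PMF.bind_map, Function.comp_def]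
  refine congrArg _ (funext fun sk => ?_)
  rw [← uniform_bind_enc (hn l hl), iid_map, PMF.bind_map]
  rfl

theorem challenge_true_bind (q l : ℕ) (f : List (List Bool) → PMF Bool) :
    ((goppaRSE gopGen gopDec).challenge q l true).bind f =
      (iid (bits (n l)) q).bind fun ys =>
          f [unary l, unary (n l), unary (k l), unary q, ys.flatten] := by
  change ((gopGen l).bind fun sk => (iid (PMF.uniformOfFintype (Word (n l))) q).bind fun R =>
      PMF.pure [unary l, unary (n l), unary (k l), unary q, (R.map wordBits).flatten]).bind f = _
  simp only [PMF.bind_const, PMF.bind_bind, PMF.pure_bind]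
  rw [← uniform_map_wordBits, iid_map, PMF.bind_map]
  rfl

/-- The last hybrid no longer depends on the matrix and is the ideal case of the security game;
`hybridPr_zero` identifies the first one with encodings under a uniform matrix. -/
theorem hybridPr_self (A : PPT) (n k l q : ℕ) :
    hybridPr A n k l q q = pr ((iid (bits n) q).bind fun ys =>
      answer A [unary l, unary n, unary k, unary q, ys.flatten]) := by
  simp only [hybridPr, hybrid, Nat.sub_self, iid_zero, PMF.pure_map, List.flatten_nil,
    List.append_nil, PMF.bind_const, PMF.bind_bind, PMF.pure_bind]

theorem hybridPr_zero (A : PPT) (n k l q : ℕ) :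
    hybridPr A n k l q 0 = pr ((bits (k * n)).bind fun G => (iid (encBits n k l G) q).bind fun ys =>
      answer A [unary l, unary n, unary k, unary q, ys.flatten]) := by
  simp only [hybridPr, hybrid, Nat.sub_zero, iid_zero, PMF.pure_bind, PMF.bind_bind, PMF.bind_map,
    Function.comp_def, List.flatten_nil, List.nil_append]

theorem secure_goppaRSE (hn : ∀ l, 0 < l → l ≤ n l)
    (hGen : (goppaFamily gopGen gopDec).EfficientGen) (hADP : AverageDecodingHard n k)
    (hGD : GoppaRandomIndist gopGen) {q : ℕ → ℕ} (hq : ∃ p : ℕ[X], ∀ l, q l ≤ p.eval l) :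
    Indistinguishable fun l => (goppaRSE gopGen gopDec).challenge (q l) l := by
  obtain ⟨M, hM⟩ := hGen
  have hM' : ∀ l, 0 < l → (M.out [unary l]).map (fun s => s 0)
      = (gopGen l).map fun sk => matBits sk.1 := fun l hl => by
    have := congrArg (PMF.map fun f => f (0 : Fin 2)) (hM l hl)
    rw [PMF.map_comp, PMF.map_comp] at this
    exact this
  obtain ⟨S₁, hS₁⟩ := exists_matrix_sampler n k M hM'
  obtain ⟨S₂, hS₂⟩ := exists_decoding_sampler n k
  have h₁ := (indistinguishable_matrixGame hGD).advice (fun l b inp hinp => by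
    obtain ⟨G, -, rfl⟩ := (PMF.mem_support_map_iff _ _ _).1 hinp
    exact ⟨_, _, _, _, rfl⟩) S₁ hS₁ hq
  have h₂ := (indistinguishable_decodingGame hn hADP).advice (fun l b inp hinp => by
    obtain ⟨R, -, h⟩ := (PMF.mem_support_bind_iff _ _ _).1 hinp
    obtain ⟨y, -, rfl⟩ := (PMF.mem_support_map_iff _ _ _).1 h
    exact ⟨_, _, _, _, rfl⟩) S₂ hS₂ hq
  rw [indistinguishable_iff] at h₁ h₂ ⊢
  intro A
  obtain ⟨B₁, hB₁⟩ := exists_encodings_reduction A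
  obtain ⟨B₂, hB₂⟩ := exists_adv_decodingGame A
  obtain ⟨ε₁, hε₁, h₁⟩ := h₁ B₁
  obtain ⟨ε₂, hε₂, h₂⟩ := h₂ B₂
  obtain ⟨C, d, hCd⟩ := exists_lt_mul_pow hq
  refine ⟨_, (negligible_poly_mul hε₂ C d).add hε₁, fun l hl => ?_⟩
  have h₁ := h₁ l hl
  have h₂ := h₂ l hl
  have hB₂ := hB₂ l (n l) (k l) (q l)
  have hB₁' : ∀ μ : PMF (List Bool), (∀ G ∈ μ.support, G.length = k l * n l) →
      ((μ.map fun G => [unary l, unary (n l), unary (k l), G, []]).map fun inp =>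
        inp ++ [unary (q l)]).bind (answer B₁) = μ.bind fun G =>
          (iid (encBits (n l) (k l) l G) (q l)).bind fun ys =>
            answer A [unary l, unary (n l), unary (k l), unary (q l), ys.flatten] := fun μ hμ => by
    rw [PMF.bind_map, PMF.bind_map]
    exact bind_congr_of_support fun G hG => hB₁ l (n l) (k l) (q l) G [] (hμ G hG)
  -- Passing from uniform words to encodings under `G` goes through encodings under a uniform
  -- matrix, which are hybrid `0`. The sign of the last term comes from the Goppa matrix being case
  -- `true` of its game, while encodings are case `false` of the security game.
  have key : adv A (fun b => (goppaRSE gopGen gopDec).challenge (q l) l b) =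
      (hybridPr A (n l) (k l) l (q l) (q l) - hybridPr A (n l) (k l) l (q l) 0) -
      adv B₁ fun b => (matrixGame ((gopGen l).map fun sk => matBits sk.1) (n l) (k l) l b).map
        fun inp => inp ++ [unary (q l)] := by
    rw [adv, adv, challenge_true_bind, challenge_false_bind hn hl, hybridPr_self, hybridPr_zero,
      matrixGame, matrixGame, if_pos rfl, if_neg (by decide), hB₁', hB₁']
    · ring
    · exact fun G hG => length_of_mem_support_iid hG
    · intro G hG
      obtain ⟨sk, -, rfl⟩ := (PMF.mem_support_map_iff _ _ _).1 hG
      exact length_matBits sk.1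
  change |adv A (fun b => (goppaRSE gopGen gopDec).challenge (q l) l b)| ≤
    ((C * l ^ d : ℕ) : ℝ) * ε₂ l + ε₁ l
  rw [key, hB₂]
  refine (abs_sub _ _).trans (add_le_add ?_ h₁)
  rw [abs_mul, Nat.abs_cast]
  -- The hybrid argument loses a factor `q l`, which is below `C * l ^ d`; so the bound remains
  -- negligible.
  exact mul_le_mul (by exact_mod_cast (hCd l hl).le) h₂ (abs_nonneg _) (Nat.cast_nonneg _)

end RobustEnc
end

open RobustEnc in
theorem mainTheorem5
    (n k m t : ℕ → ℕ) (δ : ℕ → ℝ)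
    (hk : ∀ l, 0 < l → 0 < k l) (hδ : ∀ l, 0 < l → 0 < δ l)
    (gopGen : ∀ l, PMF (GoppaKey (n l) (k l)))
    (gopDec : ∀ l, GoppaKey (n l) (k l) → Word (n l) → PMF (Word (k l)))
    (hGoppa : ∀ l, 0 < l → ∀ sk ∈ (gopGen l).support,
      ∃ C : Set (Word (n l)), IsGoppaCode (m l) (t l) C ∧ IsGenerator sk.1 C)
    (hGen : (goppaFamily gopGen gopDec).EfficientGen)
    (hDec : (goppaFamily gopGen gopDec).EfficientDec)
    (hTol : (goppaFamily gopGen gopDec).ToleratesErrors fun l => l + δ l * n l)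
    (hADP : AverageDecodingHard n k)
    (hGD : GoppaRandomIndist gopGen) :
    (goppaRSE gopGen gopDec).IsRSE δ := by
  have hn : ∀ l, 0 < l → l ≤ n l := fun l hl =>
    le_length_of_toleratesErrors (w := fun l => l) hk (fun l hl => by
      have := mul_nonneg (hδ l hl).le (Nat.cast_nonneg (α := ℝ) (n l))
      simpa using this) hTol hl
  exact ⟨hGen, efficientEnc_goppaRSE hk hn, hDec, toleratesErrors_goppaRSE hTol,
    fun q hq => secure_goppaRSE hn hGen hADP hGD hq⟩
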